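/- **Setting.** Let $(X,d)$ be an unbounded proper metric space (closed balls are compact) of bounded geometry: there is $\varepsilon>0$ such that for each $r>0$ there is $N_r\in\mathbb N$ such that every ball $B(x,r)$ is covered by at most $N_r$ open balls of radius $\varepsilon$. Assume that $X$ has property A$'$: for every $t>0$ there are non-zero measurable $\varrho_{j}\colon X\to[0,1]$ ($j\in\mathbb N$) such that $\sum_j\varrho_{j}(x)=1$ for all $x\in X$; $\sup_j\operatorname{diam}(\operatorname{supp}\varrho_{j})<\infty$; $d(x,y)\le\frac1t$ implies $\sum_j|\varrho_{j}(x)-\varrho_{j}(y)|<t$; and every ball meets only finitely many of the sets $\operatorname{supp}\varrho_{j}$. Let $\mu$ be a Radon measure on $X$, let $1<p<\infty$, let $L_p=L_p(X,\mu)$ be the complex Lebesgue space, let $\beta X$ be the Stone–Čech compactification of $X$ and $\Gamma X=\beta X\setminus X$. Write $M_f$ for multiplication by $f$, $\mathcal L(E)$ for the bounded and $\mathcal K(E)$ for the compact operators on $E$. *Band-dominated operators.* For $B\in\mathcal L(L_p)$ let $\operatorname{prop}(B)=\sup\{\operatorname{dist}(K,K'): K,K'\subseteq X \text{ measurable},\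 M_{\mathbf 1_{K'}}BM_{\mathbf 1_K}\ne0\}$. $\mathrm{BDO}^p$ is the norm closure in $\mathcal L(L_p)$ of $\{B:\operatorname{prop}(B)<\infty\}$. *Projection.* Let $M^p\subseteq L_p$ be a closed subspace, $P\in\mathrm{BDO}^p$ a bounded projection of $L_p$ onto $M^p$, $Q=I-P$, and assume that $M_{\mathbf 1_K}P$ and $PM_{\mathbf 1_K}$ are compact for all compact $K\subseteq X$. *Shifts.* Let $x_0\in X$. For each $x\in X$ let $\phi_x\colon X\to X$ be a bijective isometry with $\phi_x(x_0)=x$, assume $\mu\circ\phi_x\ll\mu\ll\mu\circ\phi_x$, and let $h_x\colon X\to\mathbb C$ be measurable with $|h_x|^p=\frac{d(\mu\circ\phi_x)}{d\mu}$ $\mu$-a.e. Assume that for $\mu$-almost every $y\in X$ the maps $x\mapsto\phi_x(y)$ and $x\mapsto h_x(y)$ are continuous. Let $U_x\colon L_p\to L_p$ be the surjective isometry $U_xf=(f\circ\phi_x)\cdot h_x$. Assume that for all compact $K,K'\subseteq X$ the map $x\mapsto M_{\mathbf 1_K}U_xPU_x^{-1}M_{\mathbf 1_{K'}}$ extends to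 a norm-continuous map $\beta X\to\mathcal L(L_p)$. *Limit operators.* For $B\in\mathcal L(L_p)$ and $x\in\Gamma X$ let $B_x$ be the limit, in the weak operator topology, of $U_yBU_y^{-1}$ as $y\in X$ tends to $x$ in $\beta X$. Let $\mathcal A^p$ be the set of all $A\in\mathcal L(M^p)$ with $AP\in\mathrm{BDO}^p$; for $A\in\mathcal A^p$ and $x\in\Gamma X$ let $A_x=(AP)_x|_{\operatorname{ran}P_x}$ and $\hat A_x=A_xP_x+Q_x$. **Theorem.** Let $A\in\mathcal A^p$. For every $x\in\Gamma X$ the limits $P_x$, $Q_x$, $(AP)_x$ exist and $(AP)_x$ maps $\operatorname{ran}P_x$ into itself, so that $A_x\in\mathcal L(\operatorname{ran}P_x)$ and $\hat A_x\in\mathcal L(L_p)$ are well defined. The following are equivalent: (a) $A$ is Fredholm; (b) $A_x$ is invertible in $\mathcal L(\operatorname{ran}P_x)$ for all $x\in\Gamma X$, and $\sup_{x\in\Gamma X}\|A_x^{-1}\|<\infty$; (c) $A_x$ is invertible in $\mathcal L(\operatorname{ran}P_x)$ for all $x\in\Gamma X$; (d) $\hat A_x$ is invertible in $\mathcal L(L_p)$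 for all $x\in\Gamma X$. Moreover, if one of these holds, then $A+\mathcal K(M^p)$ is invertible in the Calkin algebra $\mathcal L(M^p)/\mathcal K(M^p)$ (with its quotient norm) and $\|A_x^{-1}\|\le\|(A+\mathcal K(M^p))^{-1}\|$ for all $x\in\Gamma X$. -/

import Mathlib

open MeasureTheory Filter Topology Set
open scoped ENNReal

set_option linter.unusedSectionVars false

noncomputable section

namespace LimitOperators

/-! ### Metric notions -/

/-- Bounded geometry: for some `ε > 0`, every ball of radius `r` is covered by at most `N r` open
balls of radius `ε`, where `N r` does not depend on the centre. -/
def BoundedGeometry (X : Type*) [MetricSpace X] : Prop :=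
  ∃ ε : ℝ, 0 < ε ∧ ∀ r : ℝ, 0 < r → ∃ N : ℕ, ∀ x : X, ∃ s : Finset X,
    s.card ≤ N ∧ Metric.ball x r ⊆ ⋃ y ∈ s, Metric.ball y ε

/-- Property A′.  The uniform bound on the diameters of the supports is written with an explicit
constant, because the real-valued diameter of an unbounded set is `0` by convention. -/
def PropertyA' (X : Type*) [MetricSpace X] [MeasurableSpace X] : Prop :=
  ∀ t : ℝ, 0 < t → ∃ ρ : ℕ → X → ℝ,
    (∀ j, Measurable (ρ j) ∧ ρ j ≠ 0 ∧ ∀ x, ρ j x ∈ Icc (0 : ℝ) 1) ∧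
    (∀ x, HasSum (fun j => ρ j x) 1) ∧
    (∃ D : ℝ, ∀ j, ∀ x ∈ tsupport (ρ j), ∀ y ∈ tsupport (ρ j), dist x y ≤ D) ∧
    (∀ x y, dist x y ≤ 1 / t →
      Summable (fun j => |ρ j x - ρ j y|) ∧ ∑' j, |ρ j x - ρ j y| < t) ∧
    (∀ (x : X) (s : ℝ), 0 < s → {j | (tsupport (ρ j) ∩ Metric.ball x s).Nonempty}.Finite)

/-- The distance `inf {d(x, y) : x ∈ K, y ∈ K'}` between two sets (`∞` if one of them is empty). -/
def setDist {X : Type*} [MetricSpace X] (K K' : Set X) : ℝ≥0∞ :=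
  ⨅ x ∈ K, ⨅ y ∈ K', edist x y

/-- The boundary `ΓX = βX ∖ X` of the Stone–Čech compactification. -/
def boundary (X : Type*) [TopologicalSpace X] : Set (StoneCech X) :=
  (range (stoneCechUnit : X → StoneCech X))ᶜ

/-! ### Band-dominated operators -/

section Band

variable {X : Type*} [MeasurableSpace X] {μ : Measure X} {p : ℝ≥0∞} [Fact (1 ≤ p)]

/-- Multiplication by the indicator function of a measurable set, as a linear map on `L_p`. -/
def mulIndLinear (μ : Measure X) (p : ℝ≥0∞) {s : Set X} (hs : MeasurableSet s) :
    Lp ℂ p μ →ₗ[ℂ] Lp ℂ p μ where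
  toFun f := ((Lp.memLp f).indicator hs).toLp (s.indicator f)
  map_add' f g := by
    rw [← MemLp.toLp_add]
    refine MemLp.toLp_congr _ _ ?_
    filter_upwards [Lp.coeFn_add f g] with y hy
    rw [Pi.add_apply] at hy ⊢
    by_cases h : y ∈ s
    · rw [indicator_of_mem h, indicator_of_mem h, indicator_of_mem h, hy]
    · rw [indicator_of_notMem h, indicator_of_notMem h, indicator_of_notMem h, add_zero]
  map_smul' c f := by
    rw [RingHom.id_apply, ← MemLp.toLp_const_smul]
    refine MemLp.toLp_congr _ _ ?_
    filter_upwards [Lp.coeFn_smul c f] with y hy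
    rw [Pi.smul_apply] at hy ⊢
    by_cases h : y ∈ s
    · rw [indicator_of_mem h, indicator_of_mem h, hy]
    · rw [indicator_of_notMem h, indicator_of_notMem h, smul_zero]

theorem mulIndLinear_ae (μ : Measure X) (p : ℝ≥0∞) {s : Set X} (hs : MeasurableSet s)
    (f : Lp ℂ p μ) : mulIndLinear μ p hs f =ᵐ[μ] s.indicator f := by
  have h2 : MemLp (s.indicator (f : X → ℂ)) p μ := (Lp.memLp f).indicator hs
  have h1 : mulIndLinear μ p hs f = h2.toLp (s.indicator f) := rfl
  rw [h1]
  exact h2.coeFn_toLp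

theorem mulIndLinear_norm_le (μ : Measure X) (p : ℝ≥0∞) {s : Set X} (hs : MeasurableSet s)
    (f : Lp ℂ p μ) : ‖mulIndLinear μ p hs f‖ ≤ 1 * ‖f‖ := by
  rw [one_mul]
  refine Lp.norm_le_norm_of_ae_le ?_
  filter_upwards [mulIndLinear_ae μ p hs f] with y hy
  rw [hy]
  exact norm_indicator_le_norm_self (f : X → ℂ) y

/-- The operator of multiplication by the indicator function of a measurable set on `L_p`. -/
def mulInd (μ : Measure X) (p : ℝ≥0∞) [Fact (1 ≤ p)] {s : Set X} (hs : MeasurableSet s) :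
    Lp ℂ p μ →L[ℂ] Lp ℂ p μ :=
  (mulIndLinear μ p hs).mkContinuous 1 (mulIndLinear_norm_le μ p hs)

theorem mulInd_ae {s : Set X} (hs : MeasurableSet s) (f : Lp ℂ p μ) :
    mulInd μ p hs f =ᵐ[μ] s.indicator f :=
  mulIndLinear_ae μ p hs f

variable [MetricSpace X]

/-- The propagation (band width) of an operator on `L_p`. -/
def propagation (A : Lp ℂ p μ →L[ℂ] Lp ℂ p μ) : ℝ≥0∞ :=
  ⨆ (K : Set X) (K' : Set X) (hK : MeasurableSet K) (hK' : MeasurableSet K')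
    (_ : mulInd μ p hK' ∘L A ∘L mulInd μ p hK ≠ 0), setDist K K'

/-- The band operators: operators of finite propagation. -/
def BO (μ : Measure X) (p : ℝ≥0∞) [Fact (1 ≤ p)] : Set (Lp ℂ p μ →L[ℂ] Lp ℂ p μ) :=
  {A | propagation A < ∞}

/-- The band-dominated operators: the norm closure of the band operators. -/
def BDO (μ : Measure X) (p : ℝ≥0∞) [Fact (1 ≤ p)] : Set (Lp ℂ p μ →L[ℂ] Lp ℂ p μ) :=
  closure (BO μ p)

end Band

/-- The operator `AP` on `E`, for an operator `A` on a subspace `M` and a bounded projection `P`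
of `E` onto `M`. -/
def extend {E : Type*} [NormedAddCommGroup E] [NormedSpace ℂ E] {M : Submodule ℂ E}
    {P : E →L[ℂ] E} (hP : LinearMap.IsProj M P.toLinearMap) (A : M →L[ℂ] M) : E →L[ℂ] E :=
  M.subtypeL ∘L A ∘L P.codRestrict M hP.map_mem

/-! ### Calkin algebra -/

/-- The two-sided ideal `K(E)` of compact operators in `L(E)`. -/
def compactIdeal (E : Type*) [NormedAddCommGroup E] [NormedSpace ℂ E] : Ideal (E →L[ℂ] E) where
  carrier := {T | IsCompactOperator T}
  add_mem' := fun hS hT => IsCompactOperator.add hS hT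
  zero_mem' := isCompactOperator_zero
  smul_mem' := fun S _ hT => IsCompactOperator.clm_comp hT S

instance (E : Type*) [NormedAddCommGroup E] [NormedSpace ℂ E] : (compactIdeal E).IsTwoSided :=
  ⟨fun T hS => IsCompactOperator.comp_clm hS T⟩

/-- The Calkin algebra `L(E) / K(E)`. -/
abbrev Calkin (E : Type*) [NormedAddCommGroup E] [NormedSpace ℂ E] : Type _ :=
  (E →L[ℂ] E) ⧸ compactIdeal E

/-- The quotient norm on the Calkin algebra: `‖T + K(E)‖ = inf {‖T + K‖ : K ∈ K(E)}`. -/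
instance (E : Type*) [NormedAddCommGroup E] [NormedSpace ℂ E] : Norm (Calkin E) :=
  ⟨fun a => sInf (norm '' {T : E →L[ℂ] E | Ideal.Quotient.mk (compactIdeal E) T = a})⟩

/-! ### Shifts -/

/-- A system of shifts on `X`, for an exponent `1 < p < ∞`: bijective isometries `φ x` with
`φ x x₀ = x`, such that `μ ∘ φ x` and `μ` are mutually absolutely continuous, and measurable
functions `h x` with `|h x| ^ p = d(μ ∘ φ x)/dμ` almost everywhere, such that `x ↦ φ x y` and
`x ↦ h x y` are continuous for almost every `y`.  Here `μ.map (φ x).symm` is the measure `μ ∘ φ x`,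
that is `E ↦ μ (φ x '' E)`. -/
structure ShiftSystem {X : Type*} [MetricSpace X] [MeasurableSpace X]
    (μ : Measure X) (p : ℝ≥0∞) where
  one_lt : 1 < p
  lt_top : p < ∞
  x₀ : X
  φ : X → X ≃ᵢ X
  φ_base : ∀ x, φ x x₀ = x
  map_ac : ∀ x, μ.map (φ x).symm ≪ μ
  ac_map : ∀ x, μ ≪ μ.map (φ x).symm
  h : X → X → ℂ
  measurable_h : ∀ x, Measurable (h x)
  norm_h : ∀ x, ∀ᵐ y ∂μ,
    ENNReal.ofReal (‖h x y‖ ^ p.toReal) = (μ.map (φ x).symm).rnDeriv μ y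
  continuous : ∀ᵐ y ∂μ, Continuous (fun x => φ x y) ∧ Continuous (fun x => h x y)

namespace ShiftSystem

variable {X : Type*} [MetricSpace X] [ProperSpace X] [MeasurableSpace X] [BorelSpace X]
  {μ : Measure X} [μ.Regular] {p : ℝ≥0∞} [Fact (1 ≤ p)] (S : ShiftSystem μ p)

theorem measurable_φ (x : X) : Measurable (S.φ x) := (S.φ x).continuous.measurable

theorem measurable_φ_symm (x : X) : Measurable (S.φ x).symm := (S.φ x).symm.continuous.measurable

theorem sigmaFinite_map (x : X) : SigmaFinite (μ.map (S.φ x).symm) :=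
  (S.φ x).symm.toHomeomorph.toMeasurableEquiv.sigmaFinite_map

/-- The map `φ x` preserves null sets. -/
theorem quasi (x : X) : Measure.QuasiMeasurePreserving (S.φ x) μ μ := by
  refine ⟨S.measurable_φ x, ?_⟩
  refine Measure.AbsolutelyContinuous.mk fun s hs h0 => ?_
  rw [Measure.map_apply (S.measurable_φ x) hs]
  refine S.ac_map x ?_
  rw [Measure.map_apply (S.measurable_φ_symm x) ((S.measurable_φ x) hs)]
  convert h0 using 2
  ext y
  simp

theorem quasi_symm (x : X) : Measure.QuasiMeasurePreserving (S.φ x).symm μ μ :=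
  ⟨S.measurable_φ_symm x, S.map_ac x⟩

theorem h_ne_zero (x : X) : ∀ᵐ y ∂μ, S.h x y ≠ 0 := by
  have := S.sigmaFinite_map x
  filter_upwards [S.norm_h x, Measure.rnDeriv_pos' (S.ac_map x)] with y h1 h2 h3
  rw [← h1, h3, norm_zero, Real.zero_rpow, ENNReal.ofReal_zero] at h2
  · exact lt_irrefl _ h2
  · exact (ENNReal.toReal_pos (zero_lt_one.trans S.one_lt).ne' S.lt_top.ne).ne'

theorem eLpNorm_shift (x : X) {f : X → ℂ} (hf : AEStronglyMeasurable f μ) :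
    eLpNorm (fun y => f (S.φ x y) * S.h x y) p μ = eLpNorm f p μ := by
  have := S.sigmaFinite_map x
  have hp0 : p ≠ 0 := (zero_lt_one.trans S.one_lt).ne'
  rw [eLpNorm_eq_lintegral_rpow_enorm_toReal hp0 S.lt_top.ne,
    eLpNorm_eq_lintegral_rpow_enorm_toReal hp0 S.lt_top.ne]
  congr 1
  have h1 : ∫⁻ y, ‖f (S.φ x y) * S.h x y‖ₑ ^ p.toReal ∂μ
      = ∫⁻ y, (μ.map (S.φ x).symm).rnDeriv μ y * ‖f (S.φ x y)‖ₑ ^ p.toReal ∂μ := by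
    refine lintegral_congr_ae ?_
    filter_upwards [S.norm_h x] with y hy
    rw [← hy, enorm_mul, ENNReal.mul_rpow_of_nonneg _ _ ENNReal.toReal_nonneg, mul_comm,
      ← ENNReal.ofReal_rpow_of_nonneg (norm_nonneg _) ENNReal.toReal_nonneg, ofReal_norm]
  have h2 : AEStronglyMeasurable (fun y => f (S.φ x y)) μ :=
    hf.comp_quasiMeasurePreserving (S.quasi x)
  rw [h1, lintegral_rnDeriv_mul (S.map_ac x) (h2.enorm.pow_const _)]
  have h3 := MeasureTheory.lintegral_map_equiv (μ := μ) (fun y => ‖f (S.φ x y)‖ₑ ^ p.toReal)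
    (S.φ x).symm.toHomeomorph.toMeasurableEquiv
  refine h3.trans ?_
  simp

theorem memLp_shift (x : X) {f : X → ℂ} (hf : MemLp f p μ) :
    MemLp (fun y => f (S.φ x y) * S.h x y) p μ :=
  ⟨(hf.1.comp_quasiMeasurePreserving (S.quasi x)).mul (S.measurable_h x).aestronglyMeasurable,
    by rw [S.eLpNorm_shift x hf.1]; exact hf.2⟩

/-- The isometry `U_x f = (f ∘ φ x) · h x` of `L_p`. -/
def shiftIsometry (x : X) : Lp ℂ p μ →ₗᵢ[ℂ] Lp ℂ p μ where
  toFun f := (S.memLp_shift x (Lp.memLp f)).toLp (fun y => f (S.φ x y) * S.h x y)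
  map_add' f g := by
    rw [← MemLp.toLp_add]
    refine MemLp.toLp_congr _ _ ?_
    filter_upwards [(S.quasi x).ae (Lp.coeFn_add f g)] with y hy
    rw [Pi.add_apply] at hy
    rw [Pi.add_apply, hy, add_mul]
  map_smul' c f := by
    rw [RingHom.id_apply, ← MemLp.toLp_const_smul]
    refine MemLp.toLp_congr _ _ ?_
    filter_upwards [(S.quasi x).ae (Lp.coeFn_smul c f)] with y hy
    rw [Pi.smul_apply, smul_eq_mul] at hy
    rw [Pi.smul_apply, smul_eq_mul, hy, mul_assoc]
  norm_map' f := by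
    simp only [LinearMap.coe_mk, AddHom.coe_mk, Lp.norm_toLp]
    rw [S.eLpNorm_shift x (Lp.aestronglyMeasurable f), Lp.norm_def]

theorem shiftIsometry_surjective (x : X) : Function.Surjective (S.shiftIsometry x) := by
  intro g
  have hm : AEStronglyMeasurable (fun y => g ((S.φ x).symm y) / S.h x ((S.φ x).symm y)) μ := by
    have h0 : AEMeasurable (fun y => g y / S.h x y) μ :=
      (Lp.aestronglyMeasurable g).aemeasurable.div (S.measurable_h x).aemeasurable
    exact h0.aestronglyMeasurable.comp_quasiMeasurePreserving (S.quasi_symm x)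
  have he : (fun y => g ((S.φ x).symm (S.φ x y)) / S.h x ((S.φ x).symm (S.φ x y)) * S.h x y)
      =ᵐ[μ] g := by
    filter_upwards [S.h_ne_zero x] with y hy
    simp [hy]
  have hf : MemLp (fun y => g ((S.φ x).symm y) / S.h x ((S.φ x).symm y)) p μ := by
    refine ⟨hm, ?_⟩
    rw [← S.eLpNorm_shift x hm, eLpNorm_congr_ae he]
    exact (Lp.memLp g).2
  refine ⟨hf.toLp _, ?_⟩
  refine Lp.ext ?_
  refine (MemLp.coeFn_toLp (S.memLp_shift x (Lp.memLp (hf.toLp _)))).trans ?_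
  filter_upwards [(S.quasi x).ae hf.coeFn_toLp, he] with y h1 h2
  rw [h1, h2]

/-- `U_x` as a surjective isometry of `L_p`. -/
def U (x : X) : Lp ℂ p μ ≃ₗᵢ[ℂ] Lp ℂ p μ :=
  LinearIsometryEquiv.ofSurjective (S.shiftIsometry x) (S.shiftIsometry_surjective x)

theorem U_ae (x : X) (f : Lp ℂ p μ) :
    (S.U x f : X → ℂ) =ᵐ[μ] fun y => f (S.φ x y) * S.h x y :=
  MemLp.coeFn_toLp (S.memLp_shift x (Lp.memLp f))

/-- The shifted operator `U_x B U_x⁻¹`. -/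
def conj (x : X) (B : Lp ℂ p μ →L[ℂ] Lp ℂ p μ) : Lp ℂ p μ →L[ℂ] Lp ℂ p μ :=
  ((S.U x : Lp ℂ p μ ≃L[ℂ] Lp ℂ p μ) : Lp ℂ p μ →L[ℂ] Lp ℂ p μ) ∘L B ∘L
    (((S.U x).symm : Lp ℂ p μ ≃L[ℂ] Lp ℂ p μ) : Lp ℂ p μ →L[ℂ] Lp ℂ p μ)

/-! ### Limit operators -/

/-- `C` is the limit of `U_y B U_y⁻¹` in the weak operator topology as `y ∈ X` tends to `x ∈ βX`
(equivalently, along every net in `X` that converges to `x`). -/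
def IsWeakLimit (B : Lp ℂ p μ →L[ℂ] Lp ℂ p μ) (x : StoneCech X)
    (C : Lp ℂ p μ →L[ℂ] Lp ℂ p μ) : Prop :=
  Tendsto (fun y : X => ContinuousLinearMapWOT.ofCLM (S.conj y B))
    (comap stoneCechUnit (𝓝 x)) (𝓝 (ContinuousLinearMapWOT.ofCLM C))

/-- The weak limit `B_x` of `U_y B U_y⁻¹` as `y → x` (meaningful if that limit exists). -/
def weakLim (B : Lp ℂ p μ →L[ℂ] Lp ℂ p μ) (x : StoneCech X) : Lp ℂ p μ →L[ℂ] Lp ℂ p μ :=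
  (limUnder (comap stoneCechUnit (𝓝 x))
    (fun y : X => ContinuousLinearMapWOT.ofCLM (S.conj y B))).toCLM

variable {M : Submodule ℂ (Lp ℂ p μ)} {P : Lp ℂ p μ →L[ℂ] Lp ℂ p μ}

/-- The limit operator `A_x`, the restriction of `(AP)_x` to `ran P_x`, as an operator on
`ran P_x`.  The codomain is cut down by `P_x`, which changes nothing as soon as `(AP)_x` maps
`ran P_x` into itself. -/
def limitOp (hP : LinearMap.IsProj M P.toLinearMap) (A : M →L[ℂ] M) (x : StoneCech X) :
    (S.weakLim P x).range →L[ℂ] (S.weakLim P x).range :=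
  (S.weakLim P x).rangeRestrict ∘L S.weakLim (extend hP A) x ∘L
    (S.weakLim P x).range.subtypeL

/-- The operator `Â_x = A_x P_x + Q_x` on `L_p`, where `Q = I - P`. -/
def hatLimitOp (hP : LinearMap.IsProj M P.toLinearMap) (A : M →L[ℂ] M) (x : StoneCech X) :
    Lp ℂ p μ →L[ℂ] Lp ℂ p μ :=
  (S.weakLim P x).range.subtypeL ∘L S.limitOp hP A x ∘L (S.weakLim P x).rangeRestrict
    + S.weakLim (1 - P) x

end ShiftSystem

end LimitOperators

end

/-!
Write `B_y = U_y B U_y⁻¹` for the shifts of an operator `B` and `M_n` for the multiplication by the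
indicator function of the ball of radius `n` about `x₀` (`ShiftSystem.cut`).

*Existence of limit operators.*  The shifts are strongly continuous in `y` (Riesz–Scheffé), so every
bounded scalar function `y ↦ ψ (K B_y f)` extends to `βX`; for compact `K` the vectors `K B_y f`
therefore converge in norm.  For `B = P`, the norm convergence of `M_n P_y M_m` and the uniform
decay of band-dominated operators make the compact operators `M_n P_y` and `P_y M_n` converge in
norm.  Feeding this into `B = P B = B P` yields a limit operator in a strong sense
(`ShiftSystem.IsLimitOperator`, `ShiftSystem.IsAdmissible.exists_isLimitOperator`): strong
convergence of `B_y` and of its transpose, and norm convergence of `M_n B_y` and `B_y M_n`.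

*Fredholm operators have invertible limit operators, with the norm estimate.*  Let `T A - 1` and
`A T - 1` be compact.  As `y` tends to a boundary point `x`, the vectors `U_y⁻¹ f` tend weakly to
zero, and compact operators turn this into norm convergence.  Applying `T A - 1` to `P U_y⁻¹ f`
gives `‖f‖ ≤ ‖T‖ ‖A_x f‖` on `ran P_x` in the limit; the transposed argument shows that `A_x` has
dense range (`ShiftSystem.norm_weakLim_le`, `ShiftSystem.dual_comp_weakLim_eq_zero`).  Hence `A_x` is
invertible and `‖A_x⁻¹‖ ≤ ‖T‖`; the infimum over all `T` that represent the inverse of `A` in the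
Calkin algebra is the estimate of the theorem.

*Invertible limit operators imply the Fredholm property.*  It suffices that `A` and its transpose
are bounded below modulo compact operators (`isFredholm_of_le`).  Since `M_n P` and `P M_n` are
compact, this follows if `T = A P + 1 - P` and its transpose are bounded below on what vanishes on a
large ball (`ShiftSystem.exists_le_at_infinity`).  Otherwise there are `f` with `‖T f‖ ≤ 2⁻ᵐ ‖f‖`
arbitrarily far out.  Property A provides a partition of unity whose commutators with `T` are small,
so that some bounded piece of `f` is almost as good (`IsLpDecomp.isLocalizable`).  Repeating this
with coarser and coarser precision (`IsLpDecomp.exists_nested`) finds one centre `y` around which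
there are pieces `g` of size `r k` with `‖T g‖ ≤ 2⁻ᵏ ‖g‖` for all `k < m` at once.  A limit point
`x ∈ ΓX` of these centres has a limit operator `T_x = Â_x` that is not bounded below.  This one point
`x` works for every `k`, so no uniform bound on the inverses is needed.

Neither reflexivity nor the identification of the dual of `L_p` with `L_q` is used.  The localization
argument runs in any Banach space with an `ℓ_p`-decomposition `‖f‖ ^ p = ∑ ‖M i f‖ ^ p`
(`IsLpDecomp`), and the dual space inherits an `ℓ_q`-decomposition (`IsLpDecomp.dual`), so that the
transpose of `T` is covered by the same lemmas.
-/

set_option linter.unusedSectionVars false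

noncomputable section

namespace LimitOperators

/-! ### A Fredholm criterion -/

section Fredholm

variable {E F G : Type*} [NormedAddCommGroup E] [NormedSpace ℂ E] [NormedAddCommGroup F]
  [NormedSpace ℂ F] [NormedAddCommGroup G] [NormedSpace ℂ G]

theorem isCompactOperator_comp_left {T : E →L[ℂ] F} (hT : IsCompactOperator T) (S : F →L[ℂ] G) :
    IsCompactOperator (S ∘L T) := by
  rw [ContinuousLinearMap.coe_comp]
  exact hT.clm_comp S

theorem isCompactOperator_comp_right {T : F →L[ℂ] G} (hT : IsCompactOperator T) (S : E →L[ℂ] F) :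
    IsCompactOperator (T ∘L S) := by
  rw [ContinuousLinearMap.coe_comp]
  exact hT.comp_clm S

/-- The kernel of an operator that is bounded below modulo a compact operator has finite
dimension: the compact operator is bounded below on it. -/
theorem finiteDimensional_ker_of_le {A : E →L[ℂ] F} {K : E →L[ℂ] G} (hK : IsCompactOperator K)
    {C : ℝ} (h : ∀ f, ‖f‖ ≤ C * (‖A f‖ + ‖K f‖)) : FiniteDimensional ℂ A.ker := by
  set L : A.ker →L[ℂ] G := K ∘L A.ker.subtypeL
  have hL : AntilipschitzWith C.toNNReal L := by
    refine AddMonoidHomClass.antilipschitz_of_bound L fun f => ?_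
    have h1 := h f
    have h2 : A (f : E) = 0 := f.2
    rw [h2, norm_zero, zero_add] at h1
    refine h1.trans ?_
    have h3 : ‖K (f : E)‖ = ‖L f‖ := rfl
    rw [h3]
    exact mul_le_mul_of_nonneg_right (Real.le_coe_toNNReal C) (norm_nonneg _)
  have hb : TotallyBounded (L '' Metric.closedBall 0 1) := by
    have hc := isCompactOperator_comp_right hK A.ker.subtypeL
    exact (hc.isCompact_closure_image_closedBall (𝕜₁ := ℂ) 1).totallyBounded.subset subset_closure
  have hp := totallyBounded_preimage (hL.isUniformInducing L.uniformContinuous) hb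
  exact FiniteDimensional.of_totallyBounded_nhds_zero ℂ
    (Metric.closedBall_mem_nhds (0 : A.ker) one_pos) (hp.subset (subset_preimage_image _ _))

/-- An operator that is bounded below modulo a compact operator is bounded below on every closed
subspace that meets its kernel trivially. -/
theorem exists_mul_norm_le_of_le [CompleteSpace E] {A : E →L[ℂ] F} {K : E →L[ℂ] G}
    (hK : IsCompactOperator K)
    {C : ℝ} (h : ∀ f, ‖f‖ ≤ C * (‖A f‖ + ‖K f‖)) {V : Submodule ℂ E} (hV : IsClosed (V : Set E))
    (hd : ∀ f ∈ V, A f = 0 → f = 0) :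
    ∃ c : ℝ, 0 < c ∧ ∀ f ∈ V, c * ‖f‖ ≤ ‖A f‖ := by
  by_contra! hcon
  -- unit vectors `f n ∈ V` with `A f n → 0` have a convergent subsequence, since `K f n` has one
  have h1 : ∀ n : ℕ, ∃ f ∈ V, ‖f‖ = 1 ∧ ‖A f‖ < 1 / ((n : ℝ) + 1) := by
    intro n
    obtain ⟨f, hf, hlt⟩ := hcon (1 / ((n : ℝ) + 1)) (by positivity)
    have hf0 : f ≠ 0 := by
      rintro rfl
      simp at hlt
    refine ⟨((‖f‖⁻¹ : ℝ) : ℂ) • f, V.smul_mem _ hf, ?_, ?_⟩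
    · rw [norm_smul, Complex.norm_real, norm_inv, norm_norm, inv_mul_cancel₀ (norm_ne_zero_iff.2 hf0)]
    · rw [map_smul, norm_smul, Complex.norm_real, norm_inv, norm_norm,
        inv_mul_lt_iff₀ (norm_pos_iff.2 hf0), mul_comm]
      exact hlt
  choose f hfV hf1 hfA using h1
  have hA0 : Tendsto (fun n => ‖A (f n)‖) atTop (𝓝 0) :=
    squeeze_zero (fun n => norm_nonneg _) (fun n => (hfA n).le)
      tendsto_one_div_add_atTop_nhds_zero_nat
  obtain ⟨g, -, φ, hφ, hg⟩ :=
    (hK.isCompact_closure_image_closedBall (𝕜₁ := ℂ) 1).tendsto_subseq (x := fun n => K (f n))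
      (fun n => subset_closure ⟨f n, by simp [hf1], rfl⟩)
  have hcau : CauchySeq (fun n => f (φ n)) := by
    have h2 : CauchySeq (fun n => A (f (φ n))) :=
      ((tendsto_zero_iff_norm_tendsto_zero.2 hA0).comp hφ.tendsto_atTop).cauchySeq
    have h3 : CauchySeq (fun n => K (f (φ n))) := hg.cauchySeq
    rw [Metric.cauchySeq_iff] at h2 h3 ⊢
    intro ε hε
    set C' := |C| + 1
    have hC' : 0 < C' := by positivity
    obtain ⟨N, hN⟩ := h2 (ε / C' / 2) (by positivity)
    obtain ⟨N', hN'⟩ := h3 (ε / C' / 2) (by positivity)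
    refine ⟨max N N', fun m hm n hn => ?_⟩
    have e1 := hN m (le_of_max_le_left hm) n (le_of_max_le_left hn)
    have e2 := hN' m (le_of_max_le_right hm) n (le_of_max_le_right hn)
    rw [dist_eq_norm, ← map_sub] at e1 e2
    rw [dist_eq_norm]
    calc ‖f (φ m) - f (φ n)‖ ≤ C * (‖A (f (φ m) - f (φ n))‖ + ‖K (f (φ m) - f (φ n))‖) := h _
      _ ≤ C' * (‖A (f (φ m) - f (φ n))‖ + ‖K (f (φ m) - f (φ n))‖) := by
        gcongr
        exact (le_abs_self C).trans (by simp [C'])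
      _ < C' * (ε / C' / 2 + ε / C' / 2) := by gcongr
      _ = ε := by field_simp; ring
  obtain ⟨f₀, hf₀⟩ := cauchySeq_tendsto_of_complete hcau
  have hV0 : f₀ ∈ V := hV.mem_of_tendsto hf₀ (Eventually.of_forall fun n => hfV _)
  have hn : ‖f₀‖ = 1 :=
    tendsto_nhds_unique hf₀.norm (by simp [hf1])
  have hz : A f₀ = 0 := by
    have := (A.continuous.tendsto f₀).comp hf₀
    have h2 := (tendsto_zero_iff_norm_tendsto_zero.2 hA0).comp hφ.tendsto_atTop
    exact tendsto_nhds_unique this h2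
  rw [hd f₀ hV0 hz, norm_zero] at hn
  exact zero_ne_one hn

/-- A space is finite-dimensional if some compact operator into it has an adjoint that is bounded
below: by the Hahn–Banach theorem the closure of the image of the unit ball is a neighbourhood of
the origin. -/
theorem finiteDimensional_of_dual_le {L : G →L[ℂ] E} (hL : IsCompactOperator L) {C : ℝ}
    (h : ∀ ψ : StrongDual ℂ E, ‖ψ‖ ≤ C * ‖ψ ∘L L‖) : FiniteDimensional ℂ E := by
  set S := closure (L '' Metric.closedBall 0 1)
  have hS : IsCompact S := hL.isCompact_closure_image_closedBall (𝕜₁ := ℂ) 1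
  have hconv : Convex ℝ S := by
    refine Convex.closure ?_
    have := (convex_closedBall (0 : G) 1).linear_image (L.toLinearMap.restrictScalars ℝ)
    exact this
  set C' := |C| + 1
  have hC' : 0 < C' := by positivity
  have hsub : Metric.ball (0 : E) (1 / C') ⊆ S := by
    intro y hy
    by_contra hyS
    obtain ⟨ψ, u, hu, huy⟩ := RCLike.geometric_hahn_banach_closed_point (𝕜 := ℂ) hconv
      hS.isClosed hyS
    have h0 : 0 < u := by
      have := hu 0 (subset_closure ⟨0, by simp, by simp⟩)
      simpa using this
    have h1 : ‖ψ ∘L L‖ ≤ u := by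
      refine ContinuousLinearMap.opNorm_le_of_unit_norm h0.le fun g hg => ?_
      -- rotate `g` so that `ψ (L g)` becomes its absolute value
      obtain ⟨c, hc, hc'⟩ : ∃ c : ℂ, ‖c‖ = 1 ∧ c * ψ (L g) = ‖ψ (L g)‖ := by
        by_cases hz : ψ (L g) = 0
        · exact ⟨1, by simp, by simp [hz]⟩
        · refine ⟨‖ψ (L g)‖ / ψ (L g), ?_, by field_simp⟩
          rw [norm_div, Complex.norm_real, norm_norm, div_self (norm_ne_zero_iff.2 hz)]
      have h2 := hu (L (c • g)) (subset_closure ⟨c • g, by simp [norm_smul, hc, hg], rfl⟩)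
      rw [map_smul, map_smul, smul_eq_mul, hc'] at h2
      have h3 : RCLike.re ((‖ψ (L g)‖ : ℂ)) = ‖ψ (L g)‖ := Complex.ofReal_re _
      rw [h3] at h2
      exact h2.le
    have h2 : ‖ψ‖ ≤ C' * u := (h ψ).trans <| by
      gcongr
      exact (le_abs_self C).trans (by simp [C'])
    have h3 : u < C' * u * ‖y‖ := by
      calc u < RCLike.re (ψ y) := huy
        _ ≤ ‖ψ y‖ := RCLike.re_le_norm _
        _ ≤ ‖ψ‖ * ‖y‖ := ψ.le_opNorm y
        _ ≤ C' * u * ‖y‖ := by gcongr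
    rw [mem_ball_zero_iff, lt_div_iff₀ hC'] at hy
    nlinarith
  exact FiniteDimensional.of_totallyBounded_nhds_zero ℂ
    (Metric.ball_mem_nhds (0 : E) (by positivity)) (hS.totallyBounded.subset hsub)

/-- An operator on a Banach space is Fredholm if both it and its adjoint are bounded below modulo
compact operators. -/
theorem isFredholm_of_le [CompleteSpace E] {A : E →L[ℂ] E} {K : E →L[ℂ] F} {K' : G →L[ℂ] E}
    (hK : IsCompactOperator K) (hK' : IsCompactOperator K') {C C' : ℝ}
    (h : ∀ f, ‖f‖ ≤ C * (‖A f‖ + ‖K f‖))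
    (h' : ∀ ψ : StrongDual ℂ E, ‖ψ‖ ≤ C' * (‖ψ ∘L A‖ + ‖ψ ∘L K'‖)) : A.IsFredholm := by
  have hker := finiteDimensional_ker_of_le hK h
  obtain ⟨V, hV⟩ := (Submodule.ClosedComplemented.of_finiteDimensional A.ker).exists_isTopCompl
  have hVc : IsClosed (V : Set E) := hV.symm.isClosed
  have hVd : ∀ f ∈ V, A f = 0 → f = 0 := fun f hf h0 =>
    Submodule.disjoint_def.1 hV.isCompl.disjoint f h0 hf
  obtain ⟨c, hc, hcV⟩ := exists_mul_norm_le_of_le hK h hVc hVd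
  have : CompleteSpace V := hVc.completeSpace_coe
  have hrV : ∀ f, ∃ g ∈ V, A g = A f := by
    intro f
    obtain ⟨a, ha, b, hb, hab⟩ := Submodule.mem_sup.1
      (hV.isCompl.sup_eq_top ▸ Submodule.mem_top : f ∈ A.ker ⊔ V)
    refine ⟨b, hb, ?_⟩
    have ha0 : A a = 0 := ha
    rw [← hab, map_add, ha0, zero_add]
  have hrange : IsClosed (A.range : Set E) := by
    have hanti : AntilipschitzWith (c⁻¹).toNNReal (A ∘L V.subtypeL) := by
      refine AddMonoidHomClass.antilipschitz_of_bound _ fun f => ?_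
      rw [Real.coe_toNNReal _ (inv_nonneg.2 hc.le), ← div_eq_inv_mul, le_div_iff₀ hc, mul_comm]
      exact hcV f f.2
    have hcl := hanti.isClosed_range (A ∘L V.subtypeL).uniformContinuous
    convert hcl using 1
    ext y
    constructor
    · rintro ⟨f, rfl⟩
      obtain ⟨g, hg, hgf⟩ := hrV f
      exact ⟨⟨g, hg⟩, hgf⟩
    · rintro ⟨f, rfl⟩
      exact ⟨f, rfl⟩
  have : A.range.CoFG := by
    have hcl : IsClosed (A.range : Set E) := hrange
    have hL : IsCompactOperator (A.range.mkQL ∘L K') := isCompactOperator_comp_left hK' _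
    -- functionals on the quotient by the range are those that `A` transposes to zero
    refine finiteDimensional_of_dual_le (C := C') hL fun ψ => ?_
    have h1 := h' (ψ ∘L A.range.mkQL)
    have h2 : (ψ ∘L A.range.mkQL) ∘L A = 0 := by
      ext f
      have : A.range.mkQL (A f) = 0 := by
        exact (Submodule.Quotient.mk_eq_zero _).2 ⟨f, rfl⟩
      simp [this]
    rw [h2, norm_zero, zero_add] at h1
    rw [← ContinuousLinearMap.comp_assoc]
    refine le_trans ?_ h1
    refine ContinuousLinearMap.opNorm_le_bound _ (norm_nonneg _) fun y => ?_
    refine le_of_forall_pos_le_add fun ε hε => ?_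
    obtain ⟨δ, hδ, hδε⟩ : ∃ δ > 0, ‖ψ ∘L A.range.mkQL‖ * δ ≤ ε := by
      refine ⟨ε / (‖ψ ∘L A.range.mkQL‖ + 1), by positivity, ?_⟩
      rw [mul_div_assoc', div_le_iff₀ (by positivity)]
      nlinarith [norm_nonneg (ψ ∘L A.range.mkQL)]
    obtain ⟨f, rfl, hf⟩ := Submodule.Quotient.norm_mk_lt y hδ
    calc ‖ψ (Submodule.Quotient.mk f)‖ = ‖(ψ ∘L A.range.mkQL) f‖ := rfl
      _ ≤ ‖ψ ∘L A.range.mkQL‖ * ‖f‖ := ContinuousLinearMap.le_opNorm _ _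
      _ ≤ ‖ψ ∘L A.range.mkQL‖ * (‖(Submodule.Quotient.mk f : E ⧸ A.range)‖ + δ) := by gcongr
      _ ≤ _ := by rw [mul_add]; gcongr
  have hVcofg : V.CoFG :=
    Submodule.FG.cofg_of_isCompl hV.isCompl (Module.Finite.iff_fg.1 hker)
  have hmaps : MapsTo A V A.range := fun f _ => ⟨f, rfl⟩
  have : CompleteSpace A.range := hrange.completeSpace_coe
  refine ContinuousLinearMap.IsFredholm.of_isInvertible_restrict hVc hrange hmaps ?_
  refine ⟨ContinuousLinearEquiv.ofBijective (A.restrict hmaps) ?_ ?_, ?_⟩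
  · refine LinearMap.ker_eq_bot'.2 fun f hf => ?_
    exact Subtype.ext (hVd f f.2 (congrArg Subtype.val hf))
  · refine LinearMap.range_eq_top.2 ?_
    rintro ⟨_, f, rfl⟩
    obtain ⟨g, hg, hgf⟩ := hrV f
    exact ⟨⟨g, hg⟩, Subtype.ext hgf⟩
  · exact ContinuousLinearEquiv.coe_ofBijective _ _ _

end Fredholm

/-! ### Decompositions with additive `p`-th powers of norms -/

section Decomposition

variable {E F I : Type*} [NormedAddCommGroup E] [NormedSpace ℂ E] [NormedAddCommGroup F]
  [NormedSpace ℂ F]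

/-- The adjoint `ψ ↦ ψ ∘ T` on the dual space. -/
def adj (T : E →L[ℂ] F) : StrongDual ℂ F →L[ℂ] StrongDual ℂ E :=
  ContinuousLinearMap.precomp ℂ T

theorem adj_apply (T : E →L[ℂ] F) (ψ : StrongDual ℂ F) : adj T ψ = ψ ∘L T := rfl

theorem adj_sub (S T : E →L[ℂ] F) : adj (S - T) = adj S - adj T := by
  ext ψ f
  simp [adj_apply]

theorem norm_adj_le (T : E →L[ℂ] F) : ‖adj T‖ ≤ ‖T‖ := by
  refine ContinuousLinearMap.opNorm_le_bound _ (norm_nonneg _) fun ψ => ?_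
  rw [adj_apply, mul_comm]
  exact ContinuousLinearMap.opNorm_comp_le _ _

/-- A family of mutually orthogonal projections `M i` that decomposes the space as an `ℓ_p`-sum:
`‖f‖ ^ p = ∑ ‖M i f‖ ^ p`. -/
structure IsLpDecomp (p : ℝ) (M : I → F →L[ℂ] F) : Prop where
  apply_self : ∀ i f, M i (M i f) = M i f
  apply_ne : ∀ i k, i ≠ k → ∀ f, M i (M k f) = 0
  tsum : ∀ f, ∑' i, ‖M i f‖ₑ ^ p = ‖f‖ₑ ^ p

namespace IsLpDecomp

variable {p : ℝ} {M : I → F →L[ℂ] F} (D : IsLpDecomp p M)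
include D

theorem enorm_le (hp : 0 < p) (i : I) (f : F) : ‖M i f‖ₑ ≤ ‖f‖ₑ := by
  rw [← ENNReal.rpow_le_rpow_iff hp, ← D.tsum f]
  exact ENNReal.le_tsum i

theorem norm_le (hp : 0 < p) (i : I) (f : F) : ‖M i f‖ ≤ ‖f‖ := by
  have := D.enorm_le hp i f
  rwa [← ofReal_norm, ← ofReal_norm, ENNReal.ofReal_le_ofReal_iff (norm_nonneg _)] at this

theorem exists_ne_zero (hp : 0 < p) {f : F} (hf : f ≠ 0) : ∃ i, M i f ≠ 0 := by
  by_contra! h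
  have := D.tsum f
  simp only [h, enorm_zero, ENNReal.zero_rpow_of_pos hp, tsum_zero] at this
  have h2 := (ENNReal.rpow_eq_zero_iff_of_pos hp).1 this.symm
  exact hf (enorm_eq_zero.1 h2)

theorem apply_sum [DecidableEq I] (S : Finset I) (g : I → F) (k : I) :
    M k (∑ i ∈ S, M i (g i)) = if k ∈ S then M k (g k) else 0 := by
  rw [map_sum]
  split_ifs with h
  · rw [Finset.sum_eq_single k (fun i _ hi => D.apply_ne k i hi.symm _) (fun hk => (hk h).elim),
      D.apply_self]
  · exact Finset.sum_eq_zero fun i hi => D.apply_ne k i (fun hk => h (hk ▸ hi)) _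

theorem enorm_sum (hp : 0 < p) (S : Finset I) (g : I → F) :
    ‖∑ i ∈ S, M i (g i)‖ₑ ^ p = ∑ i ∈ S, ‖M i (g i)‖ₑ ^ p := by
  classical
  rw [← D.tsum, tsum_eq_sum (s := S)]
  · exact Finset.sum_congr rfl fun i hi => by rw [D.apply_sum, if_pos hi]
  · intro i hi
    rw [D.apply_sum, if_neg hi, enorm_zero, ENNReal.zero_rpow_of_pos hp]

theorem hasSum (hp : 0 < p) (f : F) : HasSum (fun i => M i f) f := by
  classical
  have h1 : ∀ S : Finset I, ‖f - ∑ i ∈ S, M i f‖ₑ ^ p = ∑' b : {i // i ∉ S}, ‖M b f‖ₑ ^ p := by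
    intro S
    rw [← D.tsum]
    have h2 : (fun i => ‖M i (f - ∑ k ∈ S, M k f)‖ₑ ^ p)
        = ({i | i ∉ S} : Set I).indicator (fun i => ‖M i f‖ₑ ^ p) := by
      ext i
      rw [map_sub, D.apply_sum]
      by_cases hi : i ∈ S
      · rw [if_pos hi, sub_self, enorm_zero, ENNReal.zero_rpow_of_pos hp,
          indicator_of_notMem (by simpa using hi)]
      · rw [if_neg hi, sub_zero, indicator_of_mem (show i ∈ {i | i ∉ S} from hi)]
    rw [h2]
    exact (tsum_subtype _ _).symm
  have h3 : Tendsto (fun S : Finset I => ‖f - ∑ i ∈ S, M i f‖ₑ ^ p) atTop (𝓝 0) := by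
    simp_rw [h1]
    refine ENNReal.tendsto_tsum_compl_atTop_zero (f := fun i => ‖M i f‖ₑ ^ p) ?_
    rw [D.tsum]
    exact ENNReal.rpow_ne_top_of_nonneg hp.le enorm_ne_top
  have h4 := ((ENNReal.continuous_rpow_const (y := p⁻¹)).tendsto 0).comp h3
  rw [ENNReal.zero_rpow_of_pos (inv_pos.2 hp)] at h4
  have h5 : Tendsto (fun S : Finset I => ‖f - ∑ i ∈ S, M i f‖ₑ) atTop (𝓝 0) := by
    refine h4.congr fun S => ?_
    simp only [Function.comp]
    rw [← ENNReal.rpow_mul, mul_inv_cancel₀ hp.ne', ENNReal.rpow_one]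
  rw [HasSum, tendsto_iff_edist_tendsto_0]
  refine h5.congr fun S => ?_
  rw [edist_comm, edist_eq_enorm_sub]

/-- The adjoints of an `ℓ_p`-decomposition form an `ℓ_q`-decomposition of the dual space, where
`1 / p + 1 / q = 1`. -/
theorem dual {q : ℝ} (hpq : p.HolderConjugate q) : IsLpDecomp q (fun i => adj (M i)) := by
  have hp := hpq.pos
  have hq := hpq.symm.pos
  refine ⟨fun i ψ => ?_, fun i k hik ψ => ?_, fun ψ => ?_⟩
  · ext f
    simp [adj_apply, D.apply_self]
  · ext f
    simp [adj_apply, D.apply_ne k i hik.symm]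
  simp only [adj_apply]
  refine le_antisymm ?_ ?_
  · -- test `ψ` on `∑ a i ^ (q - 1) • M i (f i)` with almost optimal unit vectors `f i`
    rw [ENNReal.tsum_eq_iSup_sum]
    refine iSup_le fun S => ?_
    set a : I → ℝ := fun i => ‖ψ ∘L M i‖
    have ha : ∀ i, 0 ≤ a i := fun i => norm_nonneg _
    set A := ∑ i ∈ S, a i ^ q
    have hA0 : 0 ≤ A := Finset.sum_nonneg fun i _ => Real.rpow_nonneg (ha i) _
    have key : ∀ θ : ℝ, 0 < θ → θ < 1 → θ * A ≤ ‖ψ‖ * A ^ (1 / p) := by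
      intro θ hθ0 hθ1
      have hex : ∀ i, ∃ f : F, ‖f‖ ≤ 1 ∧ ∃ r : ℝ, ψ (M i f) = r ∧ θ * a i ≤ r := by
        intro i
        rcases (ha i).eq_or_lt with h0 | h0
        · exact ⟨0, by simp, 0, by simp, by simp [← h0]⟩
        · obtain ⟨f, hf1, hf2⟩ := (ψ ∘L M i).exists_lt_apply_of_lt_opNorm
            (r := θ * a i) (by nlinarith)
          have hz : ψ (M i f) ≠ 0 := by
            intro hz
            have : (ψ ∘L M i) f = 0 := hz
            rw [this, norm_zero] at hf2
            nlinarith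
          refine ⟨(‖ψ (M i f)‖ / ψ (M i f)) • f, ?_, ‖ψ (M i f)‖, ?_, hf2.le⟩
          · rw [norm_smul, norm_div, Complex.norm_real, norm_norm,
              div_self (norm_ne_zero_iff.2 hz), one_mul]
            exact hf1.le
          · rw [map_smul, map_smul, smul_eq_mul]
            field_simp
      choose f hf1 r hr hrθ using hex
      set g : F := ∑ i ∈ S, M i (((a i ^ (q - 1) : ℝ) : ℂ) • f i) with hg
      have hψg : ψ g = ((∑ i ∈ S, a i ^ (q - 1) * r i : ℝ) : ℂ) := by
        rw [hg, map_sum]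
        push_cast
        refine Finset.sum_congr rfl fun i _ => ?_
        rw [map_smul, map_smul, hr, smul_eq_mul]
      have hgn : ‖g‖ ^ p ≤ A := by
        have h1 : ‖g‖ₑ ^ p ≤ ENNReal.ofReal A := by
          rw [hg, D.enorm_sum hp,
            ENNReal.ofReal_sum_of_nonneg fun i _ => Real.rpow_nonneg (ha i) _]
          refine Finset.sum_le_sum fun i _ => ?_
          have h2 : ‖M i (((a i ^ (q - 1) : ℝ) : ℂ) • f i)‖ ≤ a i ^ (q - 1) := by
            refine (D.norm_le hp i _).trans ?_
            rw [norm_smul, Complex.norm_real, Real.norm_of_nonneg (Real.rpow_nonneg (ha i) _)]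
            exact mul_le_of_le_one_right (Real.rpow_nonneg (ha i) _) (hf1 i)
          rw [← ofReal_norm, ENNReal.ofReal_rpow_of_nonneg (norm_nonneg _) hp.le]
          refine ENNReal.ofReal_le_ofReal ((Real.rpow_le_rpow (norm_nonneg _) h2 hp.le).trans ?_)
          rw [← Real.rpow_mul (ha i)]
          rw [hpq.symm.sub_one_mul_conj]
        rw [← ofReal_norm, ENNReal.ofReal_rpow_of_nonneg (norm_nonneg _) hp.le,
          ENNReal.ofReal_le_ofReal_iff hA0] at h1
        exact h1
      have hgn' : ‖g‖ ≤ A ^ (1 / p) := by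
        rw [one_div, Real.le_rpow_inv_iff_of_pos (norm_nonneg _) hA0 hp]
        exact hgn
      calc θ * A = ∑ i ∈ S, a i ^ (q - 1) * (θ * a i) := by
            rw [Finset.mul_sum]
            refine Finset.sum_congr rfl fun i _ => ?_
            rcases (ha i).eq_or_lt with h0 | h0
            · rw [← h0, Real.zero_rpow hq.ne']
              ring
            · rw [Real.rpow_sub_one h0.ne']
              field_simp
        _ ≤ ∑ i ∈ S, a i ^ (q - 1) * r i := Finset.sum_le_sum fun i _ =>
            mul_le_mul_of_nonneg_left (hrθ i) (Real.rpow_nonneg (ha i) _)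
        _ ≤ ‖ψ g‖ := by
            rw [hψg, Complex.norm_real]
            exact Real.le_norm_self _
        _ ≤ ‖ψ‖ * ‖g‖ := ψ.le_opNorm g
        _ ≤ ‖ψ‖ * A ^ (1 / p) := by gcongr
    have hle : A ≤ ‖ψ‖ * A ^ (1 / p) := by
      have h1 : Tendsto (fun θ : ℝ => θ * A) (𝓝[<] 1) (𝓝 (1 * A)) :=
        (continuous_id.mul continuous_const).continuousWithinAt
      rw [one_mul] at h1
      refine le_of_tendsto h1 ?_
      filter_upwards [Ioo_mem_nhdsLT (zero_lt_one' ℝ)] with θ hθ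
      exact key θ hθ.1 hθ.2
    have hfin : A ≤ ‖ψ‖ ^ q := by
      rcases hA0.eq_or_lt with h0 | h0
      · rw [← h0]
        exact Real.rpow_nonneg (norm_nonneg _) _
      · have h1 : A ^ (1 / q) ≤ ‖ψ‖ := by
          have h2 : A = A ^ (1 / q) * A ^ (1 / p) := by
            rw [← Real.rpow_add h0, add_comm, one_div, one_div, hpq.inv_add_inv_eq_one,
              Real.rpow_one]
          have h3 : A ^ (1 / q) * A ^ (1 / p) ≤ ‖ψ‖ * A ^ (1 / p) := h2 ▸ hle
          exact le_of_mul_le_mul_right h3 (Real.rpow_pos_of_pos h0 _)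
        rw [one_div] at h1
        exact (Real.rpow_inv_le_iff_of_pos hA0 (norm_nonneg _) hq).1 h1
    have h2 : ∑ i ∈ S, ‖ψ ∘L M i‖ₑ ^ q = ENNReal.ofReal A := by
      rw [ENNReal.ofReal_sum_of_nonneg fun i _ => Real.rpow_nonneg (ha i) _]
      refine Finset.sum_congr rfl fun i _ => ?_
      rw [← ofReal_norm, ENNReal.ofReal_rpow_of_nonneg (norm_nonneg _) hq.le]
    rw [h2, ← ofReal_norm, ENNReal.ofReal_rpow_of_nonneg (norm_nonneg _) hq.le]
    exact ENNReal.ofReal_le_ofReal hfin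
  · -- Hölder's inequality
    set B := ∑' i, ‖ψ ∘L M i‖ₑ ^ q
    have h1 : ∀ f : F, ‖ψ f‖ₑ ≤ B ^ (1 / q) * ‖f‖ₑ := by
      intro f
      have h2 : Tendsto (fun S : Finset I => ‖ψ (∑ i ∈ S, M i f)‖ₑ) atTop (𝓝 ‖ψ f‖ₑ) :=
        ((continuous_enorm.comp ψ.continuous).tendsto f).comp (D.hasSum hp f)
      refine le_of_tendsto h2 (Eventually.of_forall fun S => ?_)
      calc ‖ψ (∑ i ∈ S, M i f)‖ₑ ≤ ∑ i ∈ S, ‖ψ (M i f)‖ₑ := by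
            rw [map_sum]
            exact enorm_sum_le _ _
        _ ≤ ∑ i ∈ S, ‖ψ ∘L M i‖ₑ * ‖M i f‖ₑ := by
            refine Finset.sum_le_sum fun i _ => ?_
            have := (ψ ∘L M i).le_opENorm (M i f)
            rwa [ContinuousLinearMap.comp_apply, D.apply_self] at this
        _ ≤ (∑ i ∈ S, ‖ψ ∘L M i‖ₑ ^ q) ^ (1 / q) * (∑ i ∈ S, ‖M i f‖ₑ ^ p) ^ (1 / p) :=
            ENNReal.inner_le_Lp_mul_Lq S _ _ hpq.symm
        _ ≤ B ^ (1 / q) * (‖f‖ₑ ^ p) ^ (1 / p) := by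
            gcongr
            · exact ENNReal.sum_le_tsum S
            · rw [← D.tsum f]
              exact ENNReal.sum_le_tsum S
        _ = B ^ (1 / q) * ‖f‖ₑ := by
            rw [← ENNReal.rpow_mul, mul_one_div_cancel hp.ne', ENNReal.rpow_one]
    rcases eq_or_ne B ∞ with hB | hB
    · rw [hB]
      exact le_top
    have hB' : B ^ (1 / q) ≠ ∞ := ENNReal.rpow_ne_top_of_nonneg (one_div_nonneg.2 hq.le) hB
    have h3 : ‖ψ‖ₑ ≤ B ^ (1 / q) := by
      rw [← ofReal_norm]
      refine ENNReal.ofReal_le_of_le_toReal ?_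
      refine ContinuousLinearMap.opNorm_le_bound _ ENNReal.toReal_nonneg fun f => ?_
      have := ENNReal.toReal_mono (ENNReal.mul_ne_top hB' enorm_ne_top) (h1 f)
      rwa [toReal_enorm, ENNReal.toReal_mul, toReal_enorm] at this
    calc ‖ψ‖ₑ ^ q ≤ (B ^ (1 / q)) ^ q := ENNReal.rpow_le_rpow h3 hq.le
      _ = B := by rw [← ENNReal.rpow_mul, one_div_mul_cancel hq.ne', ENNReal.rpow_one]

end IsLpDecomp

end Decomposition

/-! ### Localization of approximate kernels -/

section Localization

variable {F I : Type*} [NormedAddCommGroup F] [NormedSpace ℂ F]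

/-- A metric space in which the balls of each radius have a bounded number of points, and which
carries partitions of unity of small variation with uniformly bounded supports.  The sums are taken
in `ℝ≥0∞`, so that they include summability. -/
structure DiscretePropertyA (I : Type*) [PseudoMetricSpace I] : Prop where
  count : ∀ R : ℝ, ∃ N : ℕ, ∀ i : I, {k | dist i k ≤ R}.encard ≤ N
  weights : ∀ R t : ℝ, 0 < t → ∃ ρ : ℕ → I → ℝ,
    (∀ j i, 0 ≤ ρ j i) ∧
    (∀ i, ∑' j, ENNReal.ofReal (ρ j i) = 1) ∧
    (∃ r : ℝ, ∀ j i k, ρ j i ≠ 0 → ρ j k ≠ 0 → dist i k ≤ r) ∧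
    (∀ i k, dist i k ≤ R → ∑' j, ENNReal.ofReal |ρ j i - ρ j k| ≤ ENNReal.ofReal t)

/-- The propagation of `T` with respect to the decomposition `M` is at most `R`. -/
def IsBlockBand [PseudoMetricSpace I] (M : I → F →L[ℂ] F) (T : F →L[ℂ] F) (R : ℝ) : Prop :=
  ∀ i k, R < dist i k → ∀ f, M i (T (M k f)) = 0

/-- Every `f ≠ 0` can be cut down to some `g ≠ 0` of uniformly bounded support without increasing
the quotient `‖T f‖ / ‖f‖` by more than `δ`. -/
def IsLocalizable [PseudoMetricSpace I] (M : I → F →L[ℂ] F) (T : F →L[ℂ] F) : Prop :=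
  ∀ δ : ℝ, 0 < δ → ∃ r : ℝ, ∀ f, f ≠ 0 → ∃ g, g ≠ 0 ∧ (∀ i, M i g ≠ 0 → M i f ≠ 0) ∧
    (∀ i k, M i g ≠ 0 → M k g ≠ 0 → dist i k ≤ r) ∧ ‖T g‖ ≤ (‖T f‖ / ‖f‖ + δ) * ‖g‖

namespace IsLpDecomp

variable {p : ℝ} {M : I → F →L[ℂ] F} (D : IsLpDecomp p M)
include D

/-- The commutators of a band operator with multipliers of small variation are small, in the
`ℓ_p`-sense.  The block `i` of the commutator `[W j, T] f` is `M i T (w j i - W j) f`, and only the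
neighbours `k` of `i` contribute to it. -/
theorem tsum_commutator_le (hp : 0 < p) {J : Type*} (T : F →L[ℂ] F) (nb : I → Finset I)
    (hT : ∀ i k, k ∉ nb i → ∀ f, M i (T (M k f)) = 0) (W : J → F →L[ℂ] F) (w : J → I → ℝ)
    (hW : ∀ j i f, M i (W j f) = (w j i : ℂ) • M i f) (N t : ℝ≥0∞)
    (hN : ∀ k, {i | k ∈ nb i}.encard ≤ N)
    (ht : ∀ i, ∀ k ∈ nb i, ∑' j, ‖w j i - w j k‖ₑ ^ p ≤ t) (f : F) :
    ∑' j, ‖W j (T f) - T (W j f)‖ₑ ^ p ≤ ‖T‖ₑ ^ p * (N * t) * ‖f‖ₑ ^ p := by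
  classical
  have hloc : ∀ i g, M i (T g) = M i (T (∑ k ∈ nb i, M k g)) := by
    intro i g
    have h1 : HasSum (fun k => (M i ∘L T) (M k g)) ((M i ∘L T) g) :=
      (D.hasSum hp g).mapL (M i ∘L T)
    have h2 : HasSum (fun k => (M i ∘L T) (M k g)) (∑ k ∈ nb i, (M i ∘L T) (M k g)) :=
      hasSum_sum_of_ne_finset_zero fun k hk => hT i k hk g
    have h3 := h1.unique h2
    rw [map_sum, map_sum]
    exact h3
  have hblock : ∀ i j, ‖M i (W j (T f) - T (W j f))‖ₑ ^ p
      ≤ ‖T‖ₑ ^ p * ∑ k ∈ nb i, ‖w j i - w j k‖ₑ ^ p * ‖M k f‖ₑ ^ p := by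
    intro i j
    have h1 : M i (W j (T f) - T (W j f))
        = M i (T (∑ k ∈ nb i, M k (((w j i - w j k : ℝ) : ℂ) • f))) := by
      have h2 : M i (W j (T f) - T (W j f)) = M i (T ((w j i : ℂ) • f - W j f)) := by
        rw [map_sub, hW, map_sub T, map_sub, map_smul T, map_smul]
      rw [h2, hloc]
      congr 2
      refine Finset.sum_congr rfl fun k _ => ?_
      rw [map_sub, hW, map_smul, map_smul, ← sub_smul, Complex.ofReal_sub]
    rw [h1]
    calc ‖M i (T (∑ k ∈ nb i, M k (((w j i - w j k : ℝ) : ℂ) • f)))‖ₑ ^ p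
        ≤ (‖T‖ₑ * ‖∑ k ∈ nb i, M k (((w j i - w j k : ℝ) : ℂ) • f)‖ₑ) ^ p := by
          refine ENNReal.rpow_le_rpow ?_ hp.le
          exact (D.enorm_le hp i _).trans (T.le_opENorm _)
      _ = ‖T‖ₑ ^ p * ∑ k ∈ nb i, ‖w j i - w j k‖ₑ ^ p * ‖M k f‖ₑ ^ p := by
          rw [ENNReal.mul_rpow_of_nonneg _ _ hp.le, D.enorm_sum hp]
          congr 1
          refine Finset.sum_congr rfl fun k _ => ?_
          rw [map_smul, enorm_smul, ENNReal.mul_rpow_of_nonneg _ _ hp.le]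
          congr 2
          rw [← ofReal_norm, ← ofReal_norm, Complex.norm_real]
  calc ∑' j, ‖W j (T f) - T (W j f)‖ₑ ^ p
      = ∑' j, ∑' i, ‖M i (W j (T f) - T (W j f))‖ₑ ^ p := by simp_rw [D.tsum]
    _ ≤ ∑' j, ∑' i, ‖T‖ₑ ^ p * ∑ k ∈ nb i, ‖w j i - w j k‖ₑ ^ p * ‖M k f‖ₑ ^ p :=
        ENNReal.tsum_le_tsum fun j => ENNReal.tsum_le_tsum fun i => hblock i j
    _ = ‖T‖ₑ ^ p * ∑' i, ∑' j, ∑ k ∈ nb i, ‖w j i - w j k‖ₑ ^ p * ‖M k f‖ₑ ^ p := by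
        rw [ENNReal.tsum_comm, ← ENNReal.tsum_mul_left]
        simp_rw [ENNReal.tsum_mul_left]
    _ ≤ ‖T‖ₑ ^ p * ∑' i, ∑ k ∈ nb i, t * ‖M k f‖ₑ ^ p := by
        gcongr with i
        rw [Summable.tsum_finsetSum fun _ _ => ENNReal.summable]
        refine Finset.sum_le_sum fun k hk => ?_
        rw [ENNReal.tsum_mul_right]
        gcongr
        exact ht i k hk
    _ = ‖T‖ₑ ^ p * ∑' k, ∑' i, ({i | k ∈ nb i}.indicator 1 i) * (t * ‖M k f‖ₑ ^ p) := by
        rw [ENNReal.tsum_comm]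
        congr 2
        ext i
        rw [tsum_eq_sum (s := nb i)]
        · refine Finset.sum_congr rfl fun k hk => ?_
          rw [indicator_of_mem (show i ∈ {i | k ∈ nb i} from hk), Pi.one_apply, one_mul]
        · intro k hk
          rw [indicator_of_notMem (show i ∉ {i | k ∈ nb i} from hk), zero_mul]
    _ ≤ ‖T‖ₑ ^ p * ∑' k, N * (t * ‖M k f‖ₑ ^ p) := by
        gcongr with k
        rw [ENNReal.tsum_mul_right]
        gcongr
        rw [← tsum_subtype]
        simp only [Pi.one_apply]
        rw [ENNReal.tsum_set_one]
        exact hN k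
    _ = ‖T‖ₑ ^ p * (N * t) * ‖f‖ₑ ^ p := by
        rw [ENNReal.tsum_mul_left, ENNReal.tsum_mul_left, D.tsum]
        ring

/-- If the commutators of `T` with multipliers `W j`, `∑ w j ^ p = 1`, are small, then one of the
functions `W j f` almost attains the quotient `‖T f‖ / ‖f‖`. -/
theorem exists_multiplier (hp : 1 ≤ p) {J : Type*} (T : F →L[ℂ] F)
    (W : J → F →L[ℂ] F) (w : J → I → ℝ)
    (hW : ∀ j i f, M i (W j f) = (w j i : ℂ) • M i f)
    (hw : ∀ i, ∑' j, ‖w j i‖ₑ ^ p = 1) {f : F} (hf : f ≠ 0) {ε : ℝ} (hε : 0 < ε)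
    (hcomm : ∑' j, ‖W j (T f) - T (W j f)‖ₑ ^ p ≤ (ENNReal.ofReal ε * ‖f‖ₑ) ^ p) :
    ∃ j, W j f ≠ 0 ∧ ‖T (W j f)‖ ≤ (‖T f‖ / ‖f‖ + 2 * ε) * ‖W j f‖ := by
  have hp0 : 0 < p := zero_lt_one.trans_le hp
  have hpi : 0 ≤ 1 / p := one_div_nonneg.2 hp0.le
  have hroot : ∀ a : ℝ≥0∞, (a ^ p) ^ (1 / p) = a := fun a => by
    rw [← ENNReal.rpow_mul, mul_one_div_cancel hp0.ne', ENNReal.rpow_one]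
  -- otherwise the sum over `j` of the `p`-th powers, with Minkowski's inequality, gives
  -- `κ * ‖f‖ ≤ ‖T f‖ + ε * ‖f‖`
  by_contra! hcon
  set κ := ‖T f‖ / ‖f‖ + 2 * ε
  have hκ : 0 ≤ κ := by positivity
  have hnorm : ∀ g, ∑' j, ‖W j g‖ₑ ^ p = ‖g‖ₑ ^ p := by
    intro g
    calc ∑' j, ‖W j g‖ₑ ^ p = ∑' j, ∑' i, ‖w j i‖ₑ ^ p * ‖M i g‖ₑ ^ p := by
          congr 1
          ext j
          rw [← D.tsum]
          congr 1
          ext i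
          rw [hW, enorm_smul, ENNReal.mul_rpow_of_nonneg _ _ hp0.le]
          congr 2
          rw [← ofReal_norm, ← ofReal_norm, Complex.norm_real]
      _ = ‖g‖ₑ ^ p := by
          rw [ENNReal.tsum_comm]
          simp_rw [ENNReal.tsum_mul_right, hw, one_mul]
          exact D.tsum g
  have hle : ∀ j, ENNReal.ofReal κ * ‖W j f‖ₑ ≤ ‖T (W j f)‖ₑ := by
    intro j
    by_cases h0 : W j f = 0
    · simp [h0]
    · have := (hcon j h0).le
      rw [← ofReal_norm, ← ofReal_norm, ← ENNReal.ofReal_mul hκ]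
      exact ENNReal.ofReal_le_ofReal this
  let _ : MeasurableSpace J := ⊤
  have hmink := ENNReal.lintegral_Lp_add_le (μ := Measure.count (α := J)) (p := p)
    (f := fun j => ‖W j (T f)‖ₑ) (g := fun j => ‖W j (T f) - T (W j f)‖ₑ)
    measurable_from_top.aemeasurable measurable_from_top.aemeasurable hp
  simp only [lintegral_count, Pi.add_apply] at hmink
  have hchain : ENNReal.ofReal κ * ‖f‖ₑ ≤ ‖T f‖ₑ + ENNReal.ofReal ε * ‖f‖ₑ := by
    calc ENNReal.ofReal κ * ‖f‖ₑ
        = (∑' j, (ENNReal.ofReal κ * ‖W j f‖ₑ) ^ p) ^ (1 / p) := by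
          simp_rw [ENNReal.mul_rpow_of_nonneg _ _ hp0.le]
          rw [ENNReal.tsum_mul_left, hnorm, ← ENNReal.mul_rpow_of_nonneg _ _ hp0.le, hroot]
      _ ≤ (∑' j, (‖W j (T f)‖ₑ + ‖W j (T f) - T (W j f)‖ₑ) ^ p) ^ (1 / p) := by
          refine ENNReal.rpow_le_rpow (ENNReal.tsum_le_tsum fun j => ?_) hpi
          refine ENNReal.rpow_le_rpow ((hle j).trans ?_) hp0.le
          have h1 : T (W j f) = W j (T f) - (W j (T f) - T (W j f)) := by abel
          conv_lhs => rw [h1]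
          exact enorm_sub_le
      _ ≤ _ := hmink
      _ ≤ ‖T f‖ₑ + ENNReal.ofReal ε * ‖f‖ₑ := by
          gcongr
          · rw [hnorm, hroot]
          · exact (ENNReal.rpow_le_rpow hcomm hpi).trans (hroot _).le
  rw [← ofReal_norm, ← ofReal_norm, ← ENNReal.ofReal_mul hκ, ← ENNReal.ofReal_mul hε.le,
    ← ENNReal.ofReal_add (norm_nonneg _) (by positivity),
    ENNReal.ofReal_le_ofReal_iff (by positivity)] at hchain
  have hf0 : 0 < ‖f‖ := norm_pos_iff.2 hf
  have h2 : κ * ‖f‖ = ‖T f‖ + 2 * ε * ‖f‖ := by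
    simp only [κ]
    field_simp
  nlinarith

/-- Band operators can be localized, uniformly, with multipliers that are finite combinations of
the projections `M i`. -/
theorem isLocalizable_of_isBlockBand [PseudoMetricSpace I] (hI : DiscretePropertyA I) (hp : 1 ≤ p)
    {T : F →L[ℂ] F} {R : ℝ} (hT : IsBlockBand M T R) : IsLocalizable M T := by
  classical
  have hp0 : 0 < p := zero_lt_one.trans_le hp
  intro δ hδ
  obtain ⟨N, hN⟩ := hI.count R
  have hfin : ∀ i : I, ∀ r : ℝ, {k | dist i k ≤ r}.Finite := fun i r => by
    obtain ⟨N, hN⟩ := hI.count r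
    exact Set.finite_of_encard_le_coe (hN i)
  obtain ⟨t, ht, htδ⟩ : ∃ t : ℝ, 0 < t ∧ ‖T‖ ^ p * (N * t) ≤ (δ / 2) ^ p := by
    have hpos : 0 < (δ / 2) ^ p := Real.rpow_pos_of_pos (by positivity) _
    have hnn : 0 ≤ ‖T‖ ^ p * N := by positivity
    refine ⟨(δ / 2) ^ p / (‖T‖ ^ p * N + 1), by positivity, ?_⟩
    rw [← mul_assoc, mul_div_assoc', div_le_iff₀ (by positivity)]
    nlinarith
  obtain ⟨ρ, hρ0, hρ1, ⟨r, hr⟩, hρv⟩ := hI.weights R t ht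
  have hsupp : ∀ j, {i | ρ j i ≠ 0}.Finite := by
    intro j
    rcases ({i | ρ j i ≠ 0}).eq_empty_or_nonempty with h | ⟨i, hi⟩
    · rw [h]
      exact finite_empty
    · exact (hfin i r).subset fun k hk => hr j i k hi hk
  set w : ℕ → I → ℝ := fun j i => ρ j i ^ (1 / p)
  have hpi : 0 < 1 / p := one_div_pos.2 hp0
  have hw0 : ∀ j i, 0 ≤ w j i := fun j i => Real.rpow_nonneg (hρ0 j i) _
  have hwp : ∀ j i, w j i ^ p = ρ j i := fun j i => by
    rw [← Real.rpow_mul (hρ0 j i), one_div_mul_cancel hp0.ne', Real.rpow_one]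
  set W : ℕ → F →L[ℂ] F := fun j => ∑ i ∈ (hsupp j).toFinset, (w j i : ℂ) • M i
  have hW : ∀ j i f, M i (W j f) = (w j i : ℂ) • M i f := by
    intro j i f
    have h1 : W j f = ∑ k ∈ (hsupp j).toFinset, M k ((w j k : ℂ) • f) := by
      simp [W]
    rw [h1, D.apply_sum]
    split_ifs with h
    · rw [map_smul]
    · have h2 : ρ j i = 0 := by simpa using h
      have h3 : w j i = 0 := by simp only [w, h2]; exact Real.zero_rpow hpi.ne'
      rw [h3, Complex.ofReal_zero, zero_smul]
  have hwsum : ∀ i, ∑' j, ‖w j i‖ₑ ^ p = 1 := by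
    intro i
    rw [← hρ1 i]
    congr 1
    ext j
    rw [← ofReal_norm, ENNReal.ofReal_rpow_of_nonneg (norm_nonneg _) hp0.le,
      Real.norm_of_nonneg (hw0 j i), hwp]
  -- `|a ^ (1 / p) - b ^ (1 / p)| ^ p ≤ |a - b|`
  have hroot : ∀ a b : ℝ, 0 ≤ a → 0 ≤ b → |a ^ (1 / p) - b ^ (1 / p)| ^ p ≤ |a - b| := by
    have hmain : ∀ a b : ℝ, 0 ≤ b → b ≤ a → |a ^ (1 / p) - b ^ (1 / p)| ^ p ≤ |a - b| := by
      intro a b hb hba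
      have ha := hb.trans hba
      have h1 : b ^ (1 / p) ≤ a ^ (1 / p) := Real.rpow_le_rpow hb hba hpi.le
      rw [abs_of_nonneg (sub_nonneg.2 h1), abs_of_nonneg (sub_nonneg.2 hba)]
      have h2 := Real.add_rpow_le_rpow_add (sub_nonneg.2 h1) (Real.rpow_nonneg hb (1 / p)) hp
      rw [sub_add_cancel, ← Real.rpow_mul hb, ← Real.rpow_mul ha, one_div_mul_cancel hp0.ne',
        Real.rpow_one, Real.rpow_one] at h2
      linarith
    intro a b ha hb
    rcases le_total b a with h | h
    · exact hmain a b hb h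
    · rw [abs_sub_comm, abs_sub_comm a b]
      exact hmain b a ha h
  have hwv : ∀ i k, dist i k ≤ R → ∑' j, ‖w j i - w j k‖ₑ ^ p ≤ ENNReal.ofReal t := by
    intro i k hik
    refine le_trans (ENNReal.tsum_le_tsum fun j => ?_) (hρv i k hik)
    rw [← ofReal_norm, ENNReal.ofReal_rpow_of_nonneg (norm_nonneg _) hp0.le, Real.norm_eq_abs]
    exact ENNReal.ofReal_le_ofReal (hroot _ _ (hρ0 _ _) (hρ0 _ _))
  refine ⟨r, fun f hf => ?_⟩
  have hcomm := D.tsum_commutator_le hp0 T (fun i => (hfin i R).toFinset)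
    (fun i k hk g => hT i k (by simpa using hk) g) W w hW N (ENNReal.ofReal t)
    (fun k => by
      have h1 : {i | k ∈ (hfin i R).toFinset} = {i | dist k i ≤ R} := by
        ext i
        simp [dist_comm]
      rw [h1]
      exact_mod_cast hN k)
    (fun i k hk => hwv i k (by simpa using hk)) f
  have hcomm' : ∑' j, ‖W j (T f) - T (W j f)‖ₑ ^ p ≤ (ENNReal.ofReal (δ / 2) * ‖f‖ₑ) ^ p := by
    refine hcomm.trans ?_
    rw [ENNReal.mul_rpow_of_nonneg _ _ hp0.le]
    gcongr
    have h1 : ‖T‖ₑ ^ p * ((N : ℝ≥0∞) * ENNReal.ofReal t)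
        = ENNReal.ofReal (‖T‖ ^ p * (N * t)) := by
      rw [ENNReal.ofReal_mul (by positivity), ENNReal.ofReal_mul (by positivity),
        ENNReal.ofReal_natCast, ← ofReal_norm, ENNReal.ofReal_rpow_of_nonneg (norm_nonneg _) hp0.le]
    rw [h1, ENNReal.ofReal_rpow_of_nonneg (by positivity) hp0.le]
    exact ENNReal.ofReal_le_ofReal htδ
  obtain ⟨j, hj0, hj⟩ := D.exists_multiplier hp T W w hW hwsum hf (half_pos hδ) hcomm'
  have hne : ∀ i, M i (W j f) ≠ 0 → ρ j i ≠ 0 := by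
    intro i hi h0
    apply hi
    have h3 : w j i = 0 := by simp only [w, h0]; exact Real.zero_rpow hpi.ne'
    rw [hW, h3, Complex.ofReal_zero, zero_smul]
  refine ⟨W j f, hj0, fun i hi h0 => hi ?_, fun i k hi hk => hr j i k (hne i hi) (hne k hk), ?_⟩
  · rw [hW, h0, smul_zero]
  · rwa [mul_div_cancel₀ δ two_ne_zero] at hj

/-- Norm limits of band operators can be localized. -/
theorem isLocalizable [PseudoMetricSpace I] (hI : DiscretePropertyA I) (hp : 1 ≤ p)
    {T : F →L[ℂ] F} (hT : ∀ δ : ℝ, 0 < δ → ∃ T' R, IsBlockBand M T' R ∧ ‖T - T'‖ ≤ δ) :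
    IsLocalizable M T := by
  intro δ hδ
  obtain ⟨T', R, hT', hTT'⟩ := hT (δ / 4) (by positivity)
  obtain ⟨r, hr⟩ := D.isLocalizable_of_isBlockBand hI hp hT' (δ / 4) (by positivity)
  refine ⟨r, fun f hf => ?_⟩
  obtain ⟨g, hg0, hgs, hgr, hg⟩ := hr f hf
  refine ⟨g, hg0, hgs, hgr, ?_⟩
  have hf0 : 0 < ‖f‖ := norm_pos_iff.2 hf
  have hd : ∀ h : F, ‖(T - T') h‖ ≤ δ / 4 * ‖h‖ := fun h =>
    ((T - T').le_opNorm h).trans (by gcongr)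
  have h1 : ‖T g‖ ≤ ‖T' g‖ + δ / 4 * ‖g‖ := by
    have h2 : T g = T' g + (T - T') g := by simp
    rw [h2]
    exact (norm_add_le _ _).trans (by gcongr; exact hd g)
  have h3 : ‖T' f‖ ≤ ‖T f‖ + δ / 4 * ‖f‖ := by
    have h2 : T' f = T f - (T - T') f := by simp
    rw [h2]
    exact (norm_sub_le _ _).trans (by gcongr; exact hd f)
  have h4 : ‖T' f‖ / ‖f‖ ≤ ‖T f‖ / ‖f‖ + δ / 4 := by
    rw [div_add' _ _ _ hf0.ne']
    gcongr
  have h5 : 0 ≤ ‖g‖ := norm_nonneg g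
  nlinarith

/-- Repeated localization: an approximate kernel vector `f` of `T` contains a point around which
there are approximate kernel vectors at all scales `k < m` at once.  The radii `r k` do not depend
on `f`, nor on `m`. -/
theorem exists_nested [PseudoMetricSpace I] (hp : 0 < p) {T : F →L[ℂ] F}
    (hT : IsLocalizable M T) : ∃ r : ℕ → ℝ, ∀ (m : ℕ) (f : F), f ≠ 0 →
      ‖T f‖ ≤ (1 / 2) ^ m * ‖f‖ → ∃ i, M i f ≠ 0 ∧ ∀ k < m, ∃ g, g ≠ 0 ∧
        (∀ l, M l g ≠ 0 → dist l i ≤ r k) ∧ ‖T g‖ ≤ (1 / 2) ^ k * ‖g‖ := by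
  -- each localization costs at most a factor `2` in the bound for `‖T f‖ / ‖f‖`
  choose r hr using fun m : ℕ => hT ((1 / 2) ^ (m + 1)) (by positivity)
  refine ⟨r, fun m => ?_⟩
  induction m with
  | zero =>
    intro f hf _
    obtain ⟨i, hi⟩ := D.exists_ne_zero hp hf
    exact ⟨i, hi, fun k hk => absurd hk (Nat.not_lt_zero k)⟩
  | succ m ih =>
    intro f hf hTf
    obtain ⟨g, hg0, hgs, hgr, hg⟩ := hr m f hf
    have hg' : ‖T g‖ ≤ (1 / 2) ^ m * ‖g‖ := by
      refine hg.trans ?_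
      gcongr
      have h1 : ‖T f‖ / ‖f‖ ≤ (1 / 2) ^ (m + 1) := (div_le_iff₀ (norm_pos_iff.2 hf)).2 hTf
      calc ‖T f‖ / ‖f‖ + (1 / 2) ^ (m + 1) ≤ (1 / 2) ^ (m + 1) + (1 / 2) ^ (m + 1) := by gcongr
        _ = (1 / 2) ^ m := by ring
    obtain ⟨i, hi, hik⟩ := ih g hg0 hg'
    refine ⟨i, hgs i hi, fun k hk => ?_⟩
    rcases Nat.lt_succ_iff_lt_or_eq.1 hk with h | rfl
    · exact hik k h
    · exact ⟨g, hg0, fun l hl => hgr l i hl hi, hg'⟩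

end IsLpDecomp

end Localization

/-! ### Multiplication by indicator functions and finite propagation -/

section Cut

variable {X : Type*} [MeasurableSpace X] {μ : Measure X} {p : ℝ≥0∞} [Fact (1 ≤ p)]

theorem mulInd_inter {s t : Set X} (hs : MeasurableSet s) (ht : MeasurableSet t)
    (f : Lp ℂ p μ) : mulInd μ p hs (mulInd μ p ht f) = mulInd μ p (hs.inter ht) f := by
  refine Lp.ext ?_
  filter_upwards [mulInd_ae hs (mulInd μ p ht f), mulInd_ae ht f,
    mulInd_ae (hs.inter ht) f] with y h1 h2 h3
  rw [h1, h3, ← indicator_indicator]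
  by_cases h : y ∈ s
  · rw [indicator_of_mem h, indicator_of_mem h, h2]
  · rw [indicator_of_notMem h, indicator_of_notMem h]

theorem mulInd_congr {s t : Set X} (hs : MeasurableSet s) (ht : MeasurableSet t) (h : s = t)
    (f : Lp ℂ p μ) : mulInd μ p hs f = mulInd μ p ht f := by
  subst h
  rfl

theorem mulInd_of_subset {s t : Set X} (hs : MeasurableSet s) (ht : MeasurableSet t) (h : s ⊆ t)
    (f : Lp ℂ p μ) : mulInd μ p hs (mulInd μ p ht f) = mulInd μ p hs f := by
  rw [mulInd_inter]
  exact mulInd_congr _ _ (inter_eq_left.2 h) f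

theorem mulInd_of_superset {s t : Set X} (hs : MeasurableSet s) (ht : MeasurableSet t) (h : s ⊆ t)
    (f : Lp ℂ p μ) : mulInd μ p ht (mulInd μ p hs f) = mulInd μ p hs f := by
  rw [mulInd_inter]
  exact mulInd_congr _ _ (inter_eq_right.2 h) f

theorem mulInd_of_disjoint {s t : Set X} (hs : MeasurableSet s) (ht : MeasurableSet t)
    (h : Disjoint s t) (f : Lp ℂ p μ) : mulInd μ p hs (mulInd μ p ht f) = 0 := by
  rw [mulInd_inter]
  refine Lp.ext ?_
  filter_upwards [mulInd_ae (hs.inter ht) f, Lp.coeFn_zero ℂ p μ] with y h1 h2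
  rw [h1, h2, h.inter_eq, indicator_empty]
  rfl

theorem mulInd_compl {s : Set X} (hs : MeasurableSet s) (f : Lp ℂ p μ) :
    mulInd μ p hs.compl f = f - mulInd μ p hs f := by
  refine Lp.ext ?_
  filter_upwards [mulInd_ae hs f, mulInd_ae hs.compl f,
    Lp.coeFn_sub f (mulInd μ p hs f)] with y h1 h2 h3
  rw [h2, h3, Pi.sub_apply, h1]
  by_cases h : y ∈ s
  · rw [indicator_of_mem h, indicator_of_notMem (by simpa using h), sub_self]
  · rw [indicator_of_notMem h, indicator_of_mem (show y ∈ sᶜ from h), sub_zero]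

theorem norm_mulInd_le {s : Set X} (hs : MeasurableSet s) (f : Lp ℂ p μ) :
    ‖mulInd μ p hs f‖ ≤ ‖f‖ := by
  have := mulIndLinear_norm_le μ p hs f
  rwa [one_mul] at this

variable [MetricSpace X]

theorem setDist_le {K K' : Set X} {x y : X} (hx : x ∈ K) (hy : y ∈ K') :
    setDist K K' ≤ edist x y :=
  (iInf₂_le x hx).trans (iInf₂_le y hy)

theorem lt_setDist {K K' : Set X} {R r : ℝ} (hR : R < r) (hr : 0 < r)
    (h : ∀ x ∈ K, ∀ y ∈ K', r ≤ dist x y) :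
    ENNReal.ofReal R < setDist K K' := by
  refine ((ENNReal.ofReal_lt_ofReal_iff hr).2 hR).trans_le ?_
  refine le_iInf₂ fun x hx => le_iInf₂ fun y hy => ?_
  rw [edist_dist]
  exact ENNReal.ofReal_le_ofReal (h x hx y hy)

/-- The propagation of `T` is at most `R`. -/
def IsBand (T : Lp ℂ p μ →L[ℂ] Lp ℂ p μ) (R : ℝ) : Prop :=
  ∀ (K K' : Set X) (hK : MeasurableSet K) (hK' : MeasurableSet K'),
    ENNReal.ofReal R < setDist K K' → ∀ f, mulInd μ p hK' (T (mulInd μ p hK f)) = 0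

theorem IsBand.mono {T : Lp ℂ p μ →L[ℂ] Lp ℂ p μ} {R R' : ℝ} (hT : IsBand T R) (h : R ≤ R') :
    IsBand T R' :=
  fun K K' hK hK' hd f => hT K K' hK hK' ((ENNReal.ofReal_le_ofReal h).trans_lt hd) f

/-- `T` is a norm limit of operators of finite propagation. -/
def IsBandDominated (T : Lp ℂ p μ →L[ℂ] Lp ℂ p μ) : Prop :=
  ∀ δ : ℝ, 0 < δ → ∃ T' R, IsBand T' R ∧ ‖T - T'‖ ≤ δ

theorem isBandDominated_of_mem {T : Lp ℂ p μ →L[ℂ] Lp ℂ p μ} (hT : T ∈ BDO μ p) :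
    IsBandDominated T := by
  intro δ hδ
  obtain ⟨T', hT', hd⟩ := Metric.mem_closure_iff.1 hT δ hδ
  have hfin : propagation T' < ∞ := hT'
  refine ⟨T', (propagation T').toReal, fun K K' hK hK' hlt f => ?_, ?_⟩
  · by_contra hne
    rw [ENNReal.ofReal_toReal hfin.ne] at hlt
    refine hlt.not_ge ?_
    have hop : mulInd μ p hK' ∘L T' ∘L mulInd μ p hK ≠ 0 := by
      intro h0
      apply hne
      have := congrArg (fun S : Lp ℂ p μ →L[ℂ] Lp ℂ p μ => S f) h0
      exact this
    exact le_iSup_of_le K (le_iSup_of_le K' (le_iSup_of_le hK (le_iSup_of_le hK'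
      (le_iSup_of_le hop le_rfl))))
  · rw [← dist_eq_norm]
    exact hd.le

theorem IsBandDominated.add {S T : Lp ℂ p μ →L[ℂ] Lp ℂ p μ} (hS : IsBandDominated S)
    (hT : IsBandDominated T) : IsBandDominated (S + T) := by
  intro δ hδ
  obtain ⟨S', R, hS', hSS⟩ := hS (δ / 2) (by positivity)
  obtain ⟨T', R', hT', hTT⟩ := hT (δ / 2) (by positivity)
  refine ⟨S' + T', max R R', fun K K' hK hK' hd f => ?_, ?_⟩
  · rw [add_apply, map_add,
      hS'.mono (le_max_left _ _) K K' hK hK' hd, hT'.mono (le_max_right _ _) K K' hK hK' hd,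
      add_zero]
  · rw [add_sub_add_comm]
    exact (norm_add_le _ _).trans (by linarith)

theorem IsBandDominated.sub {S T : Lp ℂ p μ →L[ℂ] Lp ℂ p μ} (hS : IsBandDominated S)
    (hT : IsBandDominated T) : IsBandDominated (S - T) := by
  intro δ hδ
  obtain ⟨S', R, hS', hSS⟩ := hS (δ / 2) (by positivity)
  obtain ⟨T', R', hT', hTT⟩ := hT (δ / 2) (by positivity)
  refine ⟨S' - T', max R R', fun K K' hK hK' hd f => ?_, ?_⟩
  · rw [sub_apply, map_sub,
      hS'.mono (le_max_left _ _) K K' hK hK' hd, hT'.mono (le_max_right _ _) K K' hK hK' hd,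
      sub_zero]
  · rw [sub_sub_sub_comm]
    exact (norm_sub_le _ _).trans (by linarith)

theorem isBandDominated_one : IsBandDominated (1 : Lp ℂ p μ →L[ℂ] Lp ℂ p μ) := by
  refine fun δ hδ => ⟨1, 0, fun K K' hK hK' hd f => ?_, by simpa using hδ.le⟩
  refine mulInd_of_disjoint hK' hK ?_ f
  rw [Set.disjoint_left]
  intro x hx hx'
  have := hd.trans_le (setDist_le hx' hx)
  simp at this

variable [OpensMeasurableSpace X]

/-- Multiplication by the indicator function of a closed ball. -/
def ballInd (μ : Measure X) (p : ℝ≥0∞) [Fact (1 ≤ p)] (x : X) (r : ℝ) :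
    Lp ℂ p μ →L[ℂ] Lp ℂ p μ :=
  mulInd μ p (measurableSet_closedBall (x := x) (ε := r))

theorem ballInd_ballInd (x : X) {r s : ℝ} (h : r ≤ s) (f : Lp ℂ p μ) :
    ballInd μ p x s (ballInd μ p x r f) = ballInd μ p x r f :=
  mulInd_of_superset _ _ (Metric.closedBall_subset_closedBall h) f

theorem ballInd_ballInd' (x : X) {r s : ℝ} (h : r ≤ s) (f : Lp ℂ p μ) :
    ballInd μ p x r (ballInd μ p x s f) = ballInd μ p x r f :=
  mulInd_of_subset _ _ (Metric.closedBall_subset_closedBall h) f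

theorem norm_ballInd_le (x : X) (r : ℝ) (f : Lp ℂ p μ) : ‖ballInd μ p x r f‖ ≤ ‖f‖ :=
  norm_mulInd_le _ f

theorem norm_sub_ballInd_le (x : X) (r : ℝ) (f : Lp ℂ p μ) : ‖f - ballInd μ p x r f‖ ≤ ‖f‖ := by
  rw [ballInd, ← mulInd_compl]
  exact norm_mulInd_le _ f

theorem IsBand.sub_ballInd {T : Lp ℂ p μ →L[ℂ] Lp ℂ p μ} {R : ℝ} (hT : IsBand T R) (x : X)
    {r s : ℝ} (hs : R < s - r) (hs' : r < s) (f : Lp ℂ p μ) :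
    ballInd μ p x s (T (ballInd μ p x r f)) = T (ballInd μ p x r f) ∧
      ballInd μ p x r (T (ballInd μ p x s f)) = ballInd μ p x r (T f) := by
  have hd : ∀ y ∈ Metric.closedBall x r, ∀ z ∈ (Metric.closedBall x s)ᶜ, s - r ≤ dist y z := by
    intro y hy z hz
    rw [mem_compl_iff, Metric.mem_closedBall, not_le] at hz
    rw [Metric.mem_closedBall] at hy
    have := dist_triangle z y x
    rw [dist_comm z y] at this
    linarith
  constructor
  · have h1 := hT _ _ (measurableSet_closedBall (x := x) (ε := r))
      (measurableSet_closedBall (x := x) (ε := s)).compl (lt_setDist hs (by linarith) hd) f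
    rw [mulInd_compl, sub_eq_zero] at h1
    exact h1.symm
  · have h1 := hT _ _ (measurableSet_closedBall (x := x) (ε := s)).compl
      (measurableSet_closedBall (x := x) (ε := r)) (lt_setDist hs (by linarith)
        fun y hy z hz => by rw [dist_comm]; exact hd z hz y hy) f
    rw [mulInd_compl, map_sub, map_sub, sub_eq_zero] at h1
    exact h1.symm

end Cut

/-! ### Discretization -/

section Net

variable {X : Type*} [MetricSpace X] [MeasurableSpace X]

/-- A space of bounded geometry with property A′ has a countable net that inherits property A, and
a measurable choice of nearby points of the net. -/
theorem exists_net [Nonempty X] [OpensMeasurableSpace X] (hgeom : BoundedGeometry X)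
    (hA' : PropertyA' X) :
    ∃ (Z : Set X) (c : X → Z) (b : ℝ), Countable Z ∧ DiscretePropertyA Z ∧ 0 < b ∧
      (∀ x, dist (c x : X) x ≤ b) ∧ ∀ z, MeasurableSet (c ⁻¹' {z}) := by
  obtain ⟨ε, hε, hN⟩ := hgeom
  -- a maximal `2 ε`-separated set: each ball of radius `ε` contains at most one of its points
  obtain ⟨Z, hZ⟩ := zorn_subset {s : Set X | s.Pairwise fun x y => 2 * ε ≤ dist x y} (by
    intro c hc hchain
    refine ⟨⋃₀ c, ?_, fun s hs => subset_sUnion_of_mem hs⟩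
    exact (pairwise_sUnion hchain.directedOn).2 fun s hs => hc hs)
  have hsep : Z.Pairwise fun x y => 2 * ε ≤ dist x y := hZ.prop
  have hcov : ∀ x, ∃ z ∈ Z, dist z x < 2 * ε := by
    intro x
    by_contra! h
    have hins : (insert x Z).Pairwise fun x y => 2 * ε ≤ dist x y :=
      pairwise_insert.2 ⟨hsep, fun z hz _ => ⟨by rw [dist_comm]; exact h z hz, h z hz⟩⟩
    have hx : x ∈ Z := hZ.le_of_ge hins (subset_insert x Z) (mem_insert x Z)
    have := h x hx
    rw [dist_self] at this
    linarith
  have hcount : ∀ R : ℝ, ∃ N : ℕ, ∀ i : Z, {k : Z | dist i k ≤ R}.encard ≤ N := by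
    intro R
    obtain ⟨N, hN⟩ := hN (|R| + 1) (by positivity)
    refine ⟨N, fun i => ?_⟩
    obtain ⟨s, hs, hcover⟩ := hN i
    have hex : ∀ k : Z, dist i k ≤ R → ∃ y ∈ s, dist (k : X) y < ε := by
      intro k hk
      have hmem : (k : X) ∈ Metric.ball (i : X) (|R| + 1) := by
        rw [Metric.mem_ball, dist_comm]
        have : dist (i : X) k ≤ R := hk
        linarith [le_abs_self R]
      obtain ⟨y, hy, hky⟩ := mem_iUnion₂.1 (hcover hmem)
      exact ⟨y, hy, hky⟩
    choose! g hgs hg using hex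
    have hinj : InjOn g {k : Z | dist i k ≤ R} := by
      intro k hk l hl hkl
      by_contra hne
      have h1 := hsep k.2 l.2 fun h => hne (Subtype.ext h)
      have h2 := dist_triangle_right (k : X) l (g k)
      have h3 := hg k hk
      have h4 := hg l hl
      rw [← hkl] at h4
      linarith
    calc {k : Z | dist i k ≤ R}.encard ≤ (s : Set X).encard :=
          encard_le_encard_of_injOn (fun k hk => hgs k hk) hinj
      _ = s.card := encard_coe_eq_coe_finsetCard s
      _ ≤ N := by exact_mod_cast hs
  have hne : Nonempty Z := by
    obtain ⟨z, hz, -⟩ := hcov (Classical.arbitrary X)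
    exact ⟨⟨z, hz⟩⟩
  have hctbl : Countable Z := by
    obtain ⟨i⟩ := hne
    rw [← countable_univ_iff]
    have : (univ : Set Z) = ⋃ n : ℕ, {k | dist i k ≤ n} := by
      ext k
      simp only [mem_univ, mem_iUnion, mem_ofPred_eq, true_iff]
      exact exists_nat_ge (dist i k)
    rw [this]
    refine countable_iUnion fun n => ?_
    obtain ⟨N, hN⟩ := hcount n
    exact (Set.finite_of_encard_le_coe (hN i)).countable
  -- `c x` is the first point of an enumeration of `Z` that is close to `x`
  obtain ⟨u, hu⟩ := exists_surjective_nat Z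
  have hn : ∀ x, ∃ n, dist (u n : X) x < 2 * ε := by
    intro x
    obtain ⟨z, hz, hzx⟩ := hcov x
    obtain ⟨n, hn⟩ := hu ⟨z, hz⟩
    exact ⟨n, by rw [hn]; exact hzx⟩
  classical
  have hmeas : Measurable fun x => Nat.find (hn x) :=
    measurable_find hn fun n => by
      have : {x | dist (u n : X) x < 2 * ε} = Metric.ball (u n : X) (2 * ε) := by
        ext x
        simp [dist_comm]
      rw [this]
      exact measurableSet_ball
  refine ⟨Z, fun x => u (Nat.find (hn x)), 2 * ε, hctbl, ⟨hcount, ?_⟩, by positivity,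
    fun x => (Nat.find_spec (hn x)).le, fun z => ?_⟩
  · intro R t ht
    -- the parameter of property A′ bounds the variation and, through `1 / t`, the range of `dist`
    obtain ⟨ρ, hρ, hsum, ⟨D, hD⟩, hvar, -⟩ := hA' (min t (1 / (|R| + 1))) (by positivity)
    refine ⟨fun j z => ρ j z, fun j z => ((hρ j).2.2 z).1, fun z => ?_, ⟨D, ?_⟩, ?_⟩
    · rw [← ENNReal.ofReal_tsum_of_nonneg (fun j => ((hρ j).2.2 z).1) (hsum z).summable,
        (hsum z).tsum_eq, ENNReal.ofReal_one]
    · intro j i k hi hk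
      exact hD j i (subset_tsupport _ hi) k (subset_tsupport _ hk)
    · intro i k hik
      have h1 : dist (i : X) k ≤ 1 / min t (1 / (|R| + 1)) := by
        rw [le_div_iff₀ (by positivity)]
        have h2 : dist (i : X) k ≤ |R| + 1 := by
          have : dist (i : X) k ≤ R := hik
          linarith [le_abs_self R]
        calc dist (i : X) k * min t (1 / (|R| + 1)) ≤ (|R| + 1) * (1 / (|R| + 1)) := by
              gcongr
              exact min_le_right _ _
          _ = 1 := by field_simp
      obtain ⟨h2, h3⟩ := hvar i k h1
      rw [← ENNReal.ofReal_tsum_of_nonneg (fun j => abs_nonneg _) h2]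
      exact ENNReal.ofReal_le_ofReal (h3.le.trans (min_le_left _ _))
  · exact hmeas (t := u ⁻¹' {z}) trivial

variable [OpensMeasurableSpace X] {μ : Measure X} {p : ℝ≥0∞} [Fact (1 ≤ p)]

/-- Cutting a function into its restrictions to the cells of a countable measurable partition is
an `ℓ_p`-decomposition of `L_p`. -/
theorem isLpDecomp_cells {I : Type*} [Countable I] (hp : p ≠ ∞) {c : X → I}
    (hc : ∀ i, MeasurableSet (c ⁻¹' {i})) :
    IsLpDecomp p.toReal (fun i => mulInd μ p (hc i)) := by
  have hdisj : Pairwise (Function.onFun Disjoint fun i => c ⁻¹' {i}) := fun i k hik =>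
    Disjoint.preimage c (disjoint_singleton.2 hik)
  refine ⟨fun i f => mulInd_of_subset _ _ subset_rfl f,
    fun i k hik f => mulInd_of_disjoint _ _ (hdisj hik) f, fun f => ?_⟩
  have hp0 : p ≠ 0 := (zero_lt_one.trans_le (Fact.out : 1 ≤ p)).ne'
  have hpr : p.toReal ≠ 0 := (ENNReal.toReal_pos hp0 hp).ne'
  have h1 : ∀ (ν : Measure X), eLpNorm f p ν ^ p.toReal = ∫⁻ x, ‖f x‖ₑ ^ p.toReal ∂ν := by
    intro ν
    rw [eLpNorm_eq_lintegral_rpow_enorm_toReal hp0 hp, ← ENNReal.rpow_mul,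
      one_div_mul_cancel hpr, ENNReal.rpow_one]
  have h2 : ∀ i, ‖mulInd μ p (hc i) f‖ₑ ^ p.toReal
      = ∫⁻ x in c ⁻¹' {i}, ‖f x‖ₑ ^ p.toReal ∂μ := by
    intro i
    rw [Lp.enorm_def, eLpNorm_congr_ae (mulInd_ae (hc i) f),
      eLpNorm_indicator_eq_eLpNorm_restrict (hc i), h1]
  simp_rw [h2]
  rw [← lintegral_iUnion hc hdisj, ← preimage_iUnion, iUnion_of_singleton, preimage_univ,
    Measure.restrict_univ, Lp.enorm_def, h1]

end Net

/-! ### Strong continuity of the shifts -/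

section Riesz

variable {α : Type*} [MeasurableSpace α] {μ : Measure α}

/-- The Riesz–Scheffé theorem: almost everywhere convergence together with equality of the
`L_p`-norms implies convergence in `L_p`.  It is Fatou's lemma for the functions
`2 ^ (p - 1) * (|f n| ^ p + |g| ^ p) - |f n - g| ^ p ≥ 0`. -/
theorem tendsto_lintegral_sub_of_ae {p : ℝ} (hp : 1 ≤ p) {f : ℕ → α → ℂ} {g : α → ℂ}
    (hf : ∀ n, AEStronglyMeasurable (f n) μ) (hg : AEStronglyMeasurable g μ)
    (hae : ∀ᵐ x ∂μ, Tendsto (fun n => f n x) atTop (𝓝 (g x)))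
    (hnorm : ∀ n, ∫⁻ x, ‖f n x‖ₑ ^ p ∂μ = ∫⁻ x, ‖g x‖ₑ ^ p ∂μ)
    (hfin : ∫⁻ x, ‖g x‖ₑ ^ p ∂μ ≠ ∞) :
    Tendsto (fun n => ∫⁻ x, ‖f n x - g x‖ₑ ^ p ∂μ) atTop (𝓝 0) := by
  have hp0 : 0 < p := zero_lt_one.trans_le hp
  set c : ℝ≥0∞ := 2 ^ (p - 1)
  have hc : c ≠ ∞ := ENNReal.rpow_ne_top_of_nonneg (by linarith) (by simp)
  set I := ∫⁻ x, ‖g x‖ₑ ^ p ∂μ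
  set L := c * (I + I)
  have hL : L ≠ ∞ := ENNReal.mul_ne_top hc (ENNReal.add_ne_top.2 ⟨hfin, hfin⟩)
  set a : ℕ → ℝ≥0∞ := fun n => ∫⁻ x, ‖f n x - g x‖ₑ ^ p ∂μ
  have hle : ∀ n x, ‖f n x - g x‖ₑ ^ p ≤ c * (‖f n x‖ₑ ^ p + ‖g x‖ₑ ^ p) := fun n x =>
    (ENNReal.rpow_le_rpow enorm_sub_le hp0.le).trans
      (ENNReal.rpow_add_le_mul_rpow_add_rpow _ _ hp)
  have hmf : ∀ n, AEMeasurable (fun x => ‖f n x‖ₑ ^ p) μ := fun n => (hf n).enorm.pow_const p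
  have hmg : AEMeasurable (fun x => ‖g x‖ₑ ^ p) μ := hg.enorm.pow_const p
  have hmd : ∀ n, AEMeasurable (fun x => ‖f n x - g x‖ₑ ^ p) μ :=
    fun n => ((hf n).sub hg).enorm.pow_const p
  have hint : ∀ n, ∫⁻ x, c * (‖f n x‖ₑ ^ p + ‖g x‖ₑ ^ p) ∂μ = L := by
    intro n
    rw [lintegral_const_mul' _ _ hc, lintegral_add_left' (hmf n), hnorm n]
  have haL : ∀ n, a n ≤ L := fun n => (lintegral_mono (hle n)).trans (hint n).le
  have hsub : ∀ n, ∫⁻ x, (c * (‖f n x‖ₑ ^ p + ‖g x‖ₑ ^ p) - ‖f n x - g x‖ₑ ^ p) ∂μ = L - a n := by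
    intro n
    rw [lintegral_sub' (hmd n) ((haL n).trans_lt hL.lt_top).ne (Eventually.of_forall (hle n)),
      hint n]
  have hfatou : L ≤ liminf (fun n => L - a n) atTop := by
    have h1 := lintegral_liminf_le' (μ := μ) (u := atTop)
      (f := fun n x => c * (‖f n x‖ₑ ^ p + ‖g x‖ₑ ^ p) - ‖f n x - g x‖ₑ ^ p)
      fun n => (((hmf n).add hmg).const_mul c).sub (hmd n)
    simp_rw [hsub] at h1
    refine le_trans (le_of_eq ?_) h1
    have h2 : L = ∫⁻ x, c * (‖g x‖ₑ ^ p + ‖g x‖ₑ ^ p) ∂μ := by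
      rw [lintegral_const_mul' _ _ hc, lintegral_add_left' hmg]
    rw [h2]
    refine lintegral_congr_ae ?_
    filter_upwards [hae] with x hx
    have hcont : Continuous fun z : ℂ => ‖z‖ₑ ^ p :=
      (ENNReal.continuous_rpow_const).comp continuous_enorm
    have h3 : Tendsto (fun n => ‖f n x‖ₑ ^ p) atTop (𝓝 (‖g x‖ₑ ^ p)) :=
      (hcont.tendsto _).comp hx
    have h4 : Tendsto (fun n => ‖f n x - g x‖ₑ ^ p) atTop (𝓝 0) := by
      have := (hcont.tendsto _).comp (hx.sub_const (g x))
      simpa [Function.comp_def, ENNReal.zero_rpow_of_pos hp0] using this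
    have h5 := ENNReal.Tendsto.sub
      (ENNReal.Tendsto.const_mul (h3.add_const (‖g x‖ₑ ^ p)) (Or.inr hc)) h4
      (Or.inr ENNReal.zero_ne_top)
    rw [tsub_zero] at h5
    exact h5.liminf_eq.symm
  rcases eq_or_ne L 0 with h0 | h0
  · have : a = fun _ => 0 := funext fun n => le_antisymm ((haL n).trans h0.le) bot_le
    exact this ▸ tendsto_const_nhds
  refine ENNReal.tendsto_nhds_zero.2 fun ε hε => ?_
  have h1 : L - ε < liminf (fun n => L - a n) atTop :=
    (ENNReal.sub_lt_self hL h0 hε.ne').trans_le hfatou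
  filter_upwards [eventually_lt_of_lt_liminf h1] with n hn
  exact (lt_of_tsub_lt_tsub_left hn).le

end Riesz

namespace ShiftSystem

variable {X : Type*} [MetricSpace X] [ProperSpace X] [MeasurableSpace X] [BorelSpace X]
  {μ : Measure X} [μ.Regular] {p : ℝ≥0∞} [Fact (1 ≤ p)] (S : ShiftSystem μ p)

theorem one_lt_toReal (S : ShiftSystem μ p) : 1 < p.toReal := by
  have := (ENNReal.toReal_lt_toReal ENNReal.one_ne_top S.lt_top.ne).2 S.one_lt
  simpa using this

theorem continuous_U_of_continuous {g : X → ℂ} (hg : Continuous g) (hgp : MemLp g p μ) :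
    Continuous fun y => S.U y (hgp.toLp g) := by
  have hp0 : p ≠ 0 := (zero_lt_one.trans S.one_lt).ne'
  have hpr : 0 < p.toReal := zero_lt_one.trans S.one_lt_toReal
  have hU : ∀ y, (S.U y (hgp.toLp g) : X → ℂ) =ᵐ[μ] fun z => g (S.φ y z) * S.h y z := by
    intro y
    filter_upwards [S.U_ae y (hgp.toLp g), (S.quasi y).ae hgp.coeFn_toLp] with z h1 h2
    rw [h1, h2]
  rw [continuous_iff_seqContinuous]
  intro y y₀ hy
  rw [Function.comp_def, tendsto_iff_edist_tendsto_0]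
  have h1 : Tendsto (fun n => ∫⁻ x, ‖S.U (y n) (hgp.toLp g) x - S.U y₀ (hgp.toLp g) x‖ₑ ^ p.toReal
      ∂μ) atTop (𝓝 0) := by
    refine tendsto_lintegral_sub_of_ae S.one_lt_toReal.le (fun n => Lp.aestronglyMeasurable _)
      (Lp.aestronglyMeasurable _) ?_ ?_ ?_
    · filter_upwards [S.continuous, ae_all_iff.2 fun n => hU (y n), hU y₀] with z hz h1 h2
      rw [h2]
      simp_rw [h1]
      exact ((((hg.comp hz.1).mul hz.2).tendsto y₀).comp hy)
    · have hnorm : ∀ y, ∫⁻ x, ‖S.U y (hgp.toLp g) x‖ₑ ^ p.toReal ∂μ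
          = ‖hgp.toLp g‖ₑ ^ p.toReal := by
        intro y
        have h2 : ‖S.U y (hgp.toLp g)‖ₑ = ‖hgp.toLp g‖ₑ := by
          rw [← ofReal_norm, ← ofReal_norm, LinearIsometryEquiv.norm_map]
        rw [← h2, Lp.enorm_def, eLpNorm_eq_lintegral_rpow_enorm_toReal hp0 S.lt_top.ne,
          ← ENNReal.rpow_mul, one_div_mul_cancel hpr.ne', ENNReal.rpow_one]
      exact fun n => (hnorm _).trans (hnorm _).symm
    · exact (lintegral_rpow_enorm_lt_top_of_eLpNorm_lt_top hp0 S.lt_top.ne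
        (Lp.memLp _).2).ne
  have h2 := ((ENNReal.continuous_rpow_const (y := 1 / p.toReal)).tendsto 0).comp h1
  rw [ENNReal.zero_rpow_of_pos (one_div_pos.2 hpr)] at h2
  refine h2.congr fun n => ?_
  rw [Lp.edist_def, eLpNorm_eq_lintegral_rpow_enorm_toReal hp0 S.lt_top.ne]
  rfl

/-- The shifts `U_y` depend on `y` continuously in the strong operator topology. -/
theorem continuous_U (f : Lp ℂ p μ) : Continuous fun y => S.U y f := by
  refine continuous_of_uniform_approx_of_continuous fun u hu => ?_
  obtain ⟨ε, hε, hεu⟩ := Metric.mem_uniformity_dist.1 hu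
  obtain ⟨g, -, hfg, hg, hgp⟩ := (Lp.memLp f).exists_hasCompactSupport_eLpNorm_sub_le S.lt_top.ne
    (ε := ENNReal.ofReal (ε / 2)) (by simpa using hε)
  refine ⟨_, S.continuous_U_of_continuous hg hgp, fun y => hεu ?_⟩
  rw [dist_eq_norm, ← map_sub, LinearIsometryEquiv.norm_map]
  have h1 : ‖f - hgp.toLp g‖ ≤ ε / 2 := by
    have h2 : f - hgp.toLp g = ((Lp.memLp f).sub hgp).toLp ((f : X → ℂ) - g) := by
      rw [MemLp.toLp_sub (Lp.memLp f) hgp, Lp.toLp_coeFn]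
    rw [h2, Lp.norm_toLp]
    exact ENNReal.toReal_le_of_le_ofReal (by positivity) hfg
  linarith

theorem continuous_U_symm (f : Lp ℂ p μ) : Continuous fun y => (S.U y).symm f := by
  refine continuous_iff_continuousAt.2 fun y₀ => ?_
  rw [ContinuousAt, tendsto_iff_norm_sub_tendsto_zero]
  have hc : Continuous fun y => ‖f - S.U y ((S.U y₀).symm f)‖ :=
    (continuous_const.sub (S.continuous_U ((S.U y₀).symm f))).norm
  have h1 := hc.tendsto y₀
  rw [LinearIsometryEquiv.apply_symm_apply, sub_self, norm_zero] at h1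
  refine h1.congr fun y => ?_
  rw [← LinearIsometryEquiv.norm_map (S.U y) ((S.U y).symm f - (S.U y₀).symm f), map_sub,
    LinearIsometryEquiv.apply_symm_apply]

/-! ### Shifted operators -/

theorem conj_apply (y : X) (B : Lp ℂ p μ →L[ℂ] Lp ℂ p μ) (f : Lp ℂ p μ) :
    S.conj y B f = S.U y (B ((S.U y).symm f)) := rfl

theorem conj_add (y : X) (B C : Lp ℂ p μ →L[ℂ] Lp ℂ p μ) :
    S.conj y (B + C) = S.conj y B + S.conj y C := by
  ext1 f
  simp [conj_apply]

theorem conj_sub (y : X) (B C : Lp ℂ p μ →L[ℂ] Lp ℂ p μ) :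
    S.conj y (B - C) = S.conj y B - S.conj y C := by
  ext1 f
  simp [conj_apply]

theorem conj_one (y : X) : S.conj y (1 : Lp ℂ p μ →L[ℂ] Lp ℂ p μ) = 1 := by
  ext1 f
  simp [conj_apply]

theorem conj_comp (y : X) (B C : Lp ℂ p μ →L[ℂ] Lp ℂ p μ) (f : Lp ℂ p μ) :
    S.conj y B (S.conj y C f) = S.conj y (B ∘L C) f := by
  simp [conj_apply]

theorem norm_conj_apply_le (y : X) (B : Lp ℂ p μ →L[ℂ] Lp ℂ p μ) (f : Lp ℂ p μ) :
    ‖S.conj y B f‖ ≤ ‖B‖ * ‖f‖ := by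
  rw [conj_apply, LinearIsometryEquiv.norm_map]
  refine (B.le_opNorm _).trans ?_
  rw [LinearIsometryEquiv.norm_map]

theorem norm_conj_le (y : X) (B : Lp ℂ p μ →L[ℂ] Lp ℂ p μ) : ‖S.conj y B‖ ≤ ‖B‖ :=
  ContinuousLinearMap.opNorm_le_bound _ (norm_nonneg _) (S.norm_conj_apply_le y B)

theorem continuous_conj_apply (B : Lp ℂ p μ →L[ℂ] Lp ℂ p μ) (f : Lp ℂ p μ) :
    Continuous fun y => S.conj y B f := by
  refine continuous_iff_continuousAt.2 fun y₀ => ?_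
  rw [ContinuousAt, tendsto_iff_norm_sub_tendsto_zero]
  set g : X → Lp ℂ p μ := fun y => B ((S.U y).symm f)
  have hg : Continuous g := B.continuous.comp (S.continuous_U_symm f)
  have hc : Continuous fun y => ‖g y - g y₀‖ + ‖S.U y (g y₀) - S.U y₀ (g y₀)‖ :=
    (hg.sub continuous_const).norm.add ((S.continuous_U (g y₀)).sub continuous_const).norm
  have h1 := hc.tendsto y₀
  simp only [sub_self, norm_zero, add_zero] at h1
  refine squeeze_zero (fun y => norm_nonneg _) (fun y => ?_) h1
  have h2 : S.conj y B f - S.conj y₀ B f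
      = S.U y (g y - g y₀) + (S.U y (g y₀) - S.U y₀ (g y₀)) := by
    rw [map_sub, conj_apply, conj_apply]
    abel
  rw [h2]
  refine (norm_add_le _ _).trans ?_
  rw [LinearIsometryEquiv.norm_map]

theorem U_mulInd (y : X) {s : Set X} (hs : MeasurableSet s) (f : Lp ℂ p μ) :
    S.U y (mulInd μ p hs f) = mulInd μ p (S.measurable_φ y hs) (S.U y f) := by
  refine Lp.ext ?_
  filter_upwards [S.U_ae y (mulInd μ p hs f), (S.quasi y).ae (mulInd_ae hs f),
    mulInd_ae (S.measurable_φ y hs) (S.U y f), S.U_ae y f] with z h1 h2 h3 h4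
  rw [h1, h2, h3]
  by_cases h : S.φ y z ∈ s
  · rw [indicator_of_mem h, indicator_of_mem (show z ∈ S.φ y ⁻¹' s from h), h4]
  · rw [indicator_of_notMem h, indicator_of_notMem (show z ∉ S.φ y ⁻¹' s from h), zero_mul]

theorem U_symm_mulInd (y : X) {s : Set X} (hs : MeasurableSet s) (f : Lp ℂ p μ) :
    (S.U y).symm (mulInd μ p hs f) = mulInd μ p (S.measurable_φ_symm y hs) ((S.U y).symm f) := by
  apply (S.U y).injective
  rw [LinearIsometryEquiv.apply_symm_apply, U_mulInd, LinearIsometryEquiv.apply_symm_apply]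
  refine mulInd_congr _ _ ?_ f
  ext z
  simp

theorem U_ballInd (y : X) (r : ℝ) (f : Lp ℂ p μ) :
    S.U y (ballInd μ p y r f) = ballInd μ p S.x₀ r (S.U y f) := by
  rw [ballInd, U_mulInd]
  refine mulInd_congr _ _ ?_ _
  ext z
  simp only [mem_preimage, Metric.mem_closedBall]
  have h1 := (S.φ y).dist_eq z S.x₀
  rw [S.φ_base] at h1
  rw [h1]

theorem U_symm_ballInd (y : X) (r : ℝ) (f : Lp ℂ p μ) :
    (S.U y).symm (ballInd μ p S.x₀ r f) = ballInd μ p y r ((S.U y).symm f) := by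
  apply (S.U y).injective
  rw [U_ballInd, LinearIsometryEquiv.apply_symm_apply, LinearIsometryEquiv.apply_symm_apply]

theorem isBand_conj (y : X) {T : Lp ℂ p μ →L[ℂ] Lp ℂ p μ} {R : ℝ} (hT : IsBand T R) :
    IsBand (S.conj y T) R := by
  intro K K' hK hK' hd f
  apply (S.U y).symm.injective
  rw [U_symm_mulInd, conj_apply, LinearIsometryEquiv.symm_apply_apply, U_symm_mulInd, map_zero]
  refine hT _ _ _ _ (hd.trans_le ?_) _
  refine le_iInf₂ fun a ha => le_iInf₂ fun b hb => ?_
  rw [← (S.φ y).symm.edist_eq a b]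
  exact setDist_le ha hb

/-- Multiplication by the indicator function of the closed ball of radius `n` about the base
point. -/
def cut (n : ℕ) : Lp ℂ p μ →L[ℂ] Lp ℂ p μ := ballInd μ p S.x₀ n

theorem norm_cut_le (n : ℕ) (f : Lp ℂ p μ) : ‖S.cut n f‖ ≤ ‖f‖ := norm_ballInd_le _ _ f

theorem norm_sub_cut_le (n : ℕ) (f : Lp ℂ p μ) : ‖f - S.cut n f‖ ≤ ‖f‖ :=
  norm_sub_ballInd_le _ _ f

/-- Shifts of a band-dominated operator spread supports by a uniformly bounded amount, up to small
errors. -/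
theorem exists_cut_conj {T : Lp ℂ p μ →L[ℂ] Lp ℂ p μ} (hT : IsBandDominated T) (n : ℕ) {δ : ℝ}
    (hδ : 0 < δ) : ∃ m, ∀ y f,
      ‖S.conj y T (S.cut n f) - S.cut m (S.conj y T (S.cut n f))‖ ≤ δ * ‖f‖ ∧
      ‖S.cut n (S.conj y T f) - S.cut n (S.conj y T (S.cut m f))‖ ≤ δ * ‖f‖ := by
  obtain ⟨T', R, hT', hTT'⟩ := hT δ hδ
  obtain ⟨m, hm⟩ := exists_nat_gt (n + |R|)
  refine ⟨m, fun y f => ?_⟩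
  have hR := le_abs_self R
  have hband := (S.isBand_conj y hT').sub_ballInd S.x₀ (r := n) (s := m) (by linarith)
    (by linarith [abs_nonneg R]) f
  have hsub : ∀ g, S.conj y T g = S.conj y (T - T') g + S.conj y T' g := fun g => by
    rw [conj_sub, sub_apply, sub_add_cancel]
  have hle : ∀ g, ‖S.conj y (T - T') g‖ ≤ δ * ‖g‖ := fun g =>
    (S.norm_conj_apply_le y _ g).trans (by gcongr)
  constructor
  · have h1 : S.cut m (S.conj y T' (S.cut n f)) = S.conj y T' (S.cut n f) := hband.1
    rw [hsub, map_add, h1, add_sub_add_right_eq_sub]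
    refine (S.norm_sub_cut_le m _).trans ((hle _).trans ?_)
    gcongr
    exact S.norm_cut_le n f
  · have h1 : S.cut n (S.conj y T' (S.cut m f)) = S.cut n (S.conj y T' f) := hband.2
    rw [hsub, hsub (S.cut m f), map_add, map_add, h1, add_sub_add_right_eq_sub, ← map_sub,
      ← map_sub]
    refine (S.norm_cut_le n _).trans ((hle _).trans ?_)
    gcongr
    exact S.norm_sub_cut_le m f

end ShiftSystem

/-! ### Compactness turns weak convergence into norm convergence -/

section Convergence

variable {E F G α : Type*} [NormedAddCommGroup E] [NormedSpace ℂ E] [NormedAddCommGroup F]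
  [NormedSpace ℂ F] [NormedAddCommGroup G] [NormedSpace ℂ G] {l : Filter α}

/-- A uniform limit of convergent families converges. -/
theorem exists_tendsto_of_forall_le [CompleteSpace G] [l.NeBot] {u : α → G}
    (h : ∀ ε : ℝ, 0 < ε → ∃ v : α → G, (∃ a, Tendsto v l (𝓝 a)) ∧ ∀ y, ‖u y - v y‖ ≤ ε) :
    ∃ a, Tendsto u l (𝓝 a) := by
  refine cauchy_map_iff_exists_tendsto.1 (Metric.cauchy_iff.2 ⟨inferInstance, fun ε hε => ?_⟩)
  obtain ⟨v, ⟨a, ha⟩, hv⟩ := h (ε / 4) (by positivity)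
  refine ⟨Metric.ball a (ε / 2), ?_, fun b hb c hc => ?_⟩
  · refine mem_map.2 ((ha.eventually
      (Metric.ball_mem_nhds a (show 0 < ε / 4 by positivity))).mono fun y hy => ?_)
    rw [dist_eq_norm] at hy
    rw [mem_ball_iff_norm]
    calc ‖u y - a‖ ≤ ‖u y - v y‖ + ‖v y - a‖ := norm_sub_le_norm_sub_add_norm_sub _ _ _
      _ < ε / 2 := by linarith [hv y]
  · have := dist_triangle_right b c a
    rw [Metric.mem_ball] at hb hc
    linarith

/-- A compact operator maps a bounded family to a norm convergent one as soon as the image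
converges weakly. -/
theorem exists_tendsto_of_isCompactOperator [l.NeBot] {K : E →L[ℂ] F} (hK : IsCompactOperator K)
    {v : α → E} {C : ℝ} (hv : ∀ y, ‖v y‖ ≤ C)
    (h : ∀ φ : StrongDual ℂ F, ∃ a, Tendsto (fun y => φ (K (v y))) l (𝓝 a)) :
    ∃ a, Tendsto (fun y => K (v y)) l (𝓝 a) := by
  have hS := hK.isCompact_closure_image_closedBall (𝕜₁ := ℂ) C
  have hmem : ∀ y, K (v y) ∈ closure (K '' Metric.closedBall 0 C) := fun y =>
    subset_closure ⟨v y, by simpa using hv y, rfl⟩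
  have hle : map (fun y => K (v y)) l ≤ 𝓟 (closure (K '' Metric.closedBall 0 C)) :=
    le_principal_iff.2 (mem_map.2 (univ_mem' hmem))
  obtain ⟨a, -, ha⟩ := hS hle
  refine ⟨a, hS.le_nhds_of_unique_clusterPt (le_principal_iff.1 hle) fun b _ hb => ?_⟩
  have huniq : ∀ c, ClusterPt c (map (fun y => K (v y)) l) → ∀ φ : StrongDual ℂ F, ∀ d,
      Tendsto (fun y => φ (K (v y))) l (𝓝 d) → φ c = d := by
    intro c hc φ d hd
    have h1 : MapClusterPt c l (fun y => K (v y)) := hc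
    have h2 : MapClusterPt (φ c) l (fun y => φ (K (v y))) :=
      h1.continuousAt_comp φ.continuous.continuousAt
    have h3 : (𝓝 (φ c) ⊓ 𝓝 d).NeBot := h2.neBot.mono (inf_le_inf_left _ hd)
    exact eq_of_nhds_neBot h3
  refine (SeparatingDual.eq_iff_forall_dual_eq (R := ℂ)).2 fun φ => ?_
  obtain ⟨d, hd⟩ := h φ
  rw [huniq b hb φ d hd, huniq a ha φ d hd]

/-- A compact operator maps bounded weak null families to norm null families. -/
theorem tendsto_zero_of_isCompactOperator [l.NeBot] {K : E →L[ℂ] F} (hK : IsCompactOperator K)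
    {v : α → E} {C : ℝ} (hv : ∀ y, ‖v y‖ ≤ C)
    (h : ∀ φ : StrongDual ℂ E, Tendsto (fun y => φ (v y)) l (𝓝 0)) :
    Tendsto (fun y => K (v y)) l (𝓝 0) := by
  obtain ⟨a, ha⟩ := exists_tendsto_of_isCompactOperator hK hv fun φ => ⟨0, h (φ ∘L K)⟩
  have : a = 0 := by
    refine (SeparatingDual.eq_zero_iff_forall_dual_eq_zero (R := ℂ) a).2 fun φ => ?_
    exact tendsto_nhds_unique ((φ.continuous.tendsto a).comp ha) (h (φ ∘L K))
  exact this ▸ ha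

/-- Bounded strong convergence is uniform on compact sets: it becomes norm convergence after
composition with a compact operator. -/
theorem tendsto_comp_of_isCompactOperator {L : α → F →L[ℂ] G} {L₀ : F →L[ℂ] G} {C : ℝ}
    (hL : ∀ y, ‖L y‖ ≤ C) (h : ∀ f, Tendsto (fun y => L y f) l (𝓝 (L₀ f)))
    {K : E →L[ℂ] F} (hK : IsCompactOperator K) :
    Tendsto (fun y => L y ∘L K) l (𝓝 (L₀ ∘L K)) := by
  have hS := (hK.isCompact_closure_image_closedBall (𝕜₁ := ℂ) 1).totallyBounded
  rw [Metric.tendsto_nhds]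
  intro ε hε
  set C' := |C| + ‖L₀‖ + 1
  have hC' : 0 < C' := by positivity
  obtain ⟨t, ht, hcov⟩ := Metric.totallyBounded_iff.1 hS (ε / 4 / C') (by positivity)
  have hev : ∀ᶠ y in l, ∀ f ∈ t, ‖L y f - L₀ f‖ < ε / 4 :=
    (ht.eventually_all).2 fun f _ => by
      have := (h f).eventually (Metric.ball_mem_nhds _ (show 0 < ε / 4 by positivity))
      simpa only [dist_eq_norm] using this
  filter_upwards [hev] with y hy
  rw [dist_eq_norm]
  refine lt_of_le_of_lt (ContinuousLinearMap.opNorm_le_of_unit_norm (C := ε / 2)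
    (by positivity) fun g hg => ?_) (half_lt_self hε)
  obtain ⟨f, hf, hgf⟩ := mem_iUnion₂.1
    (hcov (subset_closure ⟨g, by simp [hg], rfl⟩ : K g ∈ closure (K '' Metric.closedBall 0 1)))
  rw [mem_ball_iff_norm] at hgf
  have h1 : (L y ∘L K - L₀ ∘L K) g = (L y - L₀) (K g - f) + (L y f - L₀ f) := by
    simp only [sub_apply, ContinuousLinearMap.comp_apply, map_sub]
    abel
  have h2 : ‖L y - L₀‖ ≤ C' := (norm_sub_le _ _).trans (by
    have := le_abs_self C
    have := hL y
    simp only [C']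
    linarith)
  rw [h1]
  calc ‖(L y - L₀) (K g - f) + (L y f - L₀ f)‖
      ≤ ‖L y - L₀‖ * ‖K g - f‖ + ‖L y f - L₀ f‖ :=
        (norm_add_le _ _).trans (by gcongr; exact ContinuousLinearMap.le_opNorm _ _)
    _ ≤ C' * (ε / 4 / C') + ε / 4 := by
        gcongr
        exact (hy f hf).le
    _ = ε / 2 := by
        field_simp
        ring

/-- A bounded family of operators that converges pointwise has a bounded strong limit. -/
theorem exists_strong_limit [l.NeBot] {L : α → F →L[ℂ] G} {C : ℝ} (hL : ∀ y, ‖L y‖ ≤ C)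
    (h : ∀ f, ∃ a, Tendsto (fun y => L y f) l (𝓝 a)) :
    ∃ L₀ : F →L[ℂ] G, ∀ f, Tendsto (fun y => L y f) l (𝓝 (L₀ f)) := by
  choose a ha using h
  refine ⟨LinearMap.mkContinuous (linearMapOfTendsto (l := l) a (fun y => (L y).toLinearMap)
    (tendsto_pi_nhds.2 ha)) C fun f => ?_, ha⟩
  exact le_of_tendsto (ha f).norm (Eventually.of_forall fun y => (L y).le_of_opNorm_le (hL y) f)

end Convergence

/-! ### The Stone–Čech boundary -/

section Boundary

variable {X : Type*}

/-- The filter of those `y ∈ X` that tend to the point `x` of the Stone–Čech compactification. -/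
abbrev approach [TopologicalSpace X] (x : StoneCech X) : Filter X := comap stoneCechUnit (𝓝 x)

instance [TopologicalSpace X] (x : StoneCech X) : (approach x).NeBot := by
  refine comap_neBot_iff.2 fun t ht => ?_
  obtain ⟨_, hy, a, rfl⟩ := mem_closure_iff_nhds.1 (denseRange_stoneCechUnit x) t ht
  exact ⟨a, hy⟩

theorem approach_le_cocompact [TopologicalSpace X] {x : StoneCech X} (hx : x ∈ boundary X) :
    approach x ≤ cocompact X := by
  intro s hs
  obtain ⟨K, hK, hKs⟩ := mem_cocompact.1 hs
  have hcl : IsClosed (stoneCechUnit '' K) := (hK.image continuous_stoneCechUnit).isClosed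
  have hxK : x ∉ stoneCechUnit '' K := fun ⟨y, _, hy⟩ => hx ⟨y, hy⟩
  refine ⟨_, hcl.isOpen_compl.mem_nhds hxK, fun y hy => hKs fun hyK => hy ⟨y, hyK, rfl⟩⟩

/-- Bounded continuous functions extend to the Stone–Čech compactification. -/
theorem exists_tendsto_approach [TopologicalSpace X] (x : StoneCech X) {v : X → ℂ}
    (hv : Continuous v) {C : ℝ} (hC : ∀ y, ‖v y‖ ≤ C) : ∃ a, Tendsto v (approach x) (𝓝 a) := by
  have : CompactSpace (Metric.closedBall (0 : ℂ) C) :=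
    isCompact_iff_compactSpace.1 (isCompact_closedBall 0 C)
  set v' : X → Metric.closedBall (0 : ℂ) C := fun y => ⟨v y, by simpa using hC y⟩
  have hv' : Continuous v' := hv.subtype_mk _
  refine ⟨((stoneCechExtend hv' x : Metric.closedBall (0 : ℂ) C) : ℂ), ?_⟩
  have h1 := (continuous_subtype_val.comp (continuous_stoneCechExtend hv')).tendsto x
  refine (h1.comp tendsto_comap).congr fun y => ?_
  simp only [Function.comp, stoneCechExtend_stoneCechUnit]
  rfl

/-- A sequence that leaves every ball accumulates at the Stone–Čech boundary. -/
theorem exists_mem_boundary [PseudoMetricSpace X] {y : ℕ → X} (x₀ : X)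
    (hy : Tendsto (fun n => dist (y n) x₀) atTop atTop) :
    ∃ x ∈ boundary X, ∀ s ∈ approach x, ∃ᶠ n in atTop, y n ∈ s := by
  obtain ⟨x, hx⟩ := exists_clusterPt_of_compactSpace (map (fun n => stoneCechUnit (y n)) atTop)
  have hx' : MapClusterPt x atTop (fun n => stoneCechUnit (y n)) := hx
  refine ⟨x, ?_, fun s hs => ?_⟩
  · rintro ⟨z, rfl⟩
    have hc : Continuous fun w => ((min (dist w z) 1 : ℝ) : ℂ) :=
      Complex.continuous_ofReal.comp ((continuous_id.dist continuous_const).min continuous_const)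
    -- the continuous function `min (dist · z) 1` separates `z` from all far away points
    have hb : ∀ w, ‖((min (dist w z) 1 : ℝ) : ℂ)‖ ≤ 1 := fun w => by
      rw [Complex.norm_real, Real.norm_of_nonneg (le_min dist_nonneg zero_le_one)]
      exact min_le_right _ _
    have : CompactSpace (Metric.closedBall (0 : ℂ) 1) :=
      isCompact_iff_compactSpace.1 (isCompact_closedBall 0 1)
    set v : X → Metric.closedBall (0 : ℂ) 1 :=
      fun w => ⟨((min (dist w z) 1 : ℝ) : ℂ), by simpa using hb w⟩
    have hv : Continuous v := hc.subtype_mk _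
    have hopen : IsOpen {w | ‖((stoneCechExtend hv w : Metric.closedBall (0 : ℂ) 1) : ℂ)‖ < 1} :=
      isOpen_lt (continuous_norm.comp
        (continuous_subtype_val.comp (continuous_stoneCechExtend hv))) continuous_const
    have hz : stoneCechUnit z ∈
        {w | ‖((stoneCechExtend hv w : Metric.closedBall (0 : ℂ) 1) : ℂ)‖ < 1} := by
      rw [mem_ofPred_eq, stoneCechExtend_stoneCechUnit]
      simp [v]
    obtain ⟨n, hn, hn'⟩ := ((hx'.frequently (hopen.mem_nhds hz)).and_eventually
      (hy.eventually (eventually_ge_atTop (1 + dist z x₀)))).exists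
    rw [stoneCechExtend_stoneCechUnit] at hn
    have h1 : 1 ≤ dist (y n) z := by
      have := dist_triangle (y n) z x₀
      linarith
    have h2 : ((v (y n) : Metric.closedBall (0 : ℂ) 1) : ℂ) = 1 := by
      simp [v, min_eq_right h1]
    rw [h2, norm_one] at hn
    exact lt_irrefl _ hn
  · obtain ⟨t, ht, hts⟩ := hs
    exact (hx'.frequently ht).mono fun n hn => hts hn

end Boundary

namespace ShiftSystem

/-! ### Exhaustion by balls -/

variable {X : Type*} [MetricSpace X] [ProperSpace X] [MeasurableSpace X] [BorelSpace X]
  {μ : Measure X} [μ.Regular] {p : ℝ≥0∞} [Fact (1 ≤ p)] (S : ShiftSystem μ p)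

theorem measurableSet_shell (n : ℕ) :
    MeasurableSet ((fun z : X => ⌈dist z S.x₀⌉₊) ⁻¹' {n}) :=
  (Nat.measurable_ceil.comp (measurable_id.dist measurable_const)) (measurableSet_singleton n)

/-- Multiplication by the indicator function of the shell `{z | n - 1 < dist z x₀ ≤ n}`. -/
def shell (n : ℕ) : Lp ℂ p μ →L[ℂ] Lp ℂ p μ := mulInd μ p (S.measurableSet_shell n)

theorem isLpDecomp_shell : IsLpDecomp p.toReal S.shell :=
  isLpDecomp_cells S.lt_top.ne S.measurableSet_shell

theorem sum_shell (n : ℕ) (f : Lp ℂ p μ) : ∑ i ∈ Finset.range (n + 1), S.shell i f = S.cut n f := by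
  have hp : 0 < p.toReal := zero_lt_one.trans S.one_lt_toReal
  have h1 := (S.isLpDecomp_shell.hasSum hp f).mapL (S.cut n)
  have h2 : HasSum (fun i => S.cut n (S.shell i f))
      (∑ i ∈ Finset.range (n + 1), S.cut n (S.shell i f)) :=
    hasSum_sum_of_ne_finset_zero fun i hi => by
      refine mulInd_of_disjoint _ _ (Set.disjoint_left.2 fun z hz hz' => hi ?_) f
      rw [mem_preimage, mem_singleton_iff] at hz'
      rw [Finset.mem_range, Nat.lt_succ_iff, ← hz']
      exact Nat.ceil_le.2 hz
  rw [← h2.unique h1]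
  refine Finset.sum_congr rfl fun i hi => (mulInd_of_superset _ _ (fun z hz => ?_) f).symm
  rw [mem_preimage, mem_singleton_iff] at hz
  rw [Finset.mem_range, Nat.lt_succ_iff, ← hz] at hi
  exact Nat.ceil_le.1 hi

theorem tendsto_cut (f : Lp ℂ p μ) : Tendsto (fun n => S.cut n f) atTop (𝓝 f) := by
  have hp : 0 < p.toReal := zero_lt_one.trans S.one_lt_toReal
  have h := (tendsto_add_atTop_iff_nat 1).2 (S.isLpDecomp_shell.hasSum hp f).tendsto_sum_nat
  simpa only [sum_shell] using h

theorem tendsto_comp_cut (ψ : StrongDual ℂ (Lp ℂ p μ)) :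
    Tendsto (fun n => ψ ∘L S.cut n) atTop (𝓝 ψ) := by
  have hpq := Real.HolderConjugate.conjExponent S.one_lt_toReal
  have h := (tendsto_add_atTop_iff_nat 1).2
    ((S.isLpDecomp_shell.dual hpq).hasSum hpq.symm.pos ψ).tendsto_sum_nat
  refine h.congr fun n => ?_
  ext f
  simp [adj_apply, ← S.sum_shell n f]

theorem exists_norm_sub_cut_le (f : Lp ℂ p μ) {ε : ℝ} (hε : 0 < ε) :
    ∃ n, ‖f - S.cut n f‖ ≤ ε := by
  obtain ⟨n, hn⟩ := ((S.tendsto_cut f).eventually (Metric.ball_mem_nhds _ hε)).exists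
  rw [dist_comm, dist_eq_norm] at hn
  exact ⟨n, hn.le⟩

/-- Functionals on `L_p` are concentrated on balls; this is where `1 < p` enters. -/
theorem exists_norm_sub_comp_cut_le (ψ : StrongDual ℂ (Lp ℂ p μ)) {ε : ℝ} (hε : 0 < ε) :
    ∃ n, ‖ψ - ψ ∘L S.cut n‖ ≤ ε := by
  obtain ⟨n, hn⟩ := ((S.tendsto_comp_cut ψ).eventually (Metric.ball_mem_nhds _ hε)).exists
  rw [dist_comm, dist_eq_norm] at hn
  exact ⟨n, hn.le⟩

/-! ### Shifts tend weakly to zero at the boundary -/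

variable {x : StoneCech X}

theorem eventually_lt_dist (hx : x ∈ boundary X) (r : ℝ) :
    ∀ᶠ y in approach x, r < dist y S.x₀ :=
  ((tendsto_dist_right_cocompact_atTop S.x₀).mono_left
    (approach_le_cocompact hx)).eventually (eventually_gt_atTop r)

/-- Isometries that move every ball off every other ball tend weakly to zero, because functions and
functionals can be approximated by ones that live on balls. -/
theorem tendsto_dual_zero {l : Filter X} (V : X → Lp ℂ p μ ≃ₗᵢ[ℂ] Lp ℂ p μ)
    (hV : ∀ (m n : ℕ) f, ∀ᶠ y in l, S.cut m (V y (S.cut n f)) = 0)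
    (ψ : StrongDual ℂ (Lp ℂ p μ)) (f : Lp ℂ p μ) : Tendsto (fun y => ψ (V y f)) l (𝓝 0) := by
  rw [Metric.tendsto_nhds]
  intro ε hε
  obtain ⟨n, hn⟩ := S.exists_norm_sub_cut_le f (ε := ε / 4 / (‖ψ‖ + 1)) (by positivity)
  obtain ⟨m, hm⟩ := S.exists_norm_sub_comp_cut_le ψ (ε := ε / 4 / (‖f‖ + 1)) (by positivity)
  filter_upwards [hV m n f] with y hy
  have h1 : ψ (V y f) = ψ (V y (f - S.cut n f)) + (ψ - ψ ∘L S.cut m) (V y (S.cut n f)) := by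
    simp [hy]
  rw [dist_zero_right, h1]
  calc _ ≤ ‖ψ‖ * ‖f - S.cut n f‖ + ‖ψ - ψ ∘L S.cut m‖ * ‖f‖ := by
        refine (norm_add_le _ _).trans (add_le_add ?_ ?_)
        · simpa only [LinearIsometryEquiv.norm_map] using ψ.le_opNorm (V y (f - S.cut n f))
        · refine (ContinuousLinearMap.le_opNorm _ _).trans ?_
          rw [LinearIsometryEquiv.norm_map]
          gcongr
          exact S.norm_cut_le n f
    _ ≤ (‖ψ‖ + 1) * (ε / 4 / (‖ψ‖ + 1)) + (ε / 4 / (‖f‖ + 1)) * (‖f‖ + 1) := by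
        gcongr <;> linarith
    _ = ε / 2 := by
        field_simp
        ring
    _ < ε := half_lt_self hε

theorem tendsto_dual_U (hx : x ∈ boundary X) (ψ : StrongDual ℂ (Lp ℂ p μ)) (f : Lp ℂ p μ) :
    Tendsto (fun y => ψ (S.U y f)) (approach x) (𝓝 0) := by
  refine S.tendsto_dual_zero S.U (fun m n f => ?_) ψ f
  filter_upwards [S.eventually_lt_dist hx (m + n)] with y hy
  rw [cut, cut, ballInd, ballInd, U_mulInd]
  refine mulInd_of_disjoint _ _ (Set.disjoint_left.2 fun z hz hz' => ?_) _
  rw [mem_preimage, Metric.mem_closedBall] at hz'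
  rw [Metric.mem_closedBall] at hz
  have h1 := (S.φ y).dist_eq z S.x₀
  rw [S.φ_base] at h1
  have h2 := dist_triangle_left y S.x₀ (S.φ y z)
  linarith

theorem tendsto_dual_U_symm (hx : x ∈ boundary X) (ψ : StrongDual ℂ (Lp ℂ p μ)) (f : Lp ℂ p μ) :
    Tendsto (fun y => ψ ((S.U y).symm f)) (approach x) (𝓝 0) := by
  refine S.tendsto_dual_zero (fun y => (S.U y).symm) (fun m n f => ?_) ψ f
  filter_upwards [S.eventually_lt_dist hx (m + n)] with y hy
  rw [cut, cut, U_symm_ballInd]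
  refine mulInd_of_disjoint _ _ (Set.disjoint_left.2 fun z hz hz' => ?_) _
  rw [Metric.mem_closedBall] at hz hz'
  have h2 := dist_triangle_left y S.x₀ z
  linarith

/-! ### Limit operators -/

/-- `C` is the limit of the shifts of `B` at `x`, in the strong operator topology, strongly for the
transposed operators, and in norm after cutting down to a ball on either side. -/
structure IsLimitOperator (B : Lp ℂ p μ →L[ℂ] Lp ℂ p μ) (x : StoneCech X)
    (C : Lp ℂ p μ →L[ℂ] Lp ℂ p μ) : Prop where
  tendsto : ∀ f, Tendsto (fun y => S.conj y B f) (approach x) (𝓝 (C f))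
  dual : ∀ ψ : StrongDual ℂ (Lp ℂ p μ),
    Tendsto (fun y => ψ ∘L S.conj y B) (approach x) (𝓝 (ψ ∘L C))
  right : ∀ n, Tendsto (fun y => S.conj y B ∘L S.cut n) (approach x) (𝓝 (C ∘L S.cut n))
  left : ∀ n, Tendsto (fun y => S.cut n ∘L S.conj y B) (approach x) (𝓝 (S.cut n ∘L C))

namespace IsLimitOperator

variable {S} {B B' D C C' : Lp ℂ p μ →L[ℂ] Lp ℂ p μ}

theorem add (h : S.IsLimitOperator B x C) (h' : S.IsLimitOperator B' x C') :
    S.IsLimitOperator (B + B') x (C + C') := by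
  refine ⟨fun f => ?_, fun ψ => ?_, fun n => ?_, fun n => ?_⟩
  · simpa only [conj_add, add_apply] using (h.tendsto f).add (h'.tendsto f)
  · simpa only [conj_add, ContinuousLinearMap.comp_add] using (h.dual ψ).add (h'.dual ψ)
  · simpa only [conj_add, ContinuousLinearMap.add_comp] using (h.right n).add (h'.right n)
  · simpa only [conj_add, ContinuousLinearMap.comp_add] using (h.left n).add (h'.left n)

theorem sub (h : S.IsLimitOperator B x C) (h' : S.IsLimitOperator B' x C') :
    S.IsLimitOperator (B - B') x (C - C') := by
  refine ⟨fun f => ?_, fun ψ => ?_, fun n => ?_, fun n => ?_⟩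
  · simpa only [conj_sub, sub_apply] using (h.tendsto f).sub (h'.tendsto f)
  · simpa only [conj_sub, ContinuousLinearMap.comp_sub] using (h.dual ψ).sub (h'.dual ψ)
  · simpa only [conj_sub, ContinuousLinearMap.sub_comp] using (h.right n).sub (h'.right n)
  · simpa only [conj_sub, ContinuousLinearMap.comp_sub] using (h.left n).sub (h'.left n)

theorem one : S.IsLimitOperator (1 : Lp ℂ p μ →L[ℂ] Lp ℂ p μ) x 1 := by
  refine ⟨fun f => ?_, fun ψ => ?_, fun n => ?_, fun n => ?_⟩ <;>
  · simp only [conj_one]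
    exact tendsto_const_nhds

theorem tendsto_comp (h : S.IsLimitOperator B x C) (h' : S.IsLimitOperator B' x C')
    (f : Lp ℂ p μ) :
    Tendsto (fun y => S.conj y (B ∘L B') f) (approach x) (𝓝 (C (C' f))) := by
  simp only [← conj_comp]
  have h1 : Tendsto (fun y => ‖B‖ * ‖S.conj y B' f - C' f‖) (approach x) (𝓝 0) := by
    simpa using (tendsto_iff_norm_sub_tendsto_zero.1 (h'.tendsto f)).const_mul ‖B‖
  have h2 : Tendsto (fun y => S.conj y B (S.conj y B' f) - S.conj y B (C' f)) (approach x)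
      (𝓝 0) := by
    refine squeeze_zero_norm (fun y => ?_) h1
    rw [← map_sub]
    exact S.norm_conj_apply_le y B _
  simpa using h2.add (h.tendsto (C' f))

theorem comp_eq (h : S.IsLimitOperator B x C) (h' : S.IsLimitOperator B' x C')
    (hD : S.IsLimitOperator (B ∘L B') x D) (f : Lp ℂ p μ) : C (C' f) = D f :=
  tendsto_nhds_unique (h.tendsto_comp h' f) (hD.tendsto f)

theorem isWeakLimit (h : S.IsLimitOperator B x C) : S.IsWeakLimit B x C := by
  refine ContinuousLinearMapWOT.tendsto_iff_forall_dual_apply_tendsto.2 fun f ψ => ?_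
  exact (ψ.continuous.tendsto _).comp (h.tendsto f)

theorem weakLim_eq (h : S.IsLimitOperator B x C) : S.weakLim B x = C := by
  have h1 : Tendsto _ _ _ := h.isWeakLimit
  rw [weakLim, h1.limUnder_eq]

end IsLimitOperator

/-- A band-dominated projection `P` that is locally compact and whose compressed shifts
`M_n P_y M_m` converge in norm as `y` tends to `x`. -/
structure IsAdmissible (P : Lp ℂ p μ →L[ℂ] Lp ℂ p μ) (x : StoneCech X) : Prop where
  idem : ∀ f, P (P f) = P f
  band : IsBandDominated P
  compact_left : ∀ y r, IsCompactOperator (ballInd μ p y r ∘L P)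
  compact_right : ∀ y r, IsCompactOperator (P ∘L ballInd μ p y r)
  tendsto : ∀ n m, ∃ a, Tendsto (fun y => S.cut n ∘L S.conj y P ∘L S.cut m) (approach x) (𝓝 a)

namespace IsAdmissible

variable {S} {P B : Lp ℂ p μ →L[ℂ] Lp ℂ p μ}

theorem isCompactOperator_cut_conj (h : S.IsAdmissible P x) (n : ℕ) (y : X) :
    IsCompactOperator (S.cut n ∘L S.conj y P) := by
  have h1 := isCompactOperator_comp_left (isCompactOperator_comp_right (h.compact_left y n)
    (((S.U y).symm : Lp ℂ p μ ≃L[ℂ] Lp ℂ p μ) : Lp ℂ p μ →L[ℂ] Lp ℂ p μ))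
    ((S.U y : Lp ℂ p μ ≃L[ℂ] Lp ℂ p μ) : Lp ℂ p μ →L[ℂ] Lp ℂ p μ)
  refine (congrArg IsCompactOperator (funext fun f => ?_)).mpr h1
  simp [conj_apply, cut, U_ballInd]

theorem isCompactOperator_conj_cut (h : S.IsAdmissible P x) (n : ℕ) (y : X) :
    IsCompactOperator (S.conj y P ∘L S.cut n) := by
  have h1 := isCompactOperator_comp_left (isCompactOperator_comp_right (h.compact_right y n)
    (((S.U y).symm : Lp ℂ p μ ≃L[ℂ] Lp ℂ p μ) : Lp ℂ p μ →L[ℂ] Lp ℂ p μ))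
    ((S.U y : Lp ℂ p μ ≃L[ℂ] Lp ℂ p μ) : Lp ℂ p μ →L[ℂ] Lp ℂ p μ)
  refine (congrArg IsCompactOperator (funext fun f => ?_)).mpr h1
  simp [conj_apply, cut, U_symm_ballInd]

theorem exists_limit_conj_cut (h : S.IsAdmissible P x) (n : ℕ) :
    ∃ L : Lp ℂ p μ →L[ℂ] Lp ℂ p μ, IsCompactOperator L ∧
      Tendsto (fun y => S.conj y P ∘L S.cut n) (approach x) (𝓝 L) := by
  obtain ⟨L, hL⟩ := exists_tendsto_of_forall_le (l := approach x)
    (u := fun y => S.conj y P ∘L S.cut n) fun ε hε => by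
      obtain ⟨m, hm⟩ := S.exists_cut_conj h.band n hε
      refine ⟨_, h.tendsto m n, fun y => ContinuousLinearMap.opNorm_le_bound _ hε.le fun f => ?_⟩
      exact (hm y f).1
  exact ⟨L, isCompactOperator_of_tendsto hL
    (Eventually.of_forall fun y => h.isCompactOperator_conj_cut n y), hL⟩

theorem exists_limit_cut_conj (h : S.IsAdmissible P x) (n : ℕ) :
    ∃ L : Lp ℂ p μ →L[ℂ] Lp ℂ p μ, IsCompactOperator L ∧
      Tendsto (fun y => S.cut n ∘L S.conj y P) (approach x) (𝓝 L) := by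
  obtain ⟨L, hL⟩ := exists_tendsto_of_forall_le (l := approach x)
    (u := fun y => S.cut n ∘L S.conj y P) fun ε hε => by
      obtain ⟨m, hm⟩ := S.exists_cut_conj h.band n hε
      refine ⟨_, h.tendsto n m, fun y => ContinuousLinearMap.opNorm_le_bound _ hε.le fun f => ?_⟩
      exact (hm y f).2
  exact ⟨L, isCompactOperator_of_tendsto hL
    (Eventually.of_forall fun y => h.isCompactOperator_cut_conj n y), hL⟩

/-- `M_n B_y f = M_n P_y B_y f`, where `M_n P_y` is close to a compact operator `R` and `R B_y f`
converges because it does so weakly. -/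
theorem exists_tendsto_cut_conj_apply (h : S.IsAdmissible P x) (hPB : ∀ f, P (B f) = B f) (n : ℕ)
    (f : Lp ℂ p μ) : ∃ a, Tendsto (fun y => S.cut n (S.conj y B f)) (approach x) (𝓝 a) := by
  obtain ⟨R, hR, hRt⟩ := h.exists_limit_cut_conj n
  obtain ⟨a, ha⟩ := exists_tendsto_of_isCompactOperator (l := approach x) hR
    (fun y => S.norm_conj_apply_le y B f) fun φ =>
      exists_tendsto_approach x ((φ ∘L R).continuous.comp (S.continuous_conj_apply B f))
        (C := ‖φ ∘L R‖ * (‖B‖ * ‖f‖)) fun y =>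
          (φ ∘L R).le_opNorm_of_le (S.norm_conj_apply_le y B f)
  refine ⟨a, ?_⟩
  have h1 : Tendsto (fun y => ‖S.cut n ∘L S.conj y P - R‖ * (‖B‖ * ‖f‖)) (approach x) (𝓝 0) := by
    simpa using (tendsto_iff_norm_sub_tendsto_zero.1 hRt).mul_const (‖B‖ * ‖f‖)
  have h2 : Tendsto (fun y => S.cut n (S.conj y B f) - R (S.conj y B f)) (approach x) (𝓝 0) := by
    refine squeeze_zero_norm (fun y => ?_) h1
    have h3 : S.cut n (S.conj y B f) - R (S.conj y B f)
        = (S.cut n ∘L S.conj y P - R) (S.conj y B f) := by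
      simp [conj_apply, hPB]
    rw [h3]
    exact ContinuousLinearMap.le_opNorm_of_le _ (S.norm_conj_apply_le y B f)
  simpa using h2.add ha

theorem exists_tendsto_conj_apply (h : S.IsAdmissible P x) (hB : IsBandDominated B)
    (hPB : ∀ f, P (B f) = B f) (f : Lp ℂ p μ) :
    ∃ a, Tendsto (fun y => S.conj y B f) (approach x) (𝓝 a) := by
  refine exists_tendsto_of_forall_le fun ε hε => ?_
  obtain ⟨n, hn⟩ := S.exists_norm_sub_cut_le f (ε := ε / (‖B‖ + 1)) (by positivity)
  refine ⟨fun y => S.conj y B (S.cut n f), ?_, fun y => ?_⟩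
  · refine exists_tendsto_of_forall_le fun ε' hε' => ?_
    obtain ⟨m, hm⟩ := S.exists_cut_conj hB n (δ := ε' / (‖f‖ + 1)) (by positivity)
    refine ⟨_, h.exists_tendsto_cut_conj_apply hPB m (S.cut n f), fun y => (hm y f).1.trans ?_⟩
    calc ε' / (‖f‖ + 1) * ‖f‖ ≤ ε' / (‖f‖ + 1) * (‖f‖ + 1) := by gcongr; linarith
      _ = ε' := by field_simp
  · rw [← map_sub]
    refine (S.norm_conj_apply_le y B _).trans ?_
    calc ‖B‖ * ‖f - S.cut n f‖ ≤ (‖B‖ + 1) * (ε / (‖B‖ + 1)) := by gcongr; linarith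
      _ = ε := by field_simp

/-- A band-dominated operator that lives on the range of an admissible projection has a limit
operator at `x`.  Strong convergence of `B_y` is uniform on compact sets, and `B_y M_n = B_y P_y M_n`
where `P_y M_n` is close to a compact operator, whence the norm convergence of `B_y M_n`. -/
theorem exists_isLimitOperator (h : S.IsAdmissible P x) (hB : IsBandDominated B)
    (hPB : ∀ f, P (B f) = B f) (hBP : ∀ f, B (P f) = B f) : ∃ C, S.IsLimitOperator B x C := by
  obtain ⟨C, hC⟩ := exists_strong_limit (l := approach x) (S.norm_conj_le · B)
    (h.exists_tendsto_conj_apply hB hPB)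
  have right : ∀ n, Tendsto (fun y => S.conj y B ∘L S.cut n) (approach x) (𝓝 (C ∘L S.cut n)) := by
    intro n
    obtain ⟨L, hL, hLt⟩ := h.exists_limit_conj_cut n
    have h1 := tendsto_comp_of_isCompactOperator (S.norm_conj_le · B) hC hL
    have h2 : Tendsto (fun y => ‖B‖ * ‖S.conj y P ∘L S.cut n - L‖) (approach x) (𝓝 0) := by
      simpa using (tendsto_iff_norm_sub_tendsto_zero.1 hLt).const_mul ‖B‖
    have h3 : Tendsto (fun y => S.conj y B ∘L S.cut n - S.conj y B ∘L L) (approach x) (𝓝 0) := by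
      refine squeeze_zero_norm (fun y => ?_) h2
      have h4 : S.conj y B ∘L S.cut n - S.conj y B ∘L L
          = S.conj y B ∘L (S.conj y P ∘L S.cut n - L) := by
        ext1 f
        simp [conj_apply, hBP]
      rw [h4]
      refine (ContinuousLinearMap.opNorm_comp_le _ _).trans ?_
      gcongr
      exact S.norm_conj_le y B
    have h5 : Tendsto (fun y => S.conj y B ∘L S.cut n) (approach x) (𝓝 (C ∘L L)) := by
      simpa using h3.add h1
    have h6 : C ∘L L = C ∘L S.cut n := by
      ext1 f
      exact tendsto_nhds_unique
        (((ContinuousLinearMap.apply ℂ _ f).continuous.tendsto _).comp h5) (hC (S.cut n f))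
    rwa [h6] at h5
  have left : ∀ n, Tendsto (fun y => S.cut n ∘L S.conj y B) (approach x) (𝓝 (S.cut n ∘L C)) := by
    intro n
    obtain ⟨D, hD⟩ := exists_tendsto_of_forall_le (l := approach x)
      (u := fun y => S.cut n ∘L S.conj y B) fun ε hε => by
        obtain ⟨m, hm⟩ := S.exists_cut_conj hB n hε
        refine ⟨fun y => S.cut n ∘L S.conj y B ∘L S.cut m, ⟨S.cut n ∘L C ∘L S.cut m, ?_⟩,
          fun y => ContinuousLinearMap.opNorm_le_bound _ hε.le fun f => (hm y f).2⟩
        exact ((ContinuousLinearMap.postcomp (Lp ℂ p μ) (S.cut n)).continuous.tendsto _).comp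
          (right m)
    have h6 : D = S.cut n ∘L C := by
      ext1 f
      exact tendsto_nhds_unique
        (((ContinuousLinearMap.apply ℂ _ f).continuous.tendsto _).comp hD)
        (((S.cut n).continuous.tendsto _).comp (hC f))
    rwa [h6] at hD
  refine ⟨C, hC, fun ψ => ?_, right, left⟩
  obtain ⟨D, hD⟩ := exists_tendsto_of_forall_le (l := approach x)
    (u := fun y => ψ ∘L S.conj y B) fun ε hε => by
      obtain ⟨n, hn⟩ := S.exists_norm_sub_comp_cut_le ψ (ε := ε / (‖B‖ + 1)) (by positivity)
      refine ⟨fun y => ψ ∘L S.cut n ∘L S.conj y B, ⟨ψ ∘L S.cut n ∘L C, ?_⟩, fun y => ?_⟩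
      · exact ((ContinuousLinearMap.postcomp (Lp ℂ p μ) ψ).continuous.tendsto _).comp (left n)
      · have h1 : ψ ∘L S.conj y B - ψ ∘L S.cut n ∘L S.conj y B
            = (ψ - ψ ∘L S.cut n) ∘L S.conj y B := rfl
        rw [h1]
        refine (ContinuousLinearMap.opNorm_comp_le _ _).trans ?_
        calc _ ≤ ε / (‖B‖ + 1) * (‖B‖ + 1) := by
              gcongr
              exact (S.norm_conj_le y B).trans (by linarith)
          _ = ε := by field_simp
  have h6 : D = ψ ∘L C := by
    ext1 f
    exact tendsto_nhds_unique
      (((ContinuousLinearMap.apply ℂ _ f).continuous.tendsto _).comp hD)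
      ((ψ.continuous.tendsto _).comp (hC f))
  rwa [h6] at hD

end IsAdmissible

end ShiftSystem

/-! ### Compression to the range of a projection -/

section Compression

variable {E : Type*} [NormedAddCommGroup E] [NormedSpace ℂ E]

/-- A bounded operator that is bounded below and whose transpose is injective is invertible. -/
theorem isUnit_of_forall_le [CompleteSpace E] {r : E →L[ℂ] E} {C : ℝ} (h : ∀ f, ‖f‖ ≤ C * ‖r f‖)
    (h' : ∀ ψ : StrongDual ℂ E, ψ ∘L r = 0 → ψ = 0) :
    IsUnit r ∧ ‖Ring.inverse r‖ ≤ max C 0 := by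
  have hanti : AntilipschitzWith (max C 0).toNNReal r :=
    AddMonoidHomClass.antilipschitz_of_bound r fun f => by
      rw [Real.coe_toNNReal _ (le_max_right _ _)]
      exact (h f).trans (by gcongr; exact le_max_left _ _)
  have hclosed : IsClosed (r.range : Set E) := hanti.isClosed_range r.uniformContinuous
  have hsurj : Function.Surjective r := by
    refine LinearMap.range_eq_top.1 ((Submodule.eq_top_iff' (p := r.range)).2 fun v => ?_)
    have hq : IsClosed (r.range : Set E) := hclosed
    refine (Submodule.Quotient.mk_eq_zero r.range).1 ?_
    refine (SeparatingDual.eq_zero_iff_forall_dual_eq_zero (R := ℂ) _).2 fun φ => ?_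
    have h1 : φ ∘L r.range.mkQL = 0 := h' _ <| by
      ext f
      have : r.range.mkQL (r f) = 0 := (Submodule.Quotient.mk_eq_zero _).2 ⟨f, rfl⟩
      simp [this]
    exact congrArg (fun ψ : StrongDual ℂ E => ψ v) h1
  have hu : IsUnit r := ContinuousLinearMap.isUnit_iff_bijective.2 ⟨hanti.injective, hsurj⟩
  refine ⟨hu, ContinuousLinearMap.opNorm_le_bound _ (le_max_right _ _) fun g => ?_⟩
  have h1 : r (Ring.inverse r g) = g :=
    congrArg (fun T : E →L[ℂ] E => T g) (Ring.mul_inverse_cancel r hu)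
  calc ‖Ring.inverse r g‖ ≤ C * ‖r (Ring.inverse r g)‖ := h _
    _ ≤ max C 0 * ‖g‖ := by
      rw [h1]
      gcongr
      exact le_max_left _ _

/-- The compression of `B` to the range of `Q`. -/
def compress (Q B : E →L[ℂ] E) : Q.range →L[ℂ] Q.range :=
  Q.rangeRestrict ∘L B ∘L Q.range.subtypeL

variable {Q B : E →L[ℂ] E}

theorem apply_of_mem_range (hQ : ∀ f, Q (Q f) = Q f) (f : Q.range) : Q f = f := by
  obtain ⟨_, g, rfl⟩ := f
  exact hQ g

theorem coe_compress (hQB : ∀ f, Q (B f) = B f) (f : Q.range) : (compress Q B f : E) = B f := hQB f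

theorem isClosed_range_of_idem (hQ : ∀ f, Q (Q f) = Q f) : IsClosed (Q.range : Set E) := by
  have : (Q.range : Set E) = {f | Q f = f} := by
    ext f
    exact ⟨fun hf => apply_of_mem_range hQ ⟨f, hf⟩, fun hf => ⟨f, hf⟩⟩
  rw [this]
  exact isClosed_eq Q.continuous continuous_id

theorem isUnit_compress_of_forall_le [CompleteSpace E] (hQ : ∀ f, Q (Q f) = Q f)
    (hQB : ∀ f, Q (B f) = B f) (hBQ : ∀ f, B (Q f) = B f) {C : ℝ} (hC : 0 ≤ C)
    (h : ∀ f, Q f = f → ‖f‖ ≤ C * ‖B f‖)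
    (h' : ∀ ψ : StrongDual ℂ E, ψ ∘L B = 0 → ψ ∘L Q = 0) :
    IsUnit (compress Q B) ∧ ‖Ring.inverse (compress Q B)‖ ≤ C := by
  have : CompleteSpace Q.range := (isClosed_range_of_idem hQ).completeSpace_coe
  have h1 := isUnit_of_forall_le (r := compress Q B) (C := C) (fun f => ?_) fun ψ hψ => ?_
  · rwa [max_eq_left hC] at h1
  · have h2 := h f (apply_of_mem_range hQ f)
    rwa [← coe_compress hQB] at h2
  · have h2 : (ψ ∘L Q.rangeRestrict) ∘L B = 0 := by
      ext f
      have h3 := congrArg (fun φ : StrongDual ℂ Q.range => φ (Q.rangeRestrict f)) hψ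
      have h4 : compress Q B (Q.rangeRestrict f) = Q.rangeRestrict (B f) :=
        congrArg Q.rangeRestrict (hBQ f)
      rw [ContinuousLinearMap.comp_apply, h4] at h3
      exact h3
    have h3 := h' _ h2
    ext f
    have h4 : Q.rangeRestrict (Q f) = f := Subtype.ext ((hQ _).trans (apply_of_mem_range hQ f))
    have h5 := congrArg (fun φ : StrongDual ℂ E => φ f) h3
    exact (congrArg ψ h4).symm.trans h5

/-- With respect to the splitting `ran Q ⊕ ker Q`, the operator `B + 1 - Q` is the direct sum of
the compression of `B` and the identity. -/
theorem isUnit_compress_iff (hQ : ∀ f, Q (Q f) = Q f) (hQB : ∀ f, Q (B f) = B f)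
    (hBQ : ∀ f, B (Q f) = B f) : IsUnit (compress Q B) ↔ IsUnit (B + (1 - Q)) := by
  constructor
  · rintro ⟨u, hu⟩
    set v : Q.range →L[ℂ] Q.range := ↑u⁻¹
    have h1 : ∀ f, compress Q B (v f) = f := fun f => by
      rw [← hu]
      exact congrArg (fun T : Q.range →L[ℂ] Q.range => T f) u.mul_inv
    have h2 : ∀ f, v (compress Q B f) = f := fun f => by
      rw [← hu]
      exact congrArg (fun T : Q.range →L[ℂ] Q.range => T f) u.inv_mul
    have h3 : ∀ f : Q.range, Q f = f := apply_of_mem_range hQ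
    have h4 : ∀ f : Q.range, B f = compress Q B f := fun f => (coe_compress hQB f).symm
    have h5 : ∀ f, Q.rangeRestrict (B f) = compress Q B (Q.rangeRestrict f) := fun f =>
      congrArg Q.rangeRestrict (hBQ f).symm
    set w : E →L[ℂ] E := Q.range.subtypeL ∘L v ∘L Q.rangeRestrict + (1 - Q)
    refine ⟨⟨B + (1 - Q), w, ?_, ?_⟩, rfl⟩
    · ext f
      have h8 : B (f - Q f) = 0 := by rw [map_sub, hBQ, sub_self]
      change B (v (Q.rangeRestrict f) + (f - Q f)) + ((v (Q.rangeRestrict f) + (f - Q f))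
        - Q (v (Q.rangeRestrict f) + (f - Q f))) = f
      rw [map_add, h8, h4, h1, map_add, h3, map_sub, hQ]
      change Q f + 0 + (_ - _) = f
      abel
    · ext f
      have h8 : Q (B f + (f - Q f)) = B f := by rw [map_add, map_sub, hQ, hQB, sub_self, add_zero]
      have h9 : Q.rangeRestrict (B f + (f - Q f)) = Q.rangeRestrict (B f) :=
        Subtype.ext (h8.trans (hQB f).symm)
      change (v (Q.rangeRestrict (B f + (f - Q f))) : E)
        + ((B f + (f - Q f)) - Q (B f + (f - Q f))) = f
      rw [h9, h5, h2, h8]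
      change Q f + _ = f
      abel
  · rintro ⟨u, hu⟩
    set v : E →L[ℂ] E := ↑u⁻¹
    have h1 : ∀ f, B (v f) + (v f - Q (v f)) = f := fun f => by
      have := congrArg (fun T : E →L[ℂ] E => T f) u.mul_inv
      rw [hu] at this
      exact this
    have h2 : ∀ f, v (B f + (f - Q f)) = f := fun f => by
      have := congrArg (fun T : E →L[ℂ] E => T f) u.inv_mul
      rw [hu] at this
      exact this
    refine ⟨⟨compress Q B, compress Q v, ?_, ?_⟩, rfl⟩
    · ext f
      have h3 := congrArg Q (h1 f)
      rw [map_add, map_sub, hQ, sub_self, add_zero, hQB, apply_of_mem_range hQ] at h3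
      have h4 : ((compress Q B) (compress Q v f) : E) = B (Q (v f)) := coe_compress hQB _
      simp [h4, hBQ, h3]
    · ext f
      have h3 := h2 f
      rw [apply_of_mem_range hQ, sub_self, add_zero] at h3
      have h4 : (compress Q v (compress Q B f) : E) = Q (v (Q (B f))) := rfl
      simp [h4, hQB, h3, apply_of_mem_range hQ]

end Compression

/-! ### Invertibility modulo compact operators passes to the limit operators -/

section Extend

variable {E : Type*} [NormedAddCommGroup E] [NormedSpace ℂ E] {M : Submodule ℂ E} {P : E →L[ℂ] E}
  (hP : LinearMap.IsProj M P.toLinearMap) (A : M →L[ℂ] M)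

theorem extend_apply (f : E) : extend hP A f = A (P.codRestrict M hP.map_mem f) := rfl

theorem proj_apply_proj {M : Submodule ℂ E} {P : E →L[ℂ] E}
    (hP : LinearMap.IsProj M P.toLinearMap) (f : E) : P (P f) = P f :=
  hP.map_id _ (hP.map_mem f)

theorem proj_extend (f : E) : P (extend hP A f) = extend hP A f := hP.map_id _ (Subtype.mem _)

theorem codRestrict_proj (f : M) : P.codRestrict M hP.map_mem f = f :=
  Subtype.ext (hP.map_id _ f.2)

theorem extend_proj (f : E) : extend hP A (P f) = extend hP A f := by
  have h : P.codRestrict M hP.map_mem (P f) = P.codRestrict M hP.map_mem f :=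
    Subtype.ext (proj_apply_proj hP f)
  rw [extend_apply, h, ← extend_apply]

end Extend

namespace ShiftSystem

variable {X : Type*} [MetricSpace X] [ProperSpace X] [MeasurableSpace X] [BorelSpace X]
  {μ : Measure X} [μ.Regular] {p : ℝ≥0∞} [Fact (1 ≤ p)] {S : ShiftSystem μ p} {x : StoneCech X}
  {P B : Lp ℂ p μ →L[ℂ] Lp ℂ p μ}

theorem IsAdmissible.isLimitOperator_weakLim (h : S.IsAdmissible P x) (hB : IsBandDominated B)
    (hPB : ∀ f, P (B f) = B f) (hBP : ∀ f, B (P f) = B f) :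
    S.IsLimitOperator B x (S.weakLim B x) := by
  obtain ⟨C, hC⟩ := h.exists_isLimitOperator hB hPB hBP
  rwa [hC.weakLim_eq]

theorem IsAdmissible.isLimitOperator_proj (h : S.IsAdmissible P x) :
    S.IsLimitOperator P x (S.weakLim P x) :=
  h.isLimitOperator_weakLim h.band h.idem h.idem

variable {M : Submodule ℂ (Lp ℂ p μ)} (hP : LinearMap.IsProj M P.toLinearMap) {A : M →L[ℂ] M}

theorem IsAdmissible.isLimitOperator_extend (h : S.IsAdmissible P x)
    (hA : IsBandDominated (extend hP A)) :
    S.IsLimitOperator (extend hP A) x (S.weakLim (extend hP A) x) :=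
  h.isLimitOperator_weakLim hA (proj_extend hP A) (extend_proj hP A)

/-- If `T A = 1 + K` with `K` compact, then `‖P U_y⁻¹ f‖ ≤ ‖T‖ ‖A P U_y⁻¹ f‖ + ‖K P U_y⁻¹ f‖`, and
the last term vanishes as `y` tends to the boundary, since `U_y⁻¹ f` tends weakly to zero. -/
theorem norm_weakLim_le (hx : x ∈ boundary X) {Px Bx : Lp ℂ p μ →L[ℂ] Lp ℂ p μ}
    (hPx : S.IsLimitOperator P x Px) (hBx : S.IsLimitOperator (extend hP A) x Bx) {T : M →L[ℂ] M}
    (hT : IsCompactOperator (T * A - 1 : M →L[ℂ] M)) (f : Lp ℂ p μ) : ‖Px f‖ ≤ ‖T‖ * ‖Bx f‖ := by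
  set c := P.codRestrict M hP.map_mem
  have hK := tendsto_zero_of_isCompactOperator (l := approach x)
    (isCompactOperator_comp_right hT c) (v := fun y => (S.U y).symm f) (C := ‖f‖)
    (fun y => by simp) fun φ => S.tendsto_dual_U_symm hx φ f
  have h1 : ∀ y, ‖S.conj y P f‖ ≤ ‖T‖ * ‖S.conj y (extend hP A) f‖
      + ‖((T * A - 1) ∘L c) ((S.U y).symm f)‖ := by
    intro y
    set v := c ((S.U y).symm f)
    have h2 : ‖S.conj y P f‖ = ‖v‖ := (S.U y).norm_map v
    have h3 : ‖S.conj y (extend hP A) f‖ = ‖A v‖ := (S.U y).norm_map (A v)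
    have h4 : v = T (A v) - (T * A - 1) v := by simp
    rw [h2, h3]
    calc ‖v‖ = ‖T (A v) - (T * A - 1) v‖ := by rw [← h4]
      _ ≤ ‖T (A v)‖ + ‖(T * A - 1) v‖ := norm_sub_le _ _
      _ ≤ _ := by
        gcongr
        · exact T.le_opNorm _
        · exact le_rfl
  refine le_of_tendsto_of_tendsto' (hPx.tendsto f).norm ?_ h1
  simpa using ((hBx.tendsto f).norm.const_mul ‖T‖).add hK.norm

/-- If `A T = 1 + K` with `K` compact, then a functional that annihilates the range of `(AP)_x` also
annihilates the range of `P_x`, because `ψ U_y → 0` uniformly on compact sets. -/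
theorem dual_comp_weakLim_eq_zero (hx : x ∈ boundary X) {Px Bx : Lp ℂ p μ →L[ℂ] Lp ℂ p μ}
    (hPx : S.IsLimitOperator P x Px) (hBx : S.IsLimitOperator (extend hP A) x Bx) {T : M →L[ℂ] M}
    (hT : IsCompactOperator (A * T - 1 : M →L[ℂ] M)) (ψ : StrongDual ℂ (Lp ℂ p μ)) (hψ : ψ ∘L Bx = 0) :
    ψ ∘L Px = 0 := by
  set c := P.codRestrict M hP.map_mem
  set K : Lp ℂ p μ →L[ℂ] Lp ℂ p μ := M.subtypeL ∘L (A * T - 1) ∘L c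
  have hK : IsCompactOperator K := isCompactOperator_comp_left (isCompactOperator_comp_right hT c) _
  set V : X → StrongDual ℂ (Lp ℂ p μ) := fun y =>
    ψ ∘L ((S.U y : Lp ℂ p μ ≃L[ℂ] Lp ℂ p μ) : Lp ℂ p μ →L[ℂ] Lp ℂ p μ)
  have hV : ∀ y, ‖V y‖ ≤ ‖ψ‖ := fun y =>
    ContinuousLinearMap.opNorm_le_bound _ (norm_nonneg _) fun f => by
      exact (ψ.le_opNorm (S.U y f)).trans_eq (by rw [LinearIsometryEquiv.norm_map])
  have hVK := tendsto_comp_of_isCompactOperator (l := approach x) (L₀ := 0) hV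
    (fun f => S.tendsto_dual_U hx ψ f) hK
  have hψB := hBx.dual ψ
  rw [hψ] at hψB
  rw [ContinuousLinearMap.zero_comp] at hVK
  ext f
  refine tendsto_nhds_unique ((ψ.continuous.tendsto _).comp (hPx.tendsto f)) ?_
  have h1 : ∀ y, ‖ψ (S.conj y P f)‖
      ≤ ‖ψ ∘L S.conj y (extend hP A)‖ * (‖T‖ * ‖c‖ * ‖f‖) + ‖V y ∘L K‖ * ‖f‖ := by
    intro y
    set v := c ((S.U y).symm f)
    have h2 : (v : Lp ℂ p μ) = extend hP A (T v) - K ((S.U y).symm f) := by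
      rw [extend_apply, codRestrict_proj hP]
      change (v : Lp ℂ p μ) = A (T v) - (A (T v) - v : M)
      simp
    have h3 : ψ (S.conj y P f) = (ψ ∘L S.conj y (extend hP A)) (S.U y (T v))
        - (V y ∘L K) ((S.U y).symm f) := by
      change ψ (S.U y v) = _
      rw [h2, map_sub, map_sub]
      simp [conj_apply, V]
    rw [h3]
    refine (norm_sub_le _ _).trans (add_le_add ?_ ?_)
    · refine (ContinuousLinearMap.le_opNorm _ _).trans ?_
      gcongr
      rw [LinearIsometryEquiv.norm_map, mul_assoc]
      refine (T.le_opNorm v).trans ?_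
      gcongr
      simpa only [LinearIsometryEquiv.norm_map] using c.le_opNorm ((S.U y).symm f)
    · simpa only [LinearIsometryEquiv.norm_map] using (V y ∘L K).le_opNorm ((S.U y).symm f)
  refine squeeze_zero_norm h1 ?_
  simpa using (hψB.norm.mul_const (‖T‖ * ‖c‖ * ‖f‖)).add (hVK.norm.mul_const ‖f‖)

theorem IsAdmissible.weakLim_idem (h : S.IsAdmissible P x) (f : Lp ℂ p μ) :
    S.weakLim P x (S.weakLim P x f) = S.weakLim P x f := by
  have hPx := h.isLimitOperator_proj
  have hPP : P ∘L P = P := ContinuousLinearMap.ext h.idem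
  exact hPx.comp_eq hPx (by rwa [hPP]) f

theorem IsAdmissible.weakLim_proj_extend (h : S.IsAdmissible P x)
    (hA : IsBandDominated (extend hP A)) (f : Lp ℂ p μ) :
    S.weakLim P x (S.weakLim (extend hP A) x f) = S.weakLim (extend hP A) x f := by
  have hBx := h.isLimitOperator_extend hP hA
  have hPB : P ∘L extend hP A = extend hP A := ContinuousLinearMap.ext (proj_extend hP A)
  exact h.isLimitOperator_proj.comp_eq hBx (by rwa [hPB]) f

theorem IsAdmissible.weakLim_extend_proj (h : S.IsAdmissible P x)
    (hA : IsBandDominated (extend hP A)) (f : Lp ℂ p μ) :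
    S.weakLim (extend hP A) x (S.weakLim P x f) = S.weakLim (extend hP A) x f := by
  have hBx := h.isLimitOperator_extend hP hA
  have hPB : extend hP A ∘L P = extend hP A := ContinuousLinearMap.ext (extend_proj hP A)
  exact hBx.comp_eq h.isLimitOperator_proj (by rwa [hPB]) f

theorem IsAdmissible.weakLim_one_sub (h : S.IsAdmissible P x) :
    S.weakLim (1 - P) x = 1 - S.weakLim P x :=
  (IsLimitOperator.one.sub h.isLimitOperator_proj).weakLim_eq

/-- An inverse of `A` modulo compact operators bounds the inverses of all limit operators. -/
theorem IsAdmissible.isUnit_limitOp (h : S.IsAdmissible P x) (hx : x ∈ boundary X)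
    (hA : IsBandDominated (extend hP A)) {T : M →L[ℂ] M} (hTA : IsCompactOperator (T * A - 1 : M →L[ℂ] M))
    (hAT : IsCompactOperator (A * T - 1 : M →L[ℂ] M)) :
    IsUnit (S.limitOp hP A x) ∧ ‖Ring.inverse (S.limitOp hP A x)‖ ≤ ‖T‖ := by
  have hBx := h.isLimitOperator_extend hP hA
  refine isUnit_compress_of_forall_le h.weakLim_idem (h.weakLim_proj_extend hP hA)
    (h.weakLim_extend_proj hP hA) (ContinuousLinearMap.opNorm_nonneg T) (fun f hf => ?_)
    (dual_comp_weakLim_eq_zero hP hx h.isLimitOperator_proj hBx hAT)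
  have := norm_weakLim_le hP hx h.isLimitOperator_proj hBx hTA f
  rwa [hf] at this

theorem IsAdmissible.isUnit_limitOp_iff (h : S.IsAdmissible P x)
    (hA : IsBandDominated (extend hP A)) :
    IsUnit (S.limitOp hP A x)
      ↔ IsUnit (S.weakLim (extend hP A) x + (1 - S.weakLim P x)) :=
  isUnit_compress_iff h.weakLim_idem (h.weakLim_proj_extend hP hA) (h.weakLim_extend_proj hP hA)

theorem IsAdmissible.hatLimitOp_eq (h : S.IsAdmissible P x)
    (hA : IsBandDominated (extend hP A)) :
    S.hatLimitOp hP A x = S.weakLim (extend hP A) x + (1 - S.weakLim P x) := by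
  rw [hatLimitOp, h.weakLim_one_sub]
  congr 1
  ext1 f
  exact (coe_compress (h.weakLim_proj_extend hP hA) _).trans (h.weakLim_extend_proj hP hA f)

end ShiftSystem

/-! ### Fredholm operators and the Calkin algebra -/

section Calkin

variable {E : Type*} [NormedAddCommGroup E] [NormedSpace ℂ E]

theorem isCompactOperator_of_hasFiniteRange {T : E →L[ℂ] E}
    (hT : T.toLinearMap.HasFiniteRange) : IsCompactOperator T := by
  have : FiniteDimensional ℂ T.range := Module.Finite.iff_fg.2 hT
  have : LocallyCompactSpace T.range := .of_finiteDimensional_of_complete ℂ T.range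
  have h : IsCompactOperator T.rangeRestrict :=
    isCompactOperator_of_locallyCompactSpace_dom T.rangeRestrict
  exact isCompactOperator_comp_left h T.range.subtypeL

theorem mk_eq_mk_iff {S T : E →L[ℂ] E} :
    Ideal.Quotient.mk (compactIdeal E) S = Ideal.Quotient.mk (compactIdeal E) T ↔
      IsCompactOperator (S - T) :=
  Ideal.Quotient.eq

theorem exists_unit_of_isFredholm {A : E →L[ℂ] E} (hA : A.IsFredholm) :
    ∃ u : (Calkin E)ˣ, (u : Calkin E) = Ideal.Quotient.mk (compactIdeal E) A := by
  obtain ⟨T, h1, h2⟩ := ContinuousLinearMap.isFredholm_iff_exists_isQuasiInverse.1 hA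
  have h3 : IsCompactOperator (T * A - 1 : E →L[ℂ] E) := isCompactOperator_of_hasFiniteRange
    (LinearMap.FiniteRangeSetoid.equiv_iff_hasFiniteRange.1 h1)
  have h4 : IsCompactOperator (A * T - 1 : E →L[ℂ] E) := isCompactOperator_of_hasFiniteRange
    (LinearMap.FiniteRangeSetoid.equiv_iff_hasFiniteRange.1 h2)
  refine ⟨⟨Ideal.Quotient.mk _ A, Ideal.Quotient.mk _ T, ?_, ?_⟩, rfl⟩
  · rw [← map_mul, ← map_one (Ideal.Quotient.mk (compactIdeal E))]
    exact mk_eq_mk_iff.2 h4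
  · rw [← map_mul, ← map_one (Ideal.Quotient.mk (compactIdeal E))]
    exact mk_eq_mk_iff.2 h3

theorem isCompactOperator_of_unit {A T : E →L[ℂ] E} {u : (Calkin E)ˣ}
    (hA : (u : Calkin E) = Ideal.Quotient.mk (compactIdeal E) A)
    (hT : Ideal.Quotient.mk (compactIdeal E) T = ((u⁻¹ : (Calkin E)ˣ) : Calkin E)) :
    IsCompactOperator (T * A - 1 : E →L[ℂ] E) ∧ IsCompactOperator (A * T - 1 : E →L[ℂ] E) := by
  constructor
  · rw [← mk_eq_mk_iff, map_mul, map_one, hT, ← hA, u.inv_mul]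
  · rw [← mk_eq_mk_iff, map_mul, map_one, hT, ← hA, u.mul_inv]

end Calkin

/-! ### Almost eigenfunctions at infinity -/

/-- If `T` is localizable and has almost eigenfunctions to the eigenvalue `0` arbitrarily far out,
then these can be cut down to bounded pieces that accumulate at a single point `x` of the boundary.
It is essential that `x` does not depend on the precision `(1 / 2) ^ k`: the pieces for all `k < m`
are found around the same centre. -/
theorem IsLpDecomp.exists_concentration {X F : Type*} [MetricSpace X] [NormedAddCommGroup F]
    [NormedSpace ℂ F] {Z : Set X} {q : ℝ} {M : Z → F →L[ℂ] F} (D : IsLpDecomp q M) (hq : 0 < q)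
    {T : F →L[ℂ] F} (hT : IsLocalizable M T) (x₀ : X) (b : ℝ)
    (h : ∀ m : ℕ, ∃ f, f ≠ 0 ∧ ‖T f‖ ≤ (1 / 2) ^ m * ‖f‖ ∧
      ∀ i, M i f ≠ 0 → m - b ≤ dist (i : X) x₀) :
    ∃ x ∈ boundary X, ∀ k : ℕ, ∃ r : ℝ, ∀ s ∈ approach x, ∃ i : Z, (i : X) ∈ s ∧
      ∃ g, g ≠ 0 ∧ (∀ l, M l g ≠ 0 → dist l i ≤ r) ∧ ‖T g‖ ≤ (1 / 2) ^ k * ‖g‖ := by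
  obtain ⟨r, hr⟩ := D.exists_nested hq hT
  choose f hf0 hf hfi using h
  choose i hi hig using fun m => hr m (f m) (hf0 m) (hf m)
  have hlim : Tendsto (fun m => dist (i m : X) x₀) atTop atTop :=
    tendsto_atTop_mono (fun m => hfi m _ (hi m))
      (tendsto_atTop_add_const_right _ (-b) tendsto_natCast_atTop_atTop)
  obtain ⟨x, hx, hfreq⟩ := exists_mem_boundary x₀ hlim
  refine ⟨x, hx, fun k => ⟨r k, fun s hs => ?_⟩⟩
  obtain ⟨m, hm, hkm⟩ := ((hfreq s hs).and_eventually (eventually_gt_atTop k)).exists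
  exact ⟨i m, hm, hig m k hkm⟩

theorem exists_mul_half_pow_lt_one (c : ℝ) : ∃ k : ℕ, c * (2 * (1 / 2) ^ k) < 1 := by
  obtain ⟨k, hk⟩ := exists_pow_lt_of_lt_one (show 0 < 1 / (2 * (|c| + 1)) by positivity)
    (show (1 / 2 : ℝ) < 1 by norm_num)
  refine ⟨k, ?_⟩
  rw [lt_div_iff₀ (by positivity)] at hk
  calc c * (2 * (1 / 2) ^ k) ≤ (|c| + 1) * (2 * (1 / 2) ^ k) := by
        gcongr
        linarith [le_abs_self c]
    _ = (1 / 2) ^ k * (2 * (|c| + 1)) := by ring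
    _ < 1 := hk

namespace ShiftSystem

variable {X : Type*} [MetricSpace X] [ProperSpace X] [MeasurableSpace X] [BorelSpace X]
  {μ : Measure X} [μ.Regular] {p : ℝ≥0∞} [Fact (1 ≤ p)] {S : ShiftSystem μ p} {x : StoneCech X}
  {T C : Lp ℂ p μ →L[ℂ] Lp ℂ p μ}

/-- Almost eigenfunctions of `T` near `x` with uniformly bounded supports are shifted to almost
eigenfunctions of the limit operator. -/
theorem IsLimitOperator.exists_norm_le (hC : S.IsLimitOperator T x C) {k : ℕ} {r : ℝ}
    (h : ∀ s ∈ approach x, ∃ y ∈ s, ∃ g, g ≠ 0 ∧ ballInd μ p y r g = g ∧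
      ‖T g‖ ≤ (1 / 2) ^ k * ‖g‖) : ∃ g, g ≠ 0 ∧ ‖C g‖ ≤ 2 * (1 / 2) ^ k * ‖g‖ := by
  obtain ⟨n, hn⟩ := exists_nat_ge r
  obtain ⟨y, hy, g, hg0, hgr, hg⟩ := h _ ((hC.right n).eventually
    (Metric.ball_mem_nhds _ (show (0 : ℝ) < (1 / 2) ^ k by positivity)))
  replace hy : dist (S.conj y T ∘L S.cut n) (C ∘L S.cut n) < (1 / 2) ^ k := hy
  rw [dist_eq_norm] at hy
  refine ⟨S.U y g, by simpa using hg0, ?_⟩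
  have h1 : S.cut n (S.U y g) = S.U y g := by
    have h2 : ballInd μ p S.x₀ r (S.U y g) = S.U y g := by rw [← S.U_ballInd, hgr]
    rw [← h2]
    exact ballInd_ballInd S.x₀ hn _
  have h2 : S.conj y T (S.U y g) = S.U y (T g) := by simp [conj_apply]
  have h3 : C (S.U y g) = S.U y (T g)
      - (S.conj y T ∘L S.cut n - C ∘L S.cut n) (S.U y g) := by
    simp [h1, h2]
  rw [h3]
  refine (norm_sub_le _ _).trans ?_
  rw [LinearIsometryEquiv.norm_map, LinearIsometryEquiv.norm_map]
  have h4 := (S.conj y T ∘L S.cut n - C ∘L S.cut n).le_of_opNorm_le hy.le (S.U y g)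
  rw [LinearIsometryEquiv.norm_map] at h4
  linarith

/-- The counterpart of `exists_norm_le` for the transposes of `T` and `C`. -/
theorem IsLimitOperator.exists_norm_comp_le (hC : S.IsLimitOperator T x C) {k : ℕ} {r : ℝ}
    (h : ∀ s ∈ approach x, ∃ y ∈ s, ∃ ψ : StrongDual ℂ (Lp ℂ p μ), ψ ≠ 0 ∧
      ψ ∘L ballInd μ p y r = ψ ∧ ‖ψ ∘L T‖ ≤ (1 / 2) ^ k * ‖ψ‖) :
    ∃ ψ : StrongDual ℂ (Lp ℂ p μ), ψ ≠ 0 ∧ ‖ψ ∘L C‖ ≤ 2 * (1 / 2) ^ k * ‖ψ‖ := by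
  obtain ⟨n, hn⟩ := exists_nat_ge r
  obtain ⟨y, hy, ψ, hψ0, hψr, hψ⟩ := h _ ((hC.left n).eventually
    (Metric.ball_mem_nhds _ (show (0 : ℝ) < (1 / 2) ^ k by positivity)))
  replace hy : dist (S.cut n ∘L S.conj y T) (S.cut n ∘L C) < (1 / 2) ^ k := hy
  rw [dist_eq_norm] at hy
  set η : StrongDual ℂ (Lp ℂ p μ) :=
    ψ ∘L (((S.U y).symm : Lp ℂ p μ ≃L[ℂ] Lp ℂ p μ) : Lp ℂ p μ →L[ℂ] Lp ℂ p μ)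
  have hη : ∀ f, η f = ψ ((S.U y).symm f) := fun f => rfl
  have hψη : ‖ψ‖ ≤ ‖η‖ := ContinuousLinearMap.opNorm_le_bound _ (norm_nonneg _) fun f => by
    have := η.le_opNorm (S.U y f)
    rwa [hη, LinearIsometryEquiv.symm_apply_apply, LinearIsometryEquiv.norm_map] at this
  refine ⟨η, fun h0 => hψ0 ?_, ?_⟩
  · rw [h0, norm_zero] at hψη
    exact norm_le_zero_iff.1 hψη
  have h1 : ∀ f, η (S.cut n f) = η f := fun f => by
    have h2 : ∀ f, ψ (ballInd μ p y r f) = ψ f := fun f =>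
      congrArg (fun φ : StrongDual ℂ (Lp ℂ p μ) => φ f) hψr
    rw [hη, cut, U_symm_ballInd, ← h2, ballInd_ballInd' y hn, h2, hη]
  have h3 : η ∘L C = η ∘L S.conj y T - η ∘L (S.cut n ∘L S.conj y T - S.cut n ∘L C) := by
    ext f
    simp [h1]
  have h4 : ‖η ∘L S.conj y T‖ ≤ (1 / 2) ^ k * ‖η‖ := by
    refine le_trans ?_ (hψ.trans (by gcongr))
    refine ContinuousLinearMap.opNorm_le_bound _ (norm_nonneg _) fun f => ?_
    have h5 : (η ∘L S.conj y T) f = (ψ ∘L T) ((S.U y).symm f) := by simp [hη, conj_apply]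
    rw [h5]
    simpa only [LinearIsometryEquiv.norm_map] using (ψ ∘L T).le_opNorm ((S.U y).symm f)
  rw [h3]
  refine (norm_sub_le _ _).trans ?_
  have h5 : ‖η ∘L (S.cut n ∘L S.conj y T - S.cut n ∘L C)‖ ≤ ‖η‖ * (1 / 2) ^ k :=
    (ContinuousLinearMap.opNorm_comp_le _ _).trans (by gcongr)
  linarith

/-- A band-dominated operator all of whose limit operators are invertible is bounded below on
functions that vanish on a large ball, and so is its transpose. -/
theorem exists_le_at_infinity (hgeom : BoundedGeometry X) (hA' : PropertyA' X)
    (hT : IsBandDominated T)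
    (hlim : ∀ x ∈ boundary X, ∃ C, S.IsLimitOperator T x C ∧ IsUnit C) :
    (∃ n : ℕ, ∀ f, S.cut n f = 0 → ‖f‖ ≤ 2 ^ n * ‖T f‖) ∧
      ∃ n : ℕ, ∀ ψ : StrongDual ℂ (Lp ℂ p μ), ψ ∘L S.cut n = 0 → ‖ψ‖ ≤ 2 ^ n * ‖ψ ∘L T‖ := by
  have : Nonempty X := ⟨S.x₀⟩
  obtain ⟨Z, c, b, hZ, hZA, hb, hcb, hc⟩ := exists_net hgeom hA'
  have D : IsLpDecomp p.toReal (fun i => mulInd μ p (hc i)) := isLpDecomp_cells S.lt_top.ne hc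
  have hp1 : 1 < p.toReal := S.one_lt_toReal
  have hp0 : 0 < p.toReal := zero_lt_one.trans hp1
  have hpq := Real.HolderConjugate.conjExponent hp1
  have hq0 := hpq.symm.pos
  -- `T` is a norm limit of block band operators with respect to the cells of the net
  have hblock : ∀ δ : ℝ, 0 < δ → ∃ T' R, IsBlockBand (fun i => mulInd μ p (hc i)) T' R ∧
      ‖T - T'‖ ≤ δ := by
    intro δ hδ
    obtain ⟨T', R, hT', hTT'⟩ := hT δ hδ
    refine ⟨T', |R| + 2 * b, fun i k hik f => ?_, hTT'⟩
    have h1 := le_abs_self R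
    refine hT' _ _ _ _ (lt_setDist (r := dist i k - 2 * b) (by linarith)
      (by linarith [abs_nonneg R]) fun u hu v hv => ?_) f
    rw [mem_preimage, mem_singleton_iff] at hu hv
    have h2 := hcb u
    have h3 := hcb v
    rw [hu] at h2
    rw [hv] at h3
    have h4 := dist_triangle4 (i : X) v u k
    rw [dist_comm v u, dist_comm u (k : X)] at h4
    rw [Subtype.dist_eq]
    linarith
  have hblock' : ∀ δ : ℝ, 0 < δ → ∃ T' R,
      IsBlockBand (fun i => adj (mulInd μ p (hc i))) T' R ∧ ‖adj T - T'‖ ≤ δ := by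
    intro δ hδ
    obtain ⟨T', R, hT', hTT'⟩ := hblock δ hδ
    refine ⟨adj T', R, fun i k hik ψ => ?_, ?_⟩
    · ext f
      have := hT' k i (by rwa [dist_comm]) f
      simp [adj_apply, this]
    · rw [← adj_sub]
      exact (norm_adj_le _).trans hTT'
  have hcell : ∀ (i z : Z) (r : ℝ), dist i z ≤ r →
      c ⁻¹' {i} ⊆ Metric.closedBall (z : X) (r + b) := by
    intro i z r hi u hu
    rw [mem_preimage, mem_singleton_iff] at hu
    have h2 := hcb u
    rw [hu] at h2
    have h3 := dist_triangle u (i : X) z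
    rw [dist_comm u (i : X)] at h3
    rw [Subtype.dist_eq] at hi
    rw [Metric.mem_closedBall]
    linarith
  have hfar : ∀ (m : ℕ) (i : Z), ¬ c ⁻¹' {i} ⊆ Metric.closedBall S.x₀ m →
      m - b ≤ dist (i : X) S.x₀ := by
    intro m i h
    obtain ⟨u, hu, hum⟩ := not_subset.1 h
    rw [mem_preimage, mem_singleton_iff] at hu
    rw [Metric.mem_closedBall, not_le] at hum
    have h2 := hcb u
    rw [hu] at h2
    have h3 := dist_triangle u (i : X) S.x₀
    rw [dist_comm u (i : X)] at h3
    linarith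
  constructor
  · by_contra! h
    obtain ⟨x, hx, hconc⟩ := D.exists_concentration hp0 (D.isLocalizable hZA hp1.le hblock)
      S.x₀ b fun m => by
        obtain ⟨f, hf0, hf⟩ := h m
        refine ⟨f, ?_, ?_, fun i hi => hfar m i fun hsub => hi ?_⟩
        · rintro rfl
          simp at hf
        · have h1 : (1 / 2 : ℝ) ^ m * (2 ^ m * ‖T f‖) = ‖T f‖ := by
            rw [← mul_assoc, ← mul_pow]
            norm_num
          rw [← h1]
          gcongr
        · have h1 : mulInd μ p (hc i) (S.cut m f) = mulInd μ p (hc i) f :=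
            mulInd_of_subset _ _ hsub f
          rw [← h1, hf0, map_zero]
    obtain ⟨C, hC, hCu⟩ := hlim x hx
    obtain ⟨k, hk⟩ := exists_mul_half_pow_lt_one ‖Ring.inverse C‖
    obtain ⟨r, hr⟩ := hconc k
    obtain ⟨g, hg0, hg⟩ := hC.exists_norm_le (k := k) (r := r + b) fun s hs => by
      obtain ⟨i, his, g, hg0, hgr, hg⟩ := hr s hs
      refine ⟨i, his, g, hg0, ?_, hg⟩
      have h1 := (D.hasSum hp0 g).mapL (ballInd μ p (i : X) (r + b))
      have h2 : ∀ l, ballInd μ p (i : X) (r + b) (mulInd μ p (hc l) g) = mulInd μ p (hc l) g := by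
        intro l
        by_cases hl : mulInd μ p (hc l) g = 0
        · rw [hl, map_zero]
        · exact mulInd_of_superset _ _ (hcell l i r (hgr l hl)) g
      simp only [h2] at h1
      exact h1.unique (D.hasSum hp0 g)
    have h1 : Ring.inverse C (C g) = g :=
      congrArg (fun B : Lp ℂ p μ →L[ℂ] Lp ℂ p μ => B g) (Ring.inverse_mul_cancel C hCu)
    have h2 := (Ring.inverse C).le_opNorm_of_le hg
    rw [h1] at h2
    have h3 : 0 < ‖g‖ := norm_pos_iff.2 hg0
    nlinarith
  · by_contra! h
    obtain ⟨x, hx, hconc⟩ := (D.dual hpq).exists_concentration hq0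
      ((D.dual hpq).isLocalizable hZA hpq.symm.lt.le hblock') S.x₀ b fun m => by
        obtain ⟨ψ, hψ0, hψ⟩ := h m
        refine ⟨ψ, ?_, ?_, fun i hi => hfar m i fun hsub => hi ?_⟩
        · rintro rfl
          simp at hψ
        · have h1 : (1 / 2 : ℝ) ^ m * (2 ^ m * ‖ψ ∘L T‖) = ‖ψ ∘L T‖ := by
            rw [← mul_assoc, ← mul_pow]
            norm_num
          rw [adj_apply, ← h1]
          gcongr
        · ext f
          have h1 : S.cut m (mulInd μ p (hc i) f) = mulInd μ p (hc i) f :=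
            mulInd_of_superset _ _ hsub f
          have h2 := congrArg (fun φ : StrongDual ℂ (Lp ℂ p μ) => φ (mulInd μ p (hc i) f)) hψ0
          rw [ContinuousLinearMap.comp_apply, h1] at h2
          exact h2
    obtain ⟨C, hC, hCu⟩ := hlim x hx
    obtain ⟨k, hk⟩ := exists_mul_half_pow_lt_one ‖Ring.inverse C‖
    obtain ⟨r, hr⟩ := hconc k
    obtain ⟨ψ, hψ0, hψ⟩ := hC.exists_norm_comp_le (k := k) (r := r + b) fun s hs => by
      obtain ⟨i, his, ψ, hψ0, hψr, hψ⟩ := hr s hs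
      refine ⟨i, his, ψ, hψ0, ?_, hψ⟩
      have h1 := ((D.dual hpq).hasSum hq0 ψ).mapL (adj (ballInd μ p (i : X) (r + b)))
      have h2 : ∀ l, adj (ballInd μ p (i : X) (r + b)) (adj (mulInd μ p (hc l)) ψ)
          = adj (mulInd μ p (hc l)) ψ := by
        intro l
        by_cases hl : adj (mulInd μ p (hc l)) ψ = 0
        · rw [hl, map_zero]
        · ext f
          exact congrArg ψ (mulInd_of_subset _ _ (hcell l i r (hψr l hl)) f)
      simp only [h2] at h1
      exact h1.unique ((D.dual hpq).hasSum hq0 ψ)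
    have h1 : ψ = (ψ ∘L C) ∘L Ring.inverse C := by
      ext f
      exact congrArg (fun B : Lp ℂ p μ →L[ℂ] Lp ℂ p μ => ψ (B f))
        (Ring.mul_inverse_cancel C hCu).symm
    have h2 : ‖ψ‖ ≤ 2 * (1 / 2) ^ k * ‖ψ‖ * ‖Ring.inverse C‖ := by
      calc ‖ψ‖ = ‖(ψ ∘L C) ∘L Ring.inverse C‖ := by rw [← h1]
        _ ≤ ‖ψ ∘L C‖ * ‖Ring.inverse C‖ := ContinuousLinearMap.opNorm_comp_le _ _
        _ ≤ _ := by gcongr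
    have h3 : 0 < ‖ψ‖ := norm_pos_iff.2 hψ0
    nlinarith

/-! ### Invertible limit operators imply the Fredholm property -/

variable {X : Type*} [MetricSpace X] [ProperSpace X] [MeasurableSpace X] [BorelSpace X]
  {μ : Measure X} [μ.Regular] {p : ℝ≥0∞} [Fact (1 ≤ p)] {S : ShiftSystem μ p}
  {M : Submodule ℂ (Lp ℂ p μ)} {P : Lp ℂ p μ →L[ℂ] Lp ℂ p μ}
  (hP : LinearMap.IsProj M P.toLinearMap) {A : M →L[ℂ] M}

/-- Lower bounds for `A P + 1 - P` and its transpose at infinity are lower bounds for `A` and its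
transpose modulo the compact operators `M_n P` and `P M_n`. -/
theorem isFredholm_of_le_at_infinity (hM : IsClosed (M : Set (Lp ℂ p μ))) {n m : ℕ}
    (hn : IsCompactOperator (S.cut n ∘L P)) (hm : IsCompactOperator (P ∘L S.cut m))
    (h : ∀ f, S.cut n f = 0 → ‖f‖ ≤ 2 ^ n * ‖(extend hP A + (1 - P)) f‖)
    (h' : ∀ ψ : StrongDual ℂ (Lp ℂ p μ), ψ ∘L S.cut m = 0 →
      ‖ψ‖ ≤ 2 ^ m * ‖ψ ∘L (extend hP A + (1 - P))‖) : A.IsFredholm := by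
  have : CompleteSpace M := hM.completeSpace_coe
  set T := extend hP A + (1 - P)
  set c := P.codRestrict M hP.map_mem
  have hidem : ∀ k f, S.cut k (S.cut k f) = S.cut k f := fun k f => ballInd_ballInd S.x₀ le_rfl f
  have hPM : ∀ f : M, P f = f := fun f => hP.map_id _ f.2
  have hK : IsCompactOperator (S.cut n ∘L P ∘L M.subtypeL) :=
    isCompactOperator_comp_right hn M.subtypeL
  have hK' : IsCompactOperator (c ∘L S.cut m) :=
    IsCompactOperator.codRestrict (V := M) hm (fun f => hP.map_mem _) hM
  refine isFredholm_of_le hK hK' (C := 2 ^ n * (1 + ‖T‖) + 1)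
    (C' := 2 ^ m * (‖c‖ + ‖T‖) + 1) (fun f => ?_) fun φ => ?_
  · have h1 := h (f - S.cut n f) (by rw [map_sub, hidem, sub_self])
    have h2 : T f = A f := by
      change A (c f) + ((f : Lp ℂ p μ) - P f) = A f
      rw [codRestrict_proj hP, hPM, sub_self, add_zero]
    have h3 : (S.cut n ∘L P ∘L M.subtypeL) f = S.cut n f := congrArg (S.cut n) (hPM f)
    rw [h3]
    set g : Lp ℂ p μ := S.cut n f
    have h4 : ‖T (f - g)‖ ≤ ‖A f‖ + ‖T‖ * ‖g‖ := by
      rw [map_sub, h2]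
      refine (norm_sub_le _ _).trans ?_
      gcongr
      · exact le_rfl
      · exact T.le_opNorm g
    have h5 : ‖f‖ ≤ ‖(f : Lp ℂ p μ) - g‖ + ‖g‖ := by
      have := norm_add_le ((f : Lp ℂ p μ) - g) g
      rwa [sub_add_cancel] at this
    have h6 := norm_nonneg (A f)
    have h7 := norm_nonneg g
    have h8 := norm_nonneg T
    have h9 : (0 : ℝ) < 2 ^ n := by positivity
    calc ‖f‖ ≤ 2 ^ n * (‖A f‖ + ‖T‖ * ‖g‖) + ‖g‖ := h5.trans (by
          gcongr
          exact h1.trans (by gcongr))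
      _ ≤ (2 ^ n * (1 + ‖T‖) + 1) * (‖A f‖ + ‖g‖) := by
        have h10 : 0 ≤ (2 : ℝ) ^ n * ‖T‖ * ‖A f‖ := by positivity
        have h11 : 0 ≤ (2 : ℝ) ^ n * ‖g‖ := by positivity
        nlinarith
  · set ψ : StrongDual ℂ (Lp ℂ p μ) := φ ∘L c
    have h1 := h' (ψ - ψ ∘L S.cut m) (by
      ext f
      simp [hidem])
    have h2 : ψ ∘L T = (φ ∘L A) ∘L c := by
      ext f
      have h3 : c (T f) = A (c f) := by
        refine Subtype.ext ?_
        change P (extend hP A f + (f - P f)) = extend hP A f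
        rw [map_add, map_sub, proj_extend hP, proj_apply_proj hP, sub_self, add_zero]
      exact congrArg φ h3
    set η : StrongDual ℂ (Lp ℂ p μ) := φ ∘L c ∘L S.cut m
    have h3 : ψ ∘L S.cut m = η := rfl
    rw [h3] at h1
    have h4 : ‖(ψ - η) ∘L T‖ ≤ ‖φ ∘L A‖ * ‖c‖ + ‖η‖ * ‖T‖ := by
      rw [ContinuousLinearMap.sub_comp, h2]
      refine (norm_sub_le _ _).trans ?_
      gcongr
      · exact ContinuousLinearMap.opNorm_comp_le _ _
      · exact ContinuousLinearMap.opNorm_comp_le _ _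
    have h5 : ‖φ‖ ≤ ‖ψ‖ := ContinuousLinearMap.opNorm_le_bound _ (norm_nonneg _) fun f => by
      have h6 : ψ f = φ f := congrArg φ (codRestrict_proj hP f)
      have := ψ.le_opNorm f
      rwa [h6] at this
    have h6 : ‖ψ‖ ≤ ‖ψ - η‖ + ‖η‖ := by
      have := norm_add_le (ψ - η) η
      rwa [sub_add_cancel] at this
    calc ‖φ‖ ≤ 2 ^ m * (‖φ ∘L A‖ * ‖c‖ + ‖η‖ * ‖T‖) + ‖η‖ := h5.trans (h6.trans (by
          gcongr
          exact h1.trans (by gcongr)))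
      _ ≤ (2 ^ m * (‖c‖ + ‖T‖) + 1) * (‖φ ∘L A‖ + ‖η‖) := by
        have h9 := norm_nonneg (φ ∘L A)
        have h10 : 0 ≤ (2 : ℝ) ^ m * ‖T‖ * ‖φ ∘L A‖ := by positivity
        have h11 : 0 ≤ (2 : ℝ) ^ m * ‖c‖ * ‖η‖ := by positivity
        nlinarith

end ShiftSystem

end LimitOperators

end

theorem theorem4p32
    -- the space
    {X : Type*} [MetricSpace X] [ProperSpace X] [MeasurableSpace X] [BorelSpace X]
    (hgeom : LimitOperators.BoundedGeometry X) (hA' : LimitOperators.PropertyA' X)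
    (hunb : ¬ Bornology.IsBounded (Set.univ : Set X))
    (μ : Measure X) [μ.Regular]
    -- the exponent, the shifts
    (p : ℝ≥0∞) [Fact (1 ≤ p)] (S : LimitOperators.ShiftSystem μ p)
    -- the subspace and the projection
    (M : Submodule ℂ (Lp ℂ p μ)) (hM : IsClosed (M : Set (Lp ℂ p μ)))
    (P : Lp ℂ p μ →L[ℂ] Lp ℂ p μ) (hP : LinearMap.IsProj M P.toLinearMap)
    (hPband : P ∈ LimitOperators.BDO μ p)
    (hPcompact : ∀ (K : Set X) (hK : IsCompact K),
      IsCompactOperator (LimitOperators.mulInd μ p hK.measurableSet ∘L P) ∧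
      IsCompactOperator (P ∘L LimitOperators.mulInd μ p hK.measurableSet))
    -- norm-continuous extension to `βX`
    (hPext : ∀ (K K' : Set X) (hK : IsCompact K) (hK' : IsCompact K'),
      ∃ F : StoneCech X → (Lp ℂ p μ →L[ℂ] Lp ℂ p μ), Continuous F ∧
        ∀ x : X, F (stoneCechUnit x) =
          LimitOperators.mulInd μ p hK.measurableSet ∘L S.conj x P ∘L
            LimitOperators.mulInd μ p hK'.measurableSet)
    -- the band-dominated operator
    (A : M →L[ℂ] M) (hA : LimitOperators.extend hP A ∈ LimitOperators.BDO μ p) :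
    -- the limit operators are well defined
    (∀ x ∈ LimitOperators.boundary X,
      S.IsWeakLimit P x (S.weakLim P x) ∧
      S.IsWeakLimit (1 - P) x (S.weakLim (1 - P) x) ∧
      S.IsWeakLimit (LimitOperators.extend hP A) x (S.weakLim (LimitOperators.extend hP A) x) ∧
      ∀ f : (S.weakLim P x).range,
        (S.limitOp hP A x f : Lp ℂ p μ) = S.weakLim (LimitOperators.extend hP A) x f) ∧
    -- the equivalence
    List.TFAE
      [A.IsFredholm,
       (∀ x ∈ LimitOperators.boundary X, IsUnit (S.limitOp hP A x)) ∧
         ∃ C : ℝ, ∀ x ∈ LimitOperators.boundary X, ‖Ring.inverse (S.limitOp hP A x)‖ ≤ C,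
       ∀ x ∈ LimitOperators.boundary X, IsUnit (S.limitOp hP A x),
       ∀ x ∈ LimitOperators.boundary X, IsUnit (S.hatLimitOp hP A x)] ∧
    -- the norm estimate
    (A.IsFredholm →
      ∃ u : (LimitOperators.Calkin M)ˣ,
        (u : LimitOperators.Calkin M) = Ideal.Quotient.mk (LimitOperators.compactIdeal M) A ∧
        ∀ x ∈ LimitOperators.boundary X,
          ‖Ring.inverse (S.limitOp hP A x)‖ ≤ ‖((u⁻¹ : (LimitOperators.Calkin M)ˣ) :
            LimitOperators.Calkin M)‖) := by

  have hband := LimitOperators.isBandDominated_of_mem hPband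
  have hAband := LimitOperators.isBandDominated_of_mem hA
  have hadm : ∀ x, S.IsAdmissible P x := fun x => by
    refine ⟨LimitOperators.proj_apply_proj hP, hband,
      fun y r => (hPcompact _ (isCompact_closedBall y r)).1,
      fun y r => (hPcompact _ (isCompact_closedBall y r)).2, fun n m => ?_⟩
    obtain ⟨F, hF, hFx⟩ := hPext _ _ (isCompact_closedBall S.x₀ n) (isCompact_closedBall S.x₀ m)
    exact ⟨F x, ((hF.tendsto x).comp tendsto_comap).congr hFx⟩
  have hfwd : A.IsFredholm → ∃ u : (LimitOperators.Calkin M)ˣ,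
      (u : LimitOperators.Calkin M) = Ideal.Quotient.mk (LimitOperators.compactIdeal M) A ∧
      ∀ T : M →L[ℂ] M, Ideal.Quotient.mk (LimitOperators.compactIdeal M) T
        = ((u⁻¹ : (LimitOperators.Calkin M)ˣ) : LimitOperators.Calkin M) →
      ∀ x ∈ LimitOperators.boundary X, IsUnit (S.limitOp hP A x) ∧
        ‖Ring.inverse (S.limitOp hP A x)‖ ≤ ‖T‖ := by
    intro hfred
    obtain ⟨u, hu⟩ := LimitOperators.exists_unit_of_isFredholm hfred
    refine ⟨u, hu, fun T hT x hx => ?_⟩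
    obtain ⟨h1, h2⟩ := LimitOperators.isCompactOperator_of_unit hu hT
    exact (hadm x).isUnit_limitOp hP hx hAband h1 h2
  refine ⟨fun x _ => ⟨?_, ?_, ?_, ?_⟩, ?_, fun hfred => ?_⟩
  · exact (hadm x).isLimitOperator_proj.isWeakLimit
  · rw [(hadm x).weakLim_one_sub]
    exact (LimitOperators.ShiftSystem.IsLimitOperator.one.sub
      (hadm x).isLimitOperator_proj).isWeakLimit
  · exact ((hadm x).isLimitOperator_extend hP hAband).isWeakLimit
  · exact LimitOperators.coe_compress ((hadm x).weakLim_proj_extend hP hAband)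
  · have h43 : ∀ x, IsUnit (S.hatLimitOp hP A x) ↔ IsUnit (S.limitOp hP A x) := fun x => by
      rw [(hadm x).hatLimitOp_eq hP hAband, (hadm x).isUnit_limitOp_iff hP hAband]
    tfae_have 1 → 2 := fun hfred => by
      obtain ⟨u, -, hu⟩ := hfwd hfred
      obtain ⟨T, hT⟩ := Ideal.Quotient.mk_surjective
        ((u⁻¹ : (LimitOperators.Calkin M)ˣ) : LimitOperators.Calkin M)
      exact ⟨fun x hx => (hu T hT x hx).1, ‖T‖, fun x hx => (hu T hT x hx).2⟩
    tfae_have 2 → 3 := fun h => h.1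
    tfae_have 3 → 4 := fun h x hx => (h43 x).2 (h x hx)
    tfae_have 4 → 1 := fun h => by
      obtain ⟨⟨n, hn⟩, m, hm⟩ := LimitOperators.ShiftSystem.exists_le_at_infinity (S := S) hgeom hA'
        (hAband.add (LimitOperators.isBandDominated_one.sub hband)) fun x hx =>
          ⟨_, ((hadm x).isLimitOperator_extend hP hAband).add
            (LimitOperators.ShiftSystem.IsLimitOperator.one.sub (hadm x).isLimitOperator_proj),
            (hadm x).hatLimitOp_eq hP hAband ▸ h x hx⟩
      exact LimitOperators.ShiftSystem.isFredholm_of_le_at_infinity hP hM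
        (hPcompact _ (isCompact_closedBall S.x₀ n)).1
        (hPcompact _ (isCompact_closedBall S.x₀ m)).2 hn hm
    tfae_finish
  · obtain ⟨u, hu, hT⟩ := hfwd hfred
    -- the quotient norm of `u⁻¹` is the infimum of `‖T‖` over its representatives `T`
    refine ⟨u, hu, fun x hx => le_csInf ?_ ?_⟩
    · obtain ⟨T, hT⟩ := Ideal.Quotient.mk_surjective
        ((u⁻¹ : (LimitOperators.Calkin M)ˣ) : LimitOperators.Calkin M)
      exact ⟨‖T‖, T, hT, rfl⟩
    · rintro _ ⟨T, hTu, rfl⟩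
      exact (hT T hTu x hx).2
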